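/- Fix $\lambda,\tau>0$. Real $2\times2$ matrices carry the Euclidean (Frobenius) norm, and $\mathrm{dist}(\cdot,SO(2))$ is the distance in this norm. Write $Q_r=(-r,r)^2\subset\mathbb R^2$ and $Q=Q_{1/2}$; for $R^-,R^+\in SO(2)$ put $$I_{R^-,R^+}(x)=R^-\ \text{ if }x_1<0,\qquad I_{R^-,R^+}(x)=R^+\ \text{ if }x_1\ge 0 .$$ For $\varepsilon>0$ let $\mathcal C_\varepsilon(Q)$ be the class of pairs $(A,S)$ with $A\in L^1(Q;\mathbb R^{2\times2})$ and $S\subset Q$ relatively closed in $Q$ such that (H1) $S\supseteq \mathrm{supp}(\mathrm{Curl}\,A)$, where $\mathrm{Curl}\,A$ is the distributional row-wise curl in $Q$; (H2) $\int_\gamma A\in\tau\varepsilon\mathbb Z^2$ for every simple closed rectifiable curve $\gamma$ in $Q\setminus S$. Here the circulation is understood weakly: if $D\subset Q$ is the bounded open set with $\partial D=\gamma$, then, up to a sign given by the orientation of $\gamma$, $\int_\gamma A$ is the vector $\int_Q A\,\nabla^\perp\varphi\,dx$ with $\nabla^\perp\varphi=(\partial_2\varphi,-\partial_1\varphi)$,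 for any $\varphi\in C_c^\infty(Q)$ with $\varphi=1$ on $D$ and $(\mathrm{supp}\,\varphi)\setminus D\subset Q\setminus S$. Let $B_{\lambda\varepsilon}(S)=\{x\in Q:\mathrm{dist}(x,S)<\lambda\varepsilon\}$ (empty if $S=\emptyset$), and define in $[0,\infty]$ $$\mathcal F_\varepsilon(A,S,Q)=\int_{Q\setminus B_{\lambda\varepsilon}(S)}\mathrm{dist}^2(A(x),SO(2))\,dx+|B_{\lambda\varepsilon}(S)|,\qquad F_\varepsilon(A,Q)=\frac1\varepsilon\inf\{\mathcal F_\varepsilon(A,S,Q):(A,S)\in\mathcal C_\varepsilon(Q)\},$$ $$\psi_0(R^-,R^+)=\inf\Big\{\liminf_{\varepsilon\to0^+}\frac1\varepsilon\mathcal F_\varepsilon(A_\varepsilon,S_\varepsilon,Q)\;:\;(A_\varepsilon,S_\varepsilon)\in\mathcal C_\varepsilon(Q)\ \text{for all }\varepsilon>0,\ \ A_\varepsilon\,\chi_{Q\setminus B_{\lambda\varepsilon}(S_\varepsilon)}\to I_{R^-,R^+}\ \text{in }L^1(Q)\ \text{as }\varepsilon\to0^+\Big\}.$$ **Theorem.**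 For all $R^-,R^+\in SO(2)$ there is a family $(A_\varepsilon)_{\varepsilon>0}$ of fields $A_\varepsilon:\mathbb R^2\to\mathbb R^{2\times2}$ with $A_\varepsilon\in L^1(Q_{1/2};\mathbb R^{2\times2})$ such that $$A_\varepsilon\to I_{R^-,R^+}\ \text{ in }L^1(Q_{1/2};\mathbb R^{2\times2})\qquad\text{and}\qquad \lim_{\varepsilon\to0^+}F_\varepsilon(A_\varepsilon,Q_{1/2})=\psi_0(R^-,R^+),$$ and such that for every $\delta\in(0,\tfrac14)$ there is $\varepsilon_\delta>0$ with $$A_\varepsilon(x)=I_{R^-,R^+}(x)\qquad\text{for all }x\in\mathbb R^2\text{ with }|x_1|>\delta\text{ and all }\varepsilon\in(0,\varepsilon_\delta).$$ -/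

import Mathlib

open MeasureTheory Filter Topology Set
open scoped ENNReal ContDiff Matrix

namespace GrainBoundary

noncomputable section

/-- The Euclidean plane. -/
abbrev Plane : Type := EuclideanSpace ℝ (Fin 2)

/-- Real `2 × 2` matrices. -/
abbrev Mat : Type := Matrix (Fin 2) (Fin 2) ℝ

/-- The group of rotations, as a set of matrices. -/
def SO2 : Set Mat := {R | R ∈ Matrix.specialOrthogonalGroup (Fin 2) ℝ}

/-- The Euclidean (Frobenius) norm of a matrix. -/
def frobNorm (M : Mat) : ℝ := √(∑ i, ∑ j, M i j ^ 2)

/-- The distance `dist(M, SO(2))` in the Euclidean norm. -/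
def distSO2 (M : Mat) : ℝ := ⨅ R : SO2, frobNorm (M - R)

/-- `A ∈ L¹(Ω; ℝ^{2×2})`. -/
def IsL1 (Ω : Set Plane) (A : Plane → Mat) : Prop :=
  ∀ i j, IntegrableOn (fun x => A x i j) Ω

/-- The open square of side `2 r` centred at the origin. -/
def square (r : ℝ) : Set Plane := {x | |x 0| < r ∧ |x 1| < r}

/-- The field equal to `Rm` on `{x₁ < 0}` and to `Rp` on `{x₁ ≥ 0}`. -/
def interfaceField (Rm Rp : Mat) (x : Plane) : Mat :=
  if x 0 < 0 then Rm else Rp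

/-- The class `C_c^∞(U)` of real test functions. -/
def IsTest (U : Set Plane) (φ : Plane → ℝ) : Prop :=
  ContDiff ℝ ∞ φ ∧ HasCompactSupport φ ∧ tsupport φ ⊆ U

/-- The rotated gradient `∇^⊥ φ = J ∇φ = (∂₂φ, -∂₁φ)`. -/
def perpGrad (φ : Plane → ℝ) (x : Plane) : Fin 2 → ℝ :=
  ![fderiv ℝ φ x (EuclideanSpace.single 1 1), -fderiv ℝ φ x (EuclideanSpace.single 0 1)]

/-- The vector `∫_Ω A ∇^⊥ φ dx`. For `φ ∈ C_c^∞(Ω)` its `i`-th entry is the distribution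
`Curl A^i = ∂₁ A_{i2} - ∂₂ A_{i1}` (curl of the `i`-th row of `A`) applied to `φ`. -/
def curlPairing (Ω : Set Plane) (A : Plane → Mat) (φ : Plane → ℝ) : Fin 2 → ℝ :=
  fun i => ∫ x in Ω, (A x *ᵥ perpGrad φ x) i

/-- The support in `Ω` of the distribution `Curl A`: the points of `Ω` that have no open
neighbourhood in `Ω` on which `Curl A` vanishes. -/
def curlSupport (Ω : Set Plane) (A : Plane → Mat) : Set Plane :=
  {x ∈ Ω | ∀ U : Set Plane, IsOpen U → U ⊆ Ω → x ∈ U →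
    ∃ φ : Plane → ℝ, IsTest U φ ∧ curlPairing Ω A φ ≠ 0}

/-- `γ`, restricted to `[0,1]`, is a simple closed rectifiable curve. -/
structure IsSimpleClosedRectifiable (γ : ℝ → Plane) : Prop where
  continuousOn : ContinuousOn γ (Icc 0 1)
  closed : γ 0 = γ 1
  simple : InjOn γ (Ico 0 1)
  rectifiable : BoundedVariationOn γ (Icc 0 1)

/-- `D ⊆ Ω` is the region enclosed by the curve `γ`: the bounded open set whose boundary is
the image of `γ`. -/
def IsEnclosedRegion (Ω : Set Plane) (γ : ℝ → Plane) (D : Set Plane) : Prop :=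
  IsOpen D ∧ Bornology.IsBounded D ∧ D ⊆ Ω ∧ frontier D = γ '' Icc 0 1

/-- The test functions through which the weak circulation along `γ = ∂D` is defined. -/
def IsCirculationTest (Ω S D : Set Plane) (φ : Plane → ℝ) : Prop :=
  IsTest Ω φ ∧ (∀ x ∈ D, φ x = 1) ∧ tsupport φ \ D ⊆ Ω \ S

/-- The class `𝒞_ε(Ω)` of admissible pairs `(A, S)`.

The weak circulation `∫_γ A` is the vector `∫_Ω A ∇^⊥ φ dx` up to a sign that depends on the
orientation of `γ`. The lattice `τ ε ℤ²` is symmetric, so that this sign plays no role. -/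
structure Admissible (τ ε : ℝ) (Ω : Set Plane) (A : Plane → Mat) (S : Set Plane) : Prop where
  /-- `A ∈ L¹(Ω)`. -/
  integrable : IsL1 Ω A
  /-- `S` is a relatively closed subset of `Ω`. -/
  relClosed : ∃ C : Set Plane, IsClosed C ∧ S = Ω ∩ C
  /-- `S` contains the support of `Curl A`. -/
  curl : curlSupport Ω A ⊆ S
  /-- The circulation of `A` along every simple closed rectifiable curve in `Ω \ S` lies in
  `τ ε ℤ²`. -/
  circulation : ∀ γ : ℝ → Plane, IsSimpleClosedRectifiable γ → γ '' Icc 0 1 ⊆ Ω \ S →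
    ∀ D : Set Plane, IsEnclosedRegion Ω γ D →
    ∀ φ : Plane → ℝ, IsCirculationTest Ω S D φ →
    ∃ k : Fin 2 → ℤ, ∀ i, curlPairing Ω A φ i = τ * ε * k i

/-- The `r`-neighbourhood of `S` in `Ω` (empty if `S` is). -/
def nbhd (Ω : Set Plane) (r : ℝ) (S : Set Plane) : Set Plane :=
  Ω ∩ Metric.thickening r S

/-- The elastic energy `∫_{Ω' \ B_{λε}(S)} dist²(A, SO(2)) dx`. -/
def elasticEnergy (lam ε : ℝ) (Ω : Set Plane) (A : Plane → Mat) (S Ω' : Set Plane) : ℝ≥0∞ :=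
  ∫⁻ x in Ω' \ nbhd Ω (lam * ε) S, ENNReal.ofReal (distSO2 (A x) ^ 2)

/-- The core energy `|B_{λε}(S) ∩ Ω'|`. -/
def coreEnergy (lam ε : ℝ) (Ω S Ω' : Set Plane) : ℝ≥0∞ :=
  volume (nbhd Ω (lam * ε) S ∩ Ω')

/-- The energy `ℱ_ε(A, S; Ω')`. -/
def pairEnergy (lam ε : ℝ) (Ω : Set Plane) (A : Plane → Mat) (S Ω' : Set Plane) : ℝ≥0∞ :=
  elasticEnergy lam ε Ω A S Ω' + coreEnergy lam ε Ω S Ω'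

/-- The rescaled energy `F_ε(A; Ω') = ε⁻¹ inf {ℱ_ε(A, S; Ω') : (A, S) ∈ 𝒞_ε(Ω)}`. -/
def fieldEnergy (lam τ ε : ℝ) (Ω : Set Plane) (A : Plane → Mat) (Ω' : Set Plane) : ℝ≥0∞ :=
  ENNReal.ofReal ε⁻¹ * ⨅ (S : Set Plane) (_ : Admissible τ ε Ω A S), pairEnergy lam ε Ω A S Ω'

/-- The family `A_ε` converges to `B` in `L¹(Ω)` as `ε → 0⁺`. -/
def TendstoL1 (Ω : Set Plane) (A : ℝ → Plane → Mat) (B : Plane → Mat) : Prop :=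
  Tendsto (fun ε : ℝ => ∫⁻ x in Ω, ENNReal.ofReal (frobNorm (A ε x - B x))) (𝓝[>] 0) (𝓝 0)

/-- The optimal grain boundary energy `ψ₀(R⁻, R⁺, Q)`: the infimum of
`liminf_{ε → 0⁺} ε⁻¹ ℱ_ε(A_ε, S_ε; Q)` over all families `(A_ε, S_ε) ∈ 𝒞_ε(Q)` such that
`A_ε χ_{Q \ B_{λε}(S_ε)} → I_{R⁻,R⁺}` in `L¹(Q)`. -/
def psiZeroOn (lam τ : ℝ) (Rm Rp : Mat) (Q : Set Plane) : ℝ≥0∞ :=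
  ⨅ (A : ℝ → Plane → Mat) (S : ℝ → Set Plane)
    (_ : ∀ ε : ℝ, 0 < ε → Admissible τ ε Q (A ε) (S ε))
    (_ : TendstoL1 Q (fun ε => (Q \ nbhd Q (lam * ε) (S ε)).indicator (A ε))
      (interfaceField Rm Rp)),
    liminf (fun ε : ℝ => ENNReal.ofReal ε⁻¹ * pairEnergy lam ε Q (A ε) (S ε) Q) (𝓝[>] 0)

/-- `ψ₀(R⁻, R⁺)`, computed on the unit square. -/
def psiZero (lam τ : ℝ) (Rm Rp : Mat) : ℝ≥0∞ :=
  psiZeroOn lam τ Rm Rp (square (1 / 2))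

end

end GrainBoundary

/-!
The fields are obtained by stacking rescaled copies of one almost optimal pair along the interface;
this needs a form of admissibility that can be localized, glued and rescaled.

*Admissibility as a lattice condition.* In a convex open domain, a pair `(A, S)` with `A` integrable
and `S` relatively closed is admissible if and only if the pairing of `Curl A` with every test
function that is equal to an integer constant near each point of `S` lies in the lattice `τ ε ℤ²`.
One implication is immediate (`Admissible.of_inLattice`). For the other one (`Admissible.inLattice`)
the test function is replaced by a combination of indicator functions of unions of cells of a fine
grid. The boundary of such a union contains a simple grid cycle, which is a rectifiable curve in the
complement of `S`; its enclosed region is described by a parity count, and removing it reduces the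
number of boundary edges. In this form admissibility is stable under cutting, gluing and rescaling.

*Adjusting phases.* When fields are modified in a column, horizontal segments are added to the core.
The test functions that vanish on these segments see the old fields, so that the only obstruction
is a homomorphism from the values on the segments to `ℝ² / τ ε ℤ²`. It extends to a free abelian
group, since the quotient is divisible, and it is then removed by a shear which is constant on each
strip between segments and whose size is of order `τ ε` (`exists_shear_inLattice`).

*Fixing the field away from the axis.* By averaging, an almost optimal pair has a column of width
comparable to `ε` on which energy and distance to the interface are small. There the field is
interpolated with the constant rotation; the circulation created by the interpolation is removed by
a primitive in each strip and by the shear, and the few strips that meet the core are put into the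
new core (`exists_admissible_eq_interface`).

*Stacking.* A single good pair at the scale `ε₀`, equal to the interface outside of a thin column,
is rescaled by `h = ε / ε₀` and stacked along the interface. The copies are separated by
segments in the core, and the phases are adjusted by another shear. Relative to the scale, the
energy changes only by terms which are small for a small column width, a small `ε₀` and a small
`h` (`exists_stack`), and the resulting field equals the interface outside of a column of width of
order `h`. A diagonal choice gives the fields of the theorem.

*Lower bound.* Almost optimal cores for fields whose energy is bounded have vanishing area, so that
the fields, cut off in these cores, compete in the definition of `ψ₀` (`tendsto_fieldEnergy`).
-/

namespace GrainBoundary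

/-! ### Test functions and the curl pairing -/

/-- `φ` is locally constant with an integer value near every point of `S`. -/
def IsIntegerNear (S : Set Plane) (φ : Plane → ℝ) : Prop :=
  ∀ s ∈ S, ∃ n : ℤ, φ =ᶠ[𝓝 s] fun _ => (n : ℝ)

/-- The vector `v` lies in the square lattice `c ℤ²`. -/
def InLattice (c : ℝ) (v : Fin 2 → ℝ) : Prop := ∃ k : Fin 2 → ℤ, ∀ i, v i = c * k i

theorem InLattice.zero (c : ℝ) : InLattice c 0 := ⟨0, by simp⟩

theorem InLattice.add {c : ℝ} {v w : Fin 2 → ℝ} (hv : InLattice c v) (hw : InLattice c w) :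
    InLattice c (v + w) := by
  obtain ⟨k, hk⟩ := hv
  obtain ⟨l, hl⟩ := hw
  exact ⟨k + l, fun i => by simp [hk, hl, mul_add]⟩

theorem InLattice.neg {c : ℝ} {v : Fin 2 → ℝ} (hv : InLattice c v) : InLattice c (-v) := by
  obtain ⟨k, hk⟩ := hv
  exact ⟨-k, fun i => by simp [hk]⟩

theorem InLattice.sub {c : ℝ} {v w : Fin 2 → ℝ} (hv : InLattice c v) (hw : InLattice c w) :
    InLattice c (v - w) := sub_eq_add_neg v w ▸ hv.add hw.neg

theorem InLattice.sum {c : ℝ} {ι : Type*} (s : Finset ι) {v : ι → Fin 2 → ℝ}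
    (hv : ∀ i ∈ s, InLattice c (v i)) : InLattice c (∑ i ∈ s, v i) := by
  classical
  induction s using Finset.induction_on with
  | empty => simpa using InLattice.zero c
  | insert a s ha ih =>
    rw [Finset.sum_insert ha]
    exact (hv a (by simp)).add (ih fun i hi => hv i (by simp [hi]))

section IsTest

variable {U V : Set Plane} {φ ψ f : Plane → ℝ}

theorem IsTest.mono (h : IsTest U φ) (hUV : U ⊆ V) : IsTest V φ := ⟨h.1, h.2.1, h.2.2.trans hUV⟩

theorem IsTest.differentiable (h : IsTest U φ) : Differentiable ℝ φ :=
  h.1.differentiable (by simp)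

theorem IsTest.eq_zero (h : IsTest U φ) {x : Plane} (hx : x ∉ U) : φ x = 0 :=
  image_eq_zero_of_notMem_tsupport fun h' => hx (h.2.2 h')

theorem IsTest.eventually_eq_zero (h : IsTest U φ) {x : Plane} (hx : x ∉ U) : φ =ᶠ[𝓝 x] 0 :=
  notMem_tsupport_iff_eventuallyEq.1 fun h' => hx (h.2.2 h')

theorem IsTest.add (h : IsTest U φ) (h' : IsTest U ψ) : IsTest U (φ + ψ) :=
  ⟨h.1.add h'.1, h.2.1.add h'.2.1,
    (tsupport_add _ _).trans (union_subset h.2.2 h'.2.2)⟩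

theorem IsTest.mul_left (hf : ContDiff ℝ ∞ f) (h : IsTest U φ) : IsTest U (f * φ) :=
  ⟨hf.mul h.1, h.2.1.mul_left, (tsupport_mul_subset_right).trans h.2.2⟩

theorem IsTest.const_mul (c : ℝ) (h : IsTest U φ) : IsTest U (fun x => c * φ x) :=
  h.mul_left (f := fun _ => c) contDiff_const

theorem IsTest.neg (h : IsTest U φ) : IsTest U (-φ) := by
  convert h.const_mul (-1) using 1
  ext x
  simp

theorem IsTest.sub (h : IsTest U φ) (h' : IsTest U ψ) : IsTest U (φ - ψ) :=
  sub_eq_add_neg φ ψ ▸ h.add h'.neg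

theorem IsTest.zero : IsTest U (0 : Plane → ℝ) :=
  ⟨contDiff_const, HasCompactSupport.zero, by simp [tsupport]⟩

theorem IsTest.sum {ι : Type*} (s : Finset ι) {φ : ι → Plane → ℝ}
    (h : ∀ i ∈ s, IsTest U (φ i)) : IsTest U (∑ i ∈ s, φ i) := by
  classical
  induction s using Finset.induction_on with
  | empty => simpa using IsTest.zero
  | insert a s ha ih =>
    rw [Finset.sum_insert ha]
    exact (h a (by simp)).add (ih fun i hi => h i (by simp [hi]))

theorem IsTest.of_tsupport_subset (h : IsTest U φ) (hV : tsupport φ ⊆ V) : IsTest V φ :=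
  ⟨h.1, h.2.1, hV⟩

/-- A test function that vanishes near the frontier of `E` can be cut off outside of `E`. -/
theorem IsTest.indicator (h : IsTest U φ) {E : Set Plane}
    (hE : ∀ x ∈ frontier E, φ =ᶠ[𝓝 x] 0) : IsTest U (E.indicator φ) := by
  have hsub : tsupport (E.indicator φ) ⊆ tsupport φ := by
    apply closure_mono
    intro x hx
    simp only [Function.mem_support, ne_eq, indicator_apply_eq_zero, not_forall] at hx
    obtain ⟨_, hx⟩ := hx
    exact hx
  refine ⟨?_, h.2.1.mono' (subset_closure.trans hsub), hsub.trans h.2.2⟩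
  rw [contDiff_iff_contDiffAt]
  intro x
  by_cases hx : x ∈ interior E
  · refine h.1.contDiffAt.congr_of_eventuallyEq ?_
    filter_upwards [isOpen_interior.mem_nhds hx] with y hy
    exact indicator_of_mem (interior_subset hy) _
  by_cases hx' : x ∈ closure E
  · have := hE x ⟨hx', hx⟩
    refine (contDiffAt_const (c := (0 : ℝ))).congr_of_eventuallyEq ?_
    filter_upwards [this] with y hy
    simp only [indicator_apply_eq_zero]
    exact fun _ => hy
  · refine (contDiffAt_const (c := (0 : ℝ))).congr_of_eventuallyEq ?_
    filter_upwards [isClosed_closure.isOpen_compl.mem_nhds hx'] with y hy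
    exact indicator_of_notMem (fun h' => hy (subset_closure h')) _

end IsTest

/-- A smooth cutoff function between a compact set and an open set. -/
theorem exists_isTest_eq_one {K U : Set Plane} (hK : IsCompact K) (hU : IsOpen U) (hKU : K ⊆ U) :
    ∃ ρ : Plane → ℝ, IsTest U ρ ∧ ∀ x ∈ K, ρ =ᶠ[𝓝 x] fun _ => 1 := by
  obtain ⟨K', hK', hKK', hK'U⟩ := exists_compact_between hK hU hKU
  obtain ⟨f, hf1, hf0, -⟩ := exists_contMDiffMap_one_nhds_of_subset_interior
    (n := (⊤ : ℕ∞)) (modelWithCornersSelf ℝ Plane) hK.isClosed hKK'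
  have hsub : tsupport (f : Plane → ℝ) ⊆ K' := by
    refine closure_minimal (fun x hx => ?_) hK'.isClosed
    by_contra h
    exact hx (hf0 x h)
  refine ⟨f, ⟨f.contMDiff.contDiff, ?_, hsub.trans hK'U⟩, fun x hx => ?_⟩
  · exact hK'.of_isClosed_subset (isClosed_tsupport _) hsub
  · exact hf1.filter_mono (nhds_le_nhdsSet hx)

section perpGrad

variable {φ ψ : Plane → ℝ} {x : Plane}

theorem perpGrad_congr (h : φ =ᶠ[𝓝 x] ψ) : perpGrad φ x = perpGrad ψ x := by
  simp only [perpGrad, h.fderiv_eq]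

theorem perpGrad_const (c : ℝ) : perpGrad (fun _ => c) x = 0 := by
  ext i
  fin_cases i <;> simp [perpGrad]

theorem perpGrad_eq_zero_of_eventuallyEq {c : ℝ} (h : φ =ᶠ[𝓝 x] fun _ => c) :
    perpGrad φ x = 0 := (perpGrad_congr h).trans (perpGrad_const c)

theorem perpGrad_eq_zero_of_notMem_tsupport (h : x ∉ tsupport φ) : perpGrad φ x = 0 :=
  perpGrad_eq_zero_of_eventuallyEq (c := 0) (notMem_tsupport_iff_eventuallyEq.1 h)

theorem perpGrad_add (h : Differentiable ℝ φ) (h' : Differentiable ℝ ψ) :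
    perpGrad (φ + ψ) x = perpGrad φ x + perpGrad ψ x := by
  ext i
  fin_cases i <;> simp [perpGrad, fderiv_add (h x) (h' x)]
  ring

theorem perpGrad_mul (h : Differentiable ℝ φ) (h' : Differentiable ℝ ψ) :
    perpGrad (φ * ψ) x = φ x • perpGrad ψ x + ψ x • perpGrad φ x := by
  ext i
  fin_cases i <;> simp [perpGrad, fderiv_mul (h x) (h' x)]
  ring

theorem perpGrad_const_mul (c : ℝ) (h : Differentiable ℝ φ) :
    perpGrad (fun y => c * φ y) x = c • perpGrad φ x := by
  have := perpGrad_mul (φ := fun _ => c) (ψ := φ) (x := x) (differentiable_const c) h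
  rw [perpGrad_const, smul_zero, add_zero] at this
  exact this

theorem continuous_perpGrad (h : ContDiff ℝ ∞ φ) : Continuous (perpGrad φ) := by
  have h1 : Continuous (fderiv ℝ φ) := h.continuous_fderiv (by simp)
  refine continuous_pi fun i => ?_
  fin_cases i
  · exact h1.clm_apply continuous_const
  · exact (h1.clm_apply continuous_const).neg

theorem exists_perpGrad_bound {U : Set Plane} (h : IsTest U φ) :
    ∃ C : ℝ, ∀ x i, ‖perpGrad φ x i‖ ≤ C := by
  have hc := continuous_perpGrad h.1
  have hs : HasCompactSupport (perpGrad φ) :=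
    h.2.1.mono' fun x hx => by
      by_contra h'
      exact hx (perpGrad_eq_zero_of_notMem_tsupport h')
  obtain ⟨C, hC⟩ := hs.exists_bound_of_continuous hc
  exact ⟨C, fun x i => (norm_le_pi_norm _ i).trans (hC x)⟩

end perpGrad

section curlPairing

variable {Ω U : Set Plane} {A B : Plane → Mat} {φ ψ : Plane → ℝ}

theorem integrableOn_mulVec_perpGrad (hA : IsL1 Ω A) (hφ : IsTest U φ) (i : Fin 2) :
    IntegrableOn (fun x => (A x *ᵥ perpGrad φ x) i) Ω := by
  obtain ⟨C, hC⟩ := exists_perpGrad_bound hφ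
  have hc := continuous_perpGrad hφ.1
  have h : ∀ j, IntegrableOn (fun x => A x i j * perpGrad φ x j) Ω := fun j =>
    Integrable.mul_bdd (c := C) (hA i j)
      ((continuous_apply j).comp hc).aestronglyMeasurable
      (Eventually.of_forall fun x => hC x j)
  have h2 := (h 0).add (h 1)
  refine h2.congr (Eventually.of_forall fun x => ?_)
  simp [Matrix.mulVec, dotProduct, Fin.sum_univ_two]

theorem curlPairing_add (hA : IsL1 Ω A) (hφ : IsTest U φ) (hψ : IsTest U ψ) :
    curlPairing Ω A (φ + ψ) = curlPairing Ω A φ + curlPairing Ω A ψ := by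
  ext i
  simp only [curlPairing, Pi.add_apply]
  rw [← integral_add (integrableOn_mulVec_perpGrad hA hφ i)
    (integrableOn_mulVec_perpGrad hA hψ i)]
  congr 1
  ext x
  rw [perpGrad_add hφ.differentiable hψ.differentiable, Matrix.mulVec_add, Pi.add_apply]

theorem curlPairing_const_mul (hφ : IsTest U φ) (c : ℝ) :
    curlPairing Ω A (fun x => c * φ x) = c • curlPairing Ω A φ := by
  ext i
  simp only [curlPairing, Pi.smul_apply, smul_eq_mul]
  rw [← integral_const_mul]
  congr 1
  ext x
  rw [perpGrad_const_mul c hφ.differentiable, Matrix.mulVec_smul, Pi.smul_apply, smul_eq_mul]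

theorem curlPairing_neg (hφ : IsTest U φ) :
    curlPairing Ω A (-φ) = -curlPairing Ω A φ := by
  have := curlPairing_const_mul (Ω := Ω) (A := A) hφ (-1)
  rw [neg_one_smul] at this
  rw [← this]
  congr 1
  ext x
  simp

theorem curlPairing_sub (hA : IsL1 Ω A) (hφ : IsTest U φ) (hψ : IsTest U ψ) :
    curlPairing Ω A (φ - ψ) = curlPairing Ω A φ - curlPairing Ω A ψ := by
  rw [sub_eq_add_neg, curlPairing_add hA hφ hψ.neg, curlPairing_neg hψ, sub_eq_add_neg]

theorem curlPairing_zero : curlPairing Ω A 0 = 0 := by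
  ext i
  have : perpGrad (0 : Plane → ℝ) = 0 := by
    ext1 x
    exact perpGrad_const 0
  simp [curlPairing, this]

theorem curlPairing_sum (hA : IsL1 Ω A) {ι : Type*} (s : Finset ι) {φ : ι → Plane → ℝ}
    (h : ∀ i ∈ s, IsTest U (φ i)) :
    curlPairing Ω A (∑ i ∈ s, φ i) = ∑ i ∈ s, curlPairing Ω A (φ i) := by
  classical
  induction s using Finset.induction_on with
  | empty => simpa using curlPairing_zero
  | insert a s ha ih =>
    have hs : ∀ i ∈ s, IsTest U (φ i) := fun i hi => h i (by simp [hi])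
    rw [Finset.sum_insert ha, Finset.sum_insert ha,
      curlPairing_add hA (h a (by simp)) (IsTest.sum s hs), ih hs]

/-- The pairing only sees the field on the set where the test function is not locally constant. -/
theorem curlPairing_congr (h : ∀ x, perpGrad φ x ≠ 0 → A x = B x) :
    curlPairing Ω A φ = curlPairing Ω B φ := by
  ext i
  simp only [curlPairing]
  congr 1
  ext x
  by_cases hx : perpGrad φ x = 0
  · simp [hx]
  · rw [h x hx]

theorem curlPairing_eq_integral (hφ : IsTest Ω φ) (i : Fin 2) :
    curlPairing Ω A φ i = ∫ x, (A x *ᵥ perpGrad φ x) i := by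
  apply setIntegral_eq_integral_of_forall_compl_eq_zero
  intro x hx
  rw [perpGrad_eq_zero_of_notMem_tsupport fun h => hx (hφ.2.2 h)]
  simp

theorem integral_fderiv_eq_zero (hφ : IsTest Ω φ) (v : Plane) : ∫ x, fderiv ℝ φ x v = 0 := by
  have hc : Continuous fun x => fderiv ℝ φ x v :=
    (hφ.1.continuous_fderiv (by simp)).clm_apply continuous_const
  have hs : HasCompactSupport fun x => fderiv ℝ φ x v := hφ.2.1.fderiv_apply (𝕜 := ℝ) v
  have := integral_mul_fderiv_eq_neg_fderiv_mul_of_integrable (μ := volume) (𝕜 := ℝ)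
    (f := fun _ : Plane => (1 : ℝ)) (g := φ) (v := v) (by simp)
    (by simpa using hc.integrable_of_hasCompactSupport hs)
    (by simpa using hφ.1.continuous.integrable_of_hasCompactSupport hφ.2.1)
    (fun x _ => differentiableAt_const _) (fun x _ => hφ.differentiable x)
  simpa using this

/-- Constant fields are curl free. -/
theorem curlPairing_const (hφ : IsTest Ω φ) (M : Mat) : curlPairing Ω (fun _ => M) φ = 0 := by
  ext i
  rw [curlPairing_eq_integral hφ i]
  have h : ∀ v : Plane, Integrable fun x => fderiv ℝ φ x v := fun v =>
    ((hφ.1.continuous_fderiv (by simp)).clm_apply continuous_const).integrable_of_hasCompactSupport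
      (hφ.2.1.fderiv_apply (𝕜 := ℝ) v)
  have h1 := (h (EuclideanSpace.single 1 1)).const_mul (M i 0)
  have h2 := (h (EuclideanSpace.single 0 1)).const_mul (M i 1)
  have := integral_sub h1 h2
  rw [integral_const_mul, integral_const_mul, integral_fderiv_eq_zero hφ,
    integral_fderiv_eq_zero hφ] at this
  simp only [mul_zero, sub_zero] at this
  rw [Pi.zero_apply, ← this]
  congr 1
  ext x
  simp [Matrix.mulVec, dotProduct, Fin.sum_univ_two, perpGrad]
  ring

end curlPairing

section IsIntegerNear

variable {S T : Set Plane} {φ ψ : Plane → ℝ}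

theorem IsIntegerNear.mono (h : IsIntegerNear T φ) (hST : S ⊆ T) : IsIntegerNear S φ :=
  fun s hs => h s (hST hs)

theorem IsIntegerNear.add (h : IsIntegerNear S φ) (h' : IsIntegerNear S ψ) :
    IsIntegerNear S (φ + ψ) := by
  intro s hs
  obtain ⟨n, hn⟩ := h s hs
  obtain ⟨m, hm⟩ := h' s hs
  exact ⟨n + m, by filter_upwards [hn, hm] with x h1 h2; simp [h1, h2]⟩

theorem IsIntegerNear.neg (h : IsIntegerNear S φ) : IsIntegerNear S (-φ) := by
  intro s hs
  obtain ⟨n, hn⟩ := h s hs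
  exact ⟨-n, by filter_upwards [hn] with x h1; simp [h1]⟩

theorem isIntegerNear_of_eventuallyEq_zero (h : ∀ s ∈ S, φ =ᶠ[𝓝 s] 0) : IsIntegerNear S φ :=
  fun s hs => ⟨0, (h s hs).trans (by simp; rfl)⟩

/-- Near a point where it is locally an integer constant, a function equals its value. -/
theorem IsIntegerNear.eventuallyEq (h : IsIntegerNear S φ) {s : Plane} (hs : s ∈ S) :
    φ =ᶠ[𝓝 s] fun _ => φ s := by
  obtain ⟨n, hn⟩ := h s hs
  rwa [hn.eq_of_nhds]

theorem IsIntegerNear.exists_int (h : IsIntegerNear S φ) {s : Plane} (hs : s ∈ S) :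
    ∃ n : ℤ, φ s = n := (h s hs).imp fun _ hn => hn.eq_of_nhds

/-- A function that is an integer constant near each point of a connected set is constant there. -/
theorem IsIntegerNear.eq_of_isPreconnected (h : IsIntegerNear S φ) (hS : IsPreconnected S)
    {s t : Plane} (hs : s ∈ S) (ht : t ∈ S) : φ s = φ t := by
  refine hS.constant_of_mapsTo (T := Set.range ((↑) : ℤ → ℝ)) (f := φ) ?_ ?_ ?_ hs ht
  · exact Int.isClosedEmbedding_coe_real.isInducing.isDiscrete_range
  · intro x hx
    have := (h.eventuallyEq hx)
    exact (continuousAt_const.congr this.symm).continuousWithinAt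
  · intro x hx
    obtain ⟨n, hn⟩ := h.exists_int hx
    exact ⟨n, hn.symm⟩

end IsIntegerNear

/-- Admissibility follows from a condition on all test functions that are integer near `S`. -/
theorem Admissible.of_inLattice {τ ε : ℝ} {Ω S : Set Plane} {A : Plane → Mat}
    (hΩ : IsOpen Ω) (hA : IsL1 Ω A) (hS : ∃ C : Set Plane, IsClosed C ∧ S = Ω ∩ C)
    (h : ∀ φ, IsTest Ω φ → IsIntegerNear S φ → InLattice (τ * ε) (curlPairing Ω A φ)) :
    Admissible τ ε Ω A S where
  integrable := hA
  relClosed := hS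
  curl := by
    obtain ⟨C, hC, rfl⟩ := hS
    intro x hx
    by_contra hxS
    have hxC : x ∉ C := fun h' => hxS ⟨hx.1, h'⟩
    obtain ⟨φ, hφ, hne⟩ := hx.2 (Ω ∩ Cᶜ) (hΩ.inter hC.isOpen_compl) inter_subset_left ⟨hx.1, hxC⟩
    refine hne ?_
    have hφΩ : IsTest Ω φ := hφ.mono inter_subset_left
    -- All real multiples of `φ` vanish near `S`, and a line inside of a lattice is trivial.
    have key : ∀ t : ℝ, InLattice (τ * ε) (t • curlPairing Ω A φ) := fun t => by
      rw [← curlPairing_const_mul hφΩ t]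
      refine h _ (hφΩ.const_mul t) (isIntegerNear_of_eventuallyEq_zero fun s hs => ?_)
      filter_upwards [hφ.eventually_eq_zero (x := s) fun h' => h'.2 hs.2] with y hy
      simp [hy]
    ext i
    by_contra hi
    simp only [Pi.zero_apply] at hi
    obtain ⟨k, hk⟩ := key (τ * ε / 2 / curlPairing Ω A φ i)
    obtain ⟨l, hl⟩ := key 1
    have h1 := hk i
    have h2 := hl i
    simp only [Pi.smul_apply, smul_eq_mul, div_mul_cancel₀ _ hi, one_mul] at h1 h2
    rcases eq_or_ne (τ * ε) 0 with h0 | h0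
    · rw [h0, zero_mul] at h2
      exact hi h2
    · have h3 : (1 : ℝ) = 2 * k i := by
        apply mul_left_cancel₀ h0
        linear_combination 2 * h1
      have h4 : (1 : ℤ) = 2 * k i := by exact_mod_cast h3
      omega
  circulation := by
    intro γ _ hγS D hD φ hφ
    refine h φ hφ.1 fun s hs => ?_
    by_cases hsD : s ∈ D
    · refine ⟨1, ?_⟩
      filter_upwards [hD.1.mem_nhds hsD] with x hx
      simpa using hφ.2.1 x hx
    · refine ⟨0, ?_⟩
      have : s ∉ tsupport φ := fun h' => (hφ.2.2 ⟨h', hsD⟩).2 hs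
      exact (notMem_tsupport_iff_eventuallyEq.1 this).trans (by simp; rfl)

/-! ### Cycles on the square grid -/

section Grid

/-- The vertical grid edge from `v` to `v + (0, 1)` separates two cells of which exactly one
belongs to `P`. The cell `v` has the vertex `v` as its lower left corner. -/
def VJump (P : Set (ℤ × ℤ)) (v : ℤ × ℤ) : Prop := ¬((v.1 - 1, v.2) ∈ P ↔ v ∈ P)

/-- The horizontal grid edge from `v` to `v + (1, 0)` separates two cells of which exactly one
belongs to `P`. -/
def HJump (P : Set (ℤ × ℤ)) (v : ℤ × ℤ) : Prop := ¬((v.1, v.2 - 1) ∈ P ↔ v ∈ P)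

/-- The boundary edges of `P`; the flag is true for vertical edges. -/
def jumps (P : Set (ℤ × ℤ)) : Set (Bool × ℤ × ℤ) :=
  {e | (e.1 = true ∧ VJump P e.2) ∨ (e.1 = false ∧ HJump P e.2)}

/-- Two vertices of the grid are neighbours. -/
def GridAdj (u v : ℤ × ℤ) : Prop :=
  (u.1 = v.1 ∧ (v.2 = u.2 + 1 ∨ u.2 = v.2 + 1)) ∨ (u.2 = v.2 ∧ (v.1 = u.1 + 1 ∨ u.1 = v.1 + 1))

/-- The edge between `u` and `v` is a boundary edge of `P`. -/
def JumpStep (P : Set (ℤ × ℤ)) (u v : ℤ × ℤ) : Prop :=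
  (v = (u.1, u.2 + 1) ∧ VJump P u) ∨ (u = (v.1, v.2 + 1) ∧ VJump P v) ∨
    (v = (u.1 + 1, u.2) ∧ HJump P u) ∨ (u = (v.1 + 1, v.2) ∧ HJump P v)

/-- The closed polygon with vertices `p 0, p 1, …, p n = p 0` is a simple closed curve on the
grid. -/
structure IsGridCycle (n : ℕ) (p : ℕ → ℤ × ℤ) : Prop where
  three_le : 3 ≤ n
  closed : p n = p 0
  inj : ∀ i < n, ∀ j < n, p i = p j → i = j
  adj : ∀ i < n, GridAdj (p i) (p (i + 1))

/-- The segment from `u` to `v` is the vertical edge that starts at `w`. -/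
def IsVEdge (u v w : ℤ × ℤ) : Prop := u.1 = v.1 ∧ u.1 = w.1 ∧ min u.2 v.2 = w.2

/-- The segment from `u` to `v` is the horizontal edge that starts at `w`. -/
def IsHEdge (u v w : ℤ × ℤ) : Prop := u.2 = v.2 ∧ u.2 = w.2 ∧ min u.1 v.1 = w.1

theorem VJump.finite {P : Set (ℤ × ℤ)} (hP : P.Finite) : {v | VJump P v}.Finite := by
  refine (hP.union (hP.image fun k => (k.1 + 1, k.2))).subset fun v hv => ?_
  by_contra h
  simp only [mem_union, mem_image, not_or, not_exists, not_and] at h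
  refine hv ⟨fun h' => ?_, fun h' => absurd h' h.1⟩
  exact absurd (by simp) (h.2 _ h')

theorem HJump.finite {P : Set (ℤ × ℤ)} (hP : P.Finite) : {v | HJump P v}.Finite := by
  refine (hP.union (hP.image fun k => (k.1, k.2 + 1))).subset fun v hv => ?_
  by_contra h
  simp only [mem_union, mem_image, not_or, not_exists, not_and] at h
  refine hv ⟨fun h' => ?_, fun h' => absurd h' h.1⟩
  exact absurd (by simp) (h.2 _ h')

theorem jumps_finite {P : Set (ℤ × ℤ)} (hP : P.Finite) : (jumps P).Finite := by
  refine (((VJump.finite hP).image fun v => (true, v)).union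
    ((HJump.finite hP).image fun v => (false, v))).subset ?_
  rintro ⟨b, v⟩ (⟨rfl, h⟩ | ⟨rfl, h⟩)
  · exact Or.inl ⟨v, h, rfl⟩
  · exact Or.inr ⟨v, h, rfl⟩

/-- The boundary of a set of cells has no end points. -/
theorem JumpStep.exists_next {P : Set (ℤ × ℤ)} {u v : ℤ × ℤ} (h : JumpStep P u v) :
    ∃ w, JumpStep P v w ∧ w ≠ u := by
  obtain ⟨a, b⟩ := v
  by_contra hw
  push Not at hw
  have h1 : VJump P (a, b) → (a, b + 1) = u := fun h' => hw _ (Or.inl ⟨rfl, h'⟩)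
  have h2 : VJump P (a, b - 1) → (a, b - 1) = u := fun h' => hw _ (Or.inr (Or.inl ⟨by simp, h'⟩))
  have h3 : HJump P (a, b) → (a + 1, b) = u := fun h' => hw _ (Or.inr (Or.inr (Or.inl ⟨rfl, h'⟩)))
  have h4 : HJump P (a - 1, b) → (a - 1, b) = u :=
    fun h' => hw _ (Or.inr (Or.inr (Or.inr ⟨by simp, h'⟩)))
  have key : (VJump P (a, b) ∧ u = (a, b + 1)) ∨ (VJump P (a, b - 1) ∧ u = (a, b - 1)) ∨
      (HJump P (a, b) ∧ u = (a + 1, b)) ∨ (HJump P (a - 1, b) ∧ u = (a - 1, b)) := by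
    rcases h with ⟨h, h'⟩ | ⟨h, h'⟩ | ⟨h, h'⟩ | ⟨h, h'⟩
    · obtain ⟨c, d⟩ := u
      simp only [Prod.mk.injEq] at h
      obtain ⟨rfl, rfl⟩ := h
      right; left; simpa using h'
    · exact Or.inl ⟨h', h⟩
    · obtain ⟨c, d⟩ := u
      simp only [Prod.mk.injEq] at h
      obtain ⟨rfl, rfl⟩ := h
      right; right; right; simpa using h'
    · right; right; left; exact ⟨h', h⟩
  rcases key with ⟨h, rfl⟩ | ⟨h, rfl⟩ | ⟨h, rfl⟩ | ⟨h, rfl⟩ <;>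
    simp [VJump, HJump, Prod.ext_iff] at * <;> grind

theorem JumpStep.gridAdj {P : Set (ℤ × ℤ)} {u v : ℤ × ℤ} (h : JumpStep P u v) : GridAdj u v := by
  rcases h with ⟨h, -⟩ | ⟨h, -⟩ | ⟨h, -⟩ | ⟨h, -⟩ <;> simp [GridAdj, h]

theorem JumpStep.ne {P : Set (ℤ × ℤ)} {u v : ℤ × ℤ} (h : JumpStep P u v) : u ≠ v := by
  rintro rfl
  rcases h.gridAdj with ⟨-, h⟩ | ⟨-, h⟩ <;> omega

theorem JumpStep.vJump {P : Set (ℤ × ℤ)} {u v w : ℤ × ℤ} (h : JumpStep P u v)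
    (hw : IsVEdge u v w) : VJump P w := by
  obtain ⟨a, b⟩ := u
  obtain ⟨c, d⟩ := v
  obtain ⟨e, f⟩ := w
  obtain ⟨h1, h2, h3⟩ := hw
  simp only at h1 h2 h3
  rcases h with ⟨h, h'⟩ | ⟨h, h'⟩ | ⟨h, h'⟩ | ⟨h, h'⟩ <;> simp only [Prod.mk.injEq] at h
  · have : f = b := by omega
    subst h2 this; exact h'
  · have : f = d := by omega
    subst h1 h2 this; exact h'
  · omega
  · omega

theorem JumpStep.hJump {P : Set (ℤ × ℤ)} {u v w : ℤ × ℤ} (h : JumpStep P u v)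
    (hw : IsHEdge u v w) : HJump P w := by
  obtain ⟨a, b⟩ := u
  obtain ⟨c, d⟩ := v
  obtain ⟨e, f⟩ := w
  obtain ⟨h1, h2, h3⟩ := hw
  simp only at h1 h2 h3
  rcases h with ⟨h, h'⟩ | ⟨h, h'⟩ | ⟨h, h'⟩ | ⟨h, h'⟩ <;> simp only [Prod.mk.injEq] at h
  · omega
  · omega
  · have : e = a := by omega
    subst h2 this; exact h'
  · have : e = c := by omega
    subst h1 h2 this; exact h'

/-- The boundary of a nonempty finite set of cells contains a simple closed polygon. -/
theorem exists_isGridCycle {P : Set (ℤ × ℤ)} (hP : P.Finite) (hne : P.Nonempty) :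
    ∃ n p, IsGridCycle n p ∧ ∀ m < n, JumpStep P (p m) (p (m + 1)) := by
  classical
  -- the left edge of a leftmost cell is a boundary edge
  obtain ⟨k, hk, hmin⟩ := hP.exists_minimalFor (fun k : ℤ × ℤ => k.1) _ hne
  have hstart : JumpStep P k (k.1, k.2 + 1) := by
    refine Or.inl ⟨rfl, fun h => ?_⟩
    have h1 := h.2 hk
    have h2 := hmin h1 (by simp)
    simp only at h2
    omega
  choose! next hnext hnext' using fun (e : (ℤ × ℤ) × ℤ × ℤ) (h : JumpStep P e.1 e.2) =>
    h.exists_next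
  let q : ℕ → (ℤ × ℤ) × ℤ × ℤ := fun n => (fun e => (e.2, next e))^[n] (k, (k.1, k.2 + 1))
  have hq : ∀ n, q (n + 1) = ((q n).2, next (q n)) := fun n =>
    Function.iterate_succ_apply' _ _ _
  have hstep : ∀ n, JumpStep P (q n).1 (q n).2 := by
    intro n
    induction n with
    | zero => exact hstart
    | succ n ih => rw [hq]; exact hnext _ ih
  let r : ℕ → ℤ × ℤ := fun n => (q n).1
  have hr1 : ∀ n, r (n + 1) = (q n).2 := fun n => by simp only [r, hq]
  have hr : ∀ n, JumpStep P (r n) (r (n + 1)) := fun n => by rw [hr1]; exact hstep n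
  have hr2 : ∀ n, r (n + 2) ≠ r n := fun n => by
    have : r (n + 2) = next (q n) := by rw [hr1, hq]
    rw [this]
    exact hnext' _ (hstep n)
  have hfin : (range r).Finite := by
    have h1 := VJump.finite hP
    have h2 := HJump.finite hP
    refine ((h1.union (h1.image fun v => (v.1, v.2 + 1))).union
      (h2.union (h2.image fun v => (v.1 + 1, v.2)))).subset ?_
    rintro _ ⟨n, rfl⟩
    rcases hr n with ⟨h, h'⟩ | ⟨h, h'⟩ | ⟨h, h'⟩ | ⟨h, h'⟩
    · exact Or.inl (Or.inl h')
    · exact Or.inl (Or.inr ⟨_, h', h.symm⟩)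
    · exact Or.inr (Or.inl h')
    · exact Or.inr (Or.inr ⟨_, h', h.symm⟩)
  have hex : ∃ d, 0 < d ∧ ∃ a, r (a + d) = r a := by
    have : ¬ Function.Injective r := fun h => by
      exact (infinite_range_of_injective h) hfin
    simp only [Function.Injective, not_forall] at this
    obtain ⟨a, b, hab, hne⟩ := this
    rcases lt_or_gt_of_ne hne with h | h
    · exact ⟨b - a, by omega, a, by rw [Nat.add_sub_cancel' h.le, hab]⟩
    · exact ⟨a - b, by omega, b, by rw [Nat.add_sub_cancel' h.le, hab]⟩
  obtain ⟨hd, a, ha⟩ := Nat.find_spec hex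
  set d := Nat.find hex with hdd
  have hmin' : ∀ d' < d, 0 < d' → ∀ a, r (a + d') ≠ r a := fun d' h1 h2 a h3 =>
    Nat.find_min hex h1 ⟨h2, a, h3⟩
  refine ⟨d, fun i => r (a + i), ⟨?_, ha, ?_, fun i _ => (hr _).gridAdj⟩, fun m _ => hr _⟩
  · have h1 : d ≠ 1 := by
      intro h
      rw [h] at ha
      exact (hr a).ne ha.symm
    have h2 : d ≠ 2 := by
      intro h
      rw [h] at ha
      exact hr2 a ha
    omega
  · intro i hi j hj hij
    by_contra hne
    rcases lt_or_gt_of_ne hne with h | h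
    · refine hmin' (j - i) (by omega) (by omega) (a + i) ?_
      rw [hij]; congr 1; omega
    · refine hmin' (i - j) (by omega) (by omega) (a + j) ?_
      rw [← hij]; congr 1; omega

namespace IsGridCycle

variable {n : ℕ} {p : ℕ → ℤ × ℤ}

theorem eq_of_reversed (hp : IsGridCycle n p) {i j : ℕ} (hi : i < n) (hj : j < n)
    (h1 : p i = p (j + 1)) (h2 : p (i + 1) = p j) : False := by
  have hn := hp.three_le
  have a1 : (j + 1 < n ∧ i = j + 1) ∨ (j + 1 = n ∧ i = 0) := by
    rcases Nat.lt_or_ge (j + 1) n with h | h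
    · exact Or.inl ⟨h, hp.inj _ hi _ h h1⟩
    · have h3 : j + 1 = n := by omega
      rw [h3, hp.closed] at h1
      exact Or.inr ⟨h3, hp.inj _ hi _ (by omega) h1⟩
  have a2 : (i + 1 < n ∧ i + 1 = j) ∨ (i + 1 = n ∧ j = 0) := by
    rcases Nat.lt_or_ge (i + 1) n with h | h
    · exact Or.inl ⟨h, hp.inj _ h _ hj h2⟩
    · have h3 : i + 1 = n := by omega
      rw [h3, hp.closed] at h2
      exact Or.inr ⟨h3, (hp.inj _ (by omega) _ hj h2).symm⟩
  omega

theorem vEdge_unique (hp : IsGridCycle n p) {i j : ℕ} (hi : i < n) (hj : j < n) {w : ℤ × ℤ}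
    (h1 : IsVEdge (p i) (p (i + 1)) w) (h2 : IsVEdge (p j) (p (j + 1)) w) : i = j := by
  obtain ⟨a1, a2, a3⟩ := h1
  obtain ⟨b1, b2, b3⟩ := h2
  have hi' := hp.adj i hi
  have hj' := hp.adj j hj
  unfold GridAdj at hi' hj'
  by_cases h : (p i).2 = (p j).2
  · exact hp.inj _ hi _ hj (Prod.ext (by omega) h)
  · exact (hp.eq_of_reversed hi hj (Prod.ext (by omega) (by omega))
      (Prod.ext (by omega) (by omega))).elim

theorem hEdge_unique (hp : IsGridCycle n p) {i j : ℕ} (hi : i < n) (hj : j < n) {w : ℤ × ℤ}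
    (h1 : IsHEdge (p i) (p (i + 1)) w) (h2 : IsHEdge (p j) (p (j + 1)) w) : i = j := by
  obtain ⟨a1, a2, a3⟩ := h1
  obtain ⟨b1, b2, b3⟩ := h2
  have hi' := hp.adj i hi
  have hj' := hp.adj j hj
  unfold GridAdj at hi' hj'
  by_cases h : (p i).1 = (p j).1
  · exact hp.inj _ hi _ hj (Prod.ext h (by omega))
  · exact (hp.eq_of_reversed hi hj (Prod.ext (by omega) (by omega))
      (Prod.ext (by omega) (by omega))).elim

end IsGridCycle

open Classical in
/-- Contribution of the step from `u` to `v` to the parity of the number of crossings of a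
horizontal ray that starts in the cell `k` and runs to the right. -/
noncomputable def crossing (k u v : ℤ × ℤ) : ZMod 2 :=
  if u.1 = v.1 ∧ min u.2 v.2 = k.2 ∧ k.1 < u.1 then 1 else 0

/-- The cells enclosed by a closed polygon: those from which a ray to the right crosses the
polygon an odd number of times. -/
def enclosed (n : ℕ) (p : ℕ → ℤ × ℤ) : Set (ℤ × ℤ) :=
  {k | ∑ m ∈ Finset.range n, crossing k (p m) (p (m + 1)) ≠ 0}

theorem zmod_two_iff {a b : ZMod 2} : ¬(a ≠ 0 ↔ b ≠ 0) ↔ a + b ≠ 0 := by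
  revert a b; decide

theorem sum_add_succ_eq_zero (n : ℕ) (g : ℕ → ZMod 2) (h : g n = g 0) :
    ∑ m ∈ Finset.range n, (g m + g (m + 1)) = 0 := by
  have : ∀ m, g m + g (m + 1) = g (m + 1) - g m := fun m => by
    generalize g m = a
    generalize g (m + 1) = b
    revert a b; decide
  simp only [this, Finset.sum_range_sub, h, sub_self]

open Classical in
theorem sum_ite_ne_zero_iff {n : ℕ} {q : ℕ → Prop}
    (h : ∀ i < n, ∀ j < n, q i → q j → i = j) :
    ∑ m ∈ Finset.range n, (if q m then (1 : ZMod 2) else 0) ≠ 0 ↔ ∃ m < n, q m := by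
  constructor
  · intro h0
    obtain ⟨m, hm, hm'⟩ := Finset.exists_ne_zero_of_sum_ne_zero h0
    exact ⟨m, Finset.mem_range.1 hm, by by_contra h'; simp [h'] at hm'⟩
  · rintro ⟨m, hm, hqm⟩
    rw [Finset.sum_eq_single m]
    · simp [hqm]
    · intro j hj hjm
      rw [if_neg]
      exact fun h' => hjm (h j (Finset.mem_range.1 hj) m hm h' hqm)
    · intro h'
      exact absurd (Finset.mem_range.2 hm) h'

namespace IsGridCycle

variable {n : ℕ} {p : ℕ → ℤ × ℤ}

open Classical in
theorem vJump_enclosed_iff (hp : IsGridCycle n p) (w : ℤ × ℤ) :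
    VJump (enclosed n p) w ↔ ∃ m < n, IsVEdge (p m) (p (m + 1)) w := by
  simp only [VJump, enclosed, mem_ofPred_eq]
  rw [zmod_two_iff, ← Finset.sum_add_distrib,
    ← sum_ite_ne_zero_iff fun i hi j hj => hp.vEdge_unique (w := w) hi hj]
  have : ∀ u v : ℤ × ℤ, crossing (w.1 - 1, w.2) u v + crossing w u v =
      if IsVEdge u v w then 1 else 0 := by
    intro u v
    by_cases hE : IsVEdge u v w
    all_goals
      simp only [crossing, hE, if_true, if_false]
      unfold IsVEdge at hE
      (repeat' split) <;> first | omega | rfl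
  simp only [this]

open Classical in
theorem hJump_enclosed_iff (hp : IsGridCycle n p) (w : ℤ × ℤ) :
    HJump (enclosed n p) w ↔ ∃ m < n, IsHEdge (p m) (p (m + 1)) w := by
  simp only [HJump, enclosed, mem_ofPred_eq]
  rw [zmod_two_iff, ← Finset.sum_add_distrib,
    ← sum_ite_ne_zero_iff fun i hi j hj => hp.hEdge_unique (w := w) hi hj]
  let g : ℤ × ℤ → ZMod 2 := fun u => if w.1 < u.1 ∧ u.2 = w.2 then 1 else 0
  have key : ∀ u v : ℤ × ℤ, GridAdj u v → crossing (w.1, w.2 - 1) u v + crossing w u v =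
      (if IsHEdge u v w then 1 else 0) + (g u + g v) := by
    intro u v huv
    unfold GridAdj at huv
    by_cases hE : IsHEdge u v w
    all_goals
      simp only [crossing, hE, if_true, if_false, g]
      unfold IsHEdge at hE
      (repeat' split) <;> first | omega | rfl
  have hsum := sum_add_succ_eq_zero n (fun m => g (p m)) (by simp [hp.closed])
  rw [Finset.sum_congr rfl fun m hm => key _ _ (hp.adj m (Finset.mem_range.1 hm)),
    Finset.sum_add_distrib, hsum, add_zero]

open Classical in
/-- An enclosed cell lies between two vertical edges of the polygon in the same row. -/
theorem exists_vEdge_of_mem_enclosed (hp : IsGridCycle n p) {k : ℤ × ℤ}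
    (hk : k ∈ enclosed n p) :
    (∃ m < n, ∃ w, IsVEdge (p m) (p (m + 1)) w ∧ w.2 = k.2 ∧ k.1 < w.1) ∧
      ∃ m < n, ∃ w, IsVEdge (p m) (p (m + 1)) w ∧ w.2 = k.2 ∧ w.1 ≤ k.1 := by
  constructor
  · obtain ⟨m, hm, h⟩ := Finset.exists_ne_zero_of_sum_ne_zero hk
    simp only [crossing, ne_eq, ite_eq_right_iff, one_ne_zero, imp_false, not_not] at h
    exact ⟨m, Finset.mem_range.1 hm, ((p m).1, k.2), ⟨h.1, rfl, h.2.1⟩, rfl, h.2.2⟩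
  · let g : ℤ × ℤ → ZMod 2 := fun u => if k.2 < u.2 then 1 else 0
    have key : ∀ u v : ℤ × ℤ, GridAdj u v → crossing k u v +
        (if u.1 = v.1 ∧ min u.2 v.2 = k.2 ∧ u.1 ≤ k.1 then 1 else 0) = g u + g v := by
      intro u v huv
      simp only [crossing, g]
      unfold GridAdj at huv
      (repeat' split) <;> first | omega | rfl
    have hsum := sum_add_succ_eq_zero n (fun m => g (p m)) (by simp [hp.closed])
    rw [← Finset.sum_congr rfl fun m hm => key _ _ (hp.adj m (Finset.mem_range.1 hm)),
      Finset.sum_add_distrib] at hsum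
    have h1 : ∑ m ∈ Finset.range n, (if (p m).1 = (p (m + 1)).1 ∧
        min (p m).2 (p (m + 1)).2 = k.2 ∧ (p m).1 ≤ k.1 then (1 : ZMod 2) else 0) ≠ 0 := by
      intro h0
      rw [h0, add_zero] at hsum
      exact hk hsum
    obtain ⟨m, hm, h⟩ := Finset.exists_ne_zero_of_sum_ne_zero h1
    simp only [ne_eq, ite_eq_right_iff, one_ne_zero, imp_false, not_not] at h
    exact ⟨m, Finset.mem_range.1 hm, ((p m).1, k.2), ⟨h.1, rfl, h.2.1⟩, rfl, h.2.2⟩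

theorem finite_enclosed (hp : IsGridCycle n p) : (enclosed n p).Finite := by
  have hf : (⋃ m ∈ Finset.range n, ⋃ m' ∈ Finset.range n,
      Icc (p m').1 (p m).1 ×ˢ {min (p m).2 (p (m + 1)).2}).Finite :=
    Set.Finite.biUnion (Finset.finite_toSet _) fun m _ =>
      Set.Finite.biUnion (Finset.finite_toSet _) fun m' _ =>
        (finite_Icc _ _).prod (finite_singleton _)
  refine hf.subset fun k hk => ?_
  obtain ⟨⟨m, hm, w, ⟨-, hw1, hw2⟩, hw3, hw4⟩, m', hm', w', ⟨-, hw1', hw2'⟩, hw3', hw4'⟩ :=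
    hp.exists_vEdge_of_mem_enclosed hk
  simp only [mem_iUnion, Finset.mem_range, mem_prod, mem_Icc, mem_singleton_iff, exists_prop]
  exact ⟨m, hm, m', hm', ⟨by omega, by omega⟩, by omega⟩

end IsGridCycle

end Grid

/-! ### Regions made of grid cells -/

section Region

/-- The index of the half-open cell of the grid of mesh `h` that contains `x`. -/
noncomputable def cellOf (h : ℝ) (x : Plane) : ℤ × ℤ := (⌊x 0 / h⌋, ⌊x 1 / h⌋)

/-- The union of the half-open cells with index in `D`. -/
def region (h : ℝ) (D : Set (ℤ × ℤ)) : Set Plane := {x | cellOf h x ∈ D}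

/-- The open cell with index `k`. -/
def openCell (h : ℝ) (k : ℤ × ℤ) : Set Plane :=
  {x | (k.1 < x 0 / h ∧ x 0 / h < k.1 + 1) ∧ (k.2 < x 1 / h ∧ x 1 / h < k.2 + 1)}

/-- The closed cell with index `k`. -/
def closedCell (h : ℝ) (k : ℤ × ℤ) : Set Plane :=
  {x | (k.1 ≤ x 0 / h ∧ x 0 / h ≤ k.1 + 1) ∧ (k.2 ≤ x 1 / h ∧ x 1 / h ≤ k.2 + 1)}

/-- The closed vertical edge that starts at the vertex `w`. -/
def vEdge (h : ℝ) (w : ℤ × ℤ) : Set Plane :=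
  {x | x 0 / h = w.1 ∧ w.2 ≤ x 1 / h ∧ x 1 / h ≤ w.2 + 1}

/-- The closed horizontal edge that starts at the vertex `w`. -/
def hEdge (h : ℝ) (w : ℤ × ℤ) : Set Plane :=
  {x | x 1 / h = w.2 ∧ w.1 ≤ x 0 / h ∧ x 0 / h ≤ w.1 + 1}

/-- The union of the boundary edges of a set of cells. -/
def boundaryEdges (h : ℝ) (D : Set (ℤ × ℤ)) : Set Plane :=
  {x | (∃ w, VJump D w ∧ x ∈ vEdge h w) ∨ ∃ w, HJump D w ∧ x ∈ hEdge h w}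

variable {h : ℝ} {D : Set (ℤ × ℤ)} {k : ℤ × ℤ} {x : Plane}

@[fun_prop]
theorem continuous_coord (i : Fin 2) : Continuous fun x : Plane => x i :=
  (EuclideanSpace.proj (𝕜 := ℝ) i).continuous

theorem isOpen_openCell : IsOpen (openCell h k) := by
  have h0 : Continuous fun x : Plane => x 0 / h := by fun_prop
  have h1 : Continuous fun x : Plane => x 1 / h := by fun_prop
  exact ((isOpen_lt continuous_const h0).inter (isOpen_lt h0 continuous_const)).inter
    ((isOpen_lt continuous_const h1).inter (isOpen_lt h1 continuous_const))

theorem cellOf_eq_of_mem_openCell (hx : x ∈ openCell h k) : cellOf h x = k :=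
  Prod.ext (Int.floor_eq_iff.2 ⟨hx.1.1.le, hx.1.2⟩) (Int.floor_eq_iff.2 ⟨hx.2.1.le, hx.2.2⟩)

theorem mem_closedCell_cellOf : x ∈ closedCell h (cellOf h x) :=
  ⟨⟨Int.floor_le _, (Int.lt_floor_add_one _).le⟩, ⟨Int.floor_le _, (Int.lt_floor_add_one _).le⟩⟩

theorem openCell_subset_interior_region (hk : k ∈ D) : openCell h k ⊆ interior (region h D) :=
  interior_maximal (fun x hx => by rw [region, mem_ofPred_eq, cellOf_eq_of_mem_openCell hx]; exact hk)
    isOpen_openCell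

theorem closedCell_subset_closure (hh : 0 < h) : closedCell h k ⊆ closure (openCell h k) := by
  intro x hx
  let c : Plane := !₂[h * (k.1 + 1 / 2), h * (k.2 + 1 / 2)]
  have hc0 : c 0 = h * (k.1 + 1 / 2) := rfl
  have hc1 : c 1 = h * (k.2 + 1 / 2) := rfl
  have ht : Tendsto (fun t : ℝ => x + t • (c - x)) (𝓝[>] 0) (𝓝 x) := by
    have : Continuous fun t : ℝ => x + t • (c - x) := by fun_prop
    have h0 := this.tendsto 0
    simp only [zero_smul, add_zero] at h0
    exact h0.mono_left nhdsWithin_le_nhds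
  refine mem_closure_of_tendsto ht ?_
  filter_upwards [Ioo_mem_nhdsGT (zero_lt_one' ℝ)] with t ht
  have key : ∀ (a b : ℝ) (m : ℤ), b = h * (m + 1 / 2) → m ≤ a / h → a / h ≤ m + 1 →
      m < (a + t * (b - a)) / h ∧ (a + t * (b - a)) / h < m + 1 := by
    rintro a b m rfl h1 h2
    have : (a + t * (h * (m + 1 / 2) - a)) / h = (1 - t) * (a / h) + t * (m + 1 / 2) := by
      field_simp; ring
    rw [this]
    constructor <;> nlinarith [ht.1, ht.2]
  exact ⟨key _ _ _ hc0 hx.1.1 hx.1.2, key _ _ _ hc1 hx.2.1 hx.2.2⟩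

theorem isCompact_closedCell (hh : 0 < h) : IsCompact (closedCell h k) := by
  refine Metric.isCompact_of_isClosed_isBounded ?_ ?_
  · have h0 : Continuous fun x : Plane => x 0 / h := by fun_prop
    have h1 : Continuous fun x : Plane => x 1 / h := by fun_prop
    exact ((isClosed_le continuous_const h0).inter (isClosed_le h0 continuous_const)).inter
      ((isClosed_le continuous_const h1).inter (isClosed_le h1 continuous_const))
  · refine (Metric.isBounded_iff_subset_closedBall (!₂[h * k.1, h * k.2] : Plane)).2 ⟨2 * h, ?_⟩
    rintro x ⟨⟨h1, h2⟩, h3, h4⟩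
    rw [le_div_iff₀ hh] at h1 h3
    rw [div_le_iff₀ hh] at h2 h4
    rw [Metric.mem_closedBall, EuclideanSpace.dist_eq]
    refine Real.sqrt_le_iff.2 ⟨by positivity, ?_⟩
    simp only [Fin.sum_univ_two, Real.dist_eq, sq_abs]
    simp
    nlinarith

theorem eventually_floor (x : ℝ) :
    ∀ᶠ y in 𝓝 x, (⌊y⌋ : ℤ) = ⌊x⌋ ∨ (x = ⌊x⌋ ∧ ⌊y⌋ = ⌊x⌋ - 1) := by
  have h1 : ∀ᶠ y in 𝓝 x, y < (⌊x⌋ : ℝ) + 1 := eventually_lt_nhds (Int.lt_floor_add_one x)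
  rcases (Int.floor_le x).eq_or_lt with h | h
  · have h2 : ∀ᶠ y in 𝓝 x, (⌊x⌋ : ℝ) - 1 < y := eventually_gt_nhds (by linarith)
    filter_upwards [h1, h2] with y hy hy'
    rcases le_or_gt (⌊x⌋ : ℝ) y with h3 | h3
    · exact Or.inl (Int.floor_eq_iff.2 ⟨h3, hy⟩)
    · refine Or.inr ⟨h.symm, Int.floor_eq_iff.2 ?_⟩
      push_cast
      exact ⟨hy'.le, by linarith⟩
  · have h2 : ∀ᶠ y in 𝓝 x, (⌊x⌋ : ℝ) < y := eventually_gt_nhds h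
    filter_upwards [h1, h2] with y hy hy'
    exact Or.inl (Int.floor_eq_iff.2 ⟨hy'.le, hy⟩)

theorem eventually_mem_region_iff (hx : x ∉ boundaryEdges h D) :
    ∀ᶠ y in 𝓝 x, (y ∈ region h D ↔ x ∈ region h D) := by
  have h0 : Tendsto (fun y : Plane => y 0 / h) (𝓝 x) (𝓝 (x 0 / h)) :=
    Continuous.tendsto (by fun_prop) x
  have h1 : Tendsto (fun y : Plane => y 1 / h) (𝓝 x) (𝓝 (x 1 / h)) :=
    Continuous.tendsto (by fun_prop) x
  simp only [boundaryEdges, mem_ofPred_eq, not_or, not_exists, not_and] at hx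
  obtain ⟨hV, hH⟩ := hx
  simp only [vEdge, hEdge, VJump, HJump, mem_ofPred_eq] at hV hH
  have b0 := Int.floor_le (x 0 / h)
  have b0' := (Int.lt_floor_add_one (x 0 / h)).le
  have b1 := Int.floor_le (x 1 / h)
  have b1' := (Int.lt_floor_add_one (x 1 / h)).le
  filter_upwards [h0.eventually (eventually_floor _), h1.eventually (eventually_floor _)]
    with y hy0 hy1
  simp only [region, cellOf, mem_ofPred_eq]
  generalize ⌊x 0 / h⌋ = i at *
  generalize ⌊x 1 / h⌋ = j at *
  have a1 := hV (i, j)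
  have a2 := hV (i, j - 1)
  have a3 := hH (i, j)
  push_cast at a1 a2 a3
  rcases hy0 with hy0 | ⟨e0, hy0⟩ <;> rcases hy1 with hy1 | ⟨e1, hy1⟩ <;> rw [hy0, hy1]
  · by_contra h'
    exact a3 h' ⟨e1, b0, b0'⟩
  · by_contra h'
    exact a1 h' ⟨e0, b1, b1'⟩
  · have c1 : (i - 1, j - 1) ∈ D ↔ (i, j - 1) ∈ D := by
      by_contra h'
      exact a2 h' ⟨e0, by linarith, by linarith⟩
    rw [c1]
    by_contra h'
    exact a3 h' ⟨e1, b0, b0'⟩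

theorem frontier_interior_region (hh : 0 < h) :
    frontier (interior (region h D)) = boundaryEdges h D := by
  rw [isOpen_interior.frontier_eq]
  apply Subset.antisymm
  · rintro x ⟨hx, hx'⟩
    by_contra hb
    have hev := eventually_mem_region_iff hb
    by_cases hxD : x ∈ region h D
    · refine hx' (mem_interior_iff_mem_nhds.2 ?_)
      filter_upwards [hev] with y hy using hy.2 hxD
    · have := mem_closure_iff_frequently.1 hx
      refine this ?_
      filter_upwards [hev] with y hy hy'
      exact hxD (hy.1 (interior_subset hy'))
  · have key : ∀ k l : ℤ × ℤ, ¬(k ∈ D ↔ l ∈ D) → ∀ x ∈ closedCell h k, x ∈ closedCell h l →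
        x ∈ closure (interior (region h D)) \ interior (region h D) := by
      have aux : ∀ k l : ℤ × ℤ, k ∈ D → l ∉ D → ∀ x ∈ closedCell h k, x ∈ closedCell h l →
          x ∈ closure (interior (region h D)) \ interior (region h D) := by
        intro k l hk hl x hxk hxl
        refine ⟨closure_mono (openCell_subset_interior_region hk)
          (closedCell_subset_closure hh hxk), fun hx => ?_⟩
        obtain ⟨y, hy, hy'⟩ := mem_closure_iff.1 (closedCell_subset_closure hh hxl) _
          isOpen_interior hx
        have := interior_subset hy
        rw [region, mem_ofPred_eq, cellOf_eq_of_mem_openCell hy'] at this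
        exact hl this
      intro k l hkl x hxk hxl
      by_cases hk : k ∈ D
      · exact aux k l hk (fun hl => hkl ⟨fun _ => hl, fun _ => hk⟩) x hxk hxl
      · exact aux l k (by by_contra hl; exact hkl ⟨fun h => absurd h hk, fun h => absurd h hl⟩) hk x
          hxl hxk
    rintro x (⟨w, hw, h1, h2, h3⟩ | ⟨w, hw, h1, h2, h3⟩)
    · refine key _ _ hw x ⟨⟨?_, ?_⟩, h2, h3⟩ ⟨⟨?_, ?_⟩, h2, h3⟩ <;> simp [h1]
    · refine key _ _ hw x ⟨⟨h2, h3⟩, ?_, ?_⟩ ⟨⟨h2, h3⟩, ?_, ?_⟩ <;> simp [h1]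

end Region

/-! ### Closed polygons on the grid as curves -/

section Polygon

/-- The piecewise linear interpolation of `a 0, a 1, …, a n`. -/
noncomputable def polyline (a : ℕ → ℝ) (n : ℕ) (s : ℝ) : ℝ :=
  a 0 + ∑ m ∈ Finset.range n, (a (m + 1) - a m) * max 0 (min (s - m) 1)

theorem polyline_eq (a : ℕ → ℝ) {n m : ℕ} (hm : m < n) {r : ℝ} (h0 : 0 ≤ r) (h1 : r ≤ 1) :
    polyline a n (m + r) = a m + r * (a (m + 1) - a m) := by
  have key : ∀ i ∈ Finset.range n, (a (i + 1) - a i) * max 0 (min ((m + r : ℝ) - i) 1) =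
      if i < m then a (i + 1) - a i else if i = m then r * (a (m + 1) - a m) else 0 := by
    intro i _
    split_ifs with h2 h3
    · have : (i : ℝ) + 1 ≤ m := by exact_mod_cast h2
      rw [min_eq_right (by linarith), max_eq_right (by norm_num), mul_one]
    · subst h3
      rw [add_sub_cancel_left, min_eq_left h1, max_eq_right h0, mul_comm]
    · have : (m : ℝ) + 1 ≤ i := by exact_mod_cast (by omega : m + 1 ≤ i)
      rw [max_eq_left, mul_zero]
      exact (min_le_left _ _).trans (by linarith)
  rw [polyline, Finset.sum_congr rfl key]
  have h2 : ∀ i, (if i < m then a (i + 1) - a i else if i = m then r * (a (m + 1) - a m) else 0) =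
      (if i < m then a (i + 1) - a i else 0) + (if i = m then r * (a (m + 1) - a m) else 0) := by
    intro i
    split_ifs <;> first | omega | simp
  simp only [h2, Finset.sum_add_distrib]
  rw [Finset.sum_ite_eq' , if_pos (Finset.mem_range.2 hm), ← Finset.sum_filter]
  have h3 : Finset.filter (fun i => i < m) (Finset.range n) = Finset.range m := by
    ext i
    simp only [Finset.mem_filter, Finset.mem_range]
    omega
  rw [h3, Finset.sum_range_sub]
  ring

theorem exists_lipschitzWith_polyline (a : ℕ → ℝ) (n : ℕ) : ∃ K, LipschitzWith K (polyline a n) := by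
  have key : ∀ n, ∃ K, LipschitzWith K fun s : ℝ =>
      ∑ m ∈ Finset.range n, (a (m + 1) - a m) * max 0 (min (s - m) 1) := by
    intro n
    induction n with
    | zero => exact ⟨0, by simp⟩
    | succ n ih =>
      obtain ⟨K, hK⟩ := ih
      have h1 : LipschitzWith 1 fun s : ℝ => max 0 (min (s - n) 1) := by
        have h2 : LipschitzWith 1 fun s : ℝ => s - (n : ℝ) :=
          LipschitzWith.of_dist_le_mul fun x y => by simp
        exact (h2.min_const 1).const_max 0
      have h3 := (lipschitzWith_smul (β := ℝ) (a (n + 1) - a n)).comp h1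
      simp only [Finset.sum_range_succ]
      exact ⟨_, hK.add h3⟩
  obtain ⟨K, hK⟩ := key n
  exact ⟨_, (LipschitzWith.const (a 0)).add hK⟩

/-- The closed polygon with vertices `h • p 0, …, h • p n`, parametrized on `[0, 1]`. -/
noncomputable def gridCurve (h : ℝ) (n : ℕ) (p : ℕ → ℤ × ℤ) (t : ℝ) : Plane :=
  !₂[h * polyline (fun m => ((p m).1 : ℝ)) n (n * t), h * polyline (fun m => ((p m).2 : ℝ)) n (n * t)]

theorem gridAdj_segments {u v u' v' : ℤ × ℤ} (huv : GridAdj u v) (huv' : GridAdj u' v') {r r' : ℝ}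
    (h0 : 0 ≤ r) (h1 : r < 1) (h0' : 0 ≤ r') (h1' : r' < 1)
    (e1 : (u.1 : ℝ) + r * (v.1 - u.1) = u'.1 + r' * (v'.1 - u'.1))
    (e2 : (u.2 : ℝ) + r * (v.2 - u.2) = u'.2 + r' * (v'.2 - u'.2)) :
    (u = u' ∧ r = r') ∨ (u = v' ∧ v = u') := by
  obtain ⟨a, b⟩ := u
  obtain ⟨c, d⟩ := v
  obtain ⟨a', b'⟩ := u'
  obtain ⟨c', d'⟩ := v'
  obtain ⟨α, rfl⟩ : ∃ α, a' = a + α := ⟨a' - a, by ring⟩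
  obtain ⟨β, rfl⟩ : ∃ β, b' = b + β := ⟨b' - b, by ring⟩
  obtain ⟨γ, rfl⟩ : ∃ γ, c = a + γ := ⟨c - a, by ring⟩
  obtain ⟨δ, rfl⟩ : ∃ δ, d = b + δ := ⟨d - b, by ring⟩
  obtain ⟨γ', rfl⟩ : ∃ γ', c' = a + α + γ' := ⟨c' - (a + α), by ring⟩
  obtain ⟨δ', rfl⟩ : ∃ δ', d' = b + β + δ' := ⟨d' - (b + β), by ring⟩
  simp only [GridAdj] at huv huv'
  simp only at e1 e2
  have fin : ∀ {α : ℤ} {t : ℝ}, (α : ℝ) = t → -2 < t → t < 2 → -2 < α ∧ α < 2 := by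
    intro α t h h1 h2
    subst h
    exact ⟨by exact_mod_cast h1, by exact_mod_cast h2⟩
  have hd : (γ = 0 ∧ (δ = 1 ∨ δ = -1)) ∨ (δ = 0 ∧ (γ = 1 ∨ γ = -1)) := by omega
  have hd' : (γ' = 0 ∧ (δ' = 1 ∨ δ' = -1)) ∨ (δ' = 0 ∧ (γ' = 1 ∨ γ' = -1)) := by omega
  clear huv huv'
  rcases hd with ⟨rfl, rfl | rfl⟩ | ⟨rfl, rfl | rfl⟩ <;>
  rcases hd' with ⟨rfl, rfl | rfl⟩ | ⟨rfl, rfl | rfl⟩ <;>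
  · push_cast at e1 e2
    ring_nf at e1 e2
    obtain ⟨p1, p2⟩ := fin (α := α) rfl (by linarith) (by linarith)
    obtain ⟨p3, p4⟩ := fin (α := β) rfl (by linarith) (by linarith)
    interval_cases α <;> interval_cases β <;> push_cast at e1 e2 <;>
    first
    | (exfalso; linarith)
    | (left; refine ⟨by simp, by linarith⟩)
    | (right; refine ⟨?_, ?_⟩ <;> ext <;> simp)

variable {h : ℝ} {n : ℕ} {p : ℕ → ℤ × ℤ}

theorem gridCurve_eq (hn : 0 < n) {m : ℕ} (hm : m < n) {r : ℝ} (h0 : 0 ≤ r) (h1 : r ≤ 1) :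
    gridCurve h n p ((m + r) / n) = !₂[h * ((p m).1 + r * ((p (m + 1)).1 - (p m).1)),
      h * ((p m).2 + r * ((p (m + 1)).2 - (p m).2))] := by
  have : (n : ℝ) * ((m + r) / n) = m + r := by field_simp
  rw [gridCurve, this, polyline_eq _ hm h0 h1, polyline_eq _ hm h0 h1]

theorem IsGridCycle.isSimpleClosedRectifiable (hp : IsGridCycle n p) (hh : 0 < h) :
    IsSimpleClosedRectifiable (gridCurve h n p) := by
  have hn : 0 < n := by have := hp.three_le; omega
  have hn' : (0 : ℝ) < n := by exact_mod_cast hn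
  obtain ⟨K1, hK1⟩ := exists_lipschitzWith_polyline (fun m => ((p m).1 : ℝ)) n
  obtain ⟨K2, hK2⟩ := exists_lipschitzWith_polyline (fun m => ((p m).2 : ℝ)) n
  have hl : ∃ K, LipschitzWith K (gridCurve h n p) := by
    have hs := lipschitzWith_smul (β := ℝ) (n : ℝ)
    have hs' := lipschitzWith_smul (β := ℝ) h
    have h1 := (hs'.comp (hK1.comp hs)).prodMk (hs'.comp (hK2.comp hs))
    have h2 : ∃ K, LipschitzWith K fun q : ℝ × ℝ => (!₂[q.1, q.2] : Plane) := by
      let L : ℝ × ℝ →L[ℝ] Plane := LinearMap.toContinuousLinearMap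
        { toFun := fun q => !₂[q.1, q.2]
          map_add' := fun x y => by ext i; fin_cases i <;> simp
          map_smul' := fun x y => by ext i; fin_cases i <;> simp }
      exact ⟨_, L.lipschitz⟩
    obtain ⟨K, hK⟩ := h2
    have h3 : gridCurve h n p = (fun q : ℝ × ℝ => (!₂[q.1, q.2] : Plane)) ∘ fun t =>
        (((fun x : ℝ => h • x) ∘ polyline (fun m => ((p m).1 : ℝ)) n ∘ fun x : ℝ => (n : ℝ) • x) t,
          ((fun x : ℝ => h • x) ∘ polyline (fun m => ((p m).2 : ℝ)) n ∘
            fun x : ℝ => (n : ℝ) • x) t) := by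
      ext1 t
      simp only [gridCurve, Function.comp_apply, smul_eq_mul]
    rw [h3]
    exact ⟨_, hK.comp h1⟩
  obtain ⟨K, hK⟩ := hl
  refine ⟨hK.continuous.continuousOn, ?_, ?_, ?_⟩
  · have h1 := gridCurve_eq (h := h) (p := p) hn (m := 0) hn le_rfl zero_le_one
    have h2 := gridCurve_eq (h := h) (p := p) hn (m := n - 1) (r := 1) (by omega) zero_le_one le_rfl
    have h3 : ((n - 1 : ℕ) : ℝ) + 1 = n := by
      rw [Nat.cast_sub (by omega)]; simp
    have h4 : n - 1 + 1 = n := by omega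
    rw [h3, div_self hn'.ne', h4, hp.closed] at h2
    simp only [Nat.cast_zero, zero_add, zero_div] at h1
    rw [h1, h2]
    ext i
    fin_cases i <;> simp
  · have hdec : ∀ t ∈ Ico (0 : ℝ) 1, ∃ m < n, ∃ r : ℝ, 0 ≤ r ∧ r < 1 ∧ t = (m + r) / n := by
      intro t ht
      have h0 : 0 ≤ n * t := mul_nonneg hn'.le ht.1
      refine ⟨⌊n * t⌋₊, ?_, n * t - ⌊n * t⌋₊, ?_, ?_, ?_⟩
      · rw [Nat.floor_lt h0]
        nlinarith [ht.2]
      · linarith [Nat.floor_le h0]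
      · linarith [Nat.lt_floor_add_one (n * t)]
      · field_simp; ring
    intro t ht t' ht' he
    obtain ⟨m, hm, r, h0, h1, rfl⟩ := hdec t ht
    obtain ⟨m', hm', r', h0', h1', rfl⟩ := hdec t' ht'
    rw [gridCurve_eq hn hm h0 h1.le, gridCurve_eq hn hm' h0' h1'.le] at he
    have e0 := congrArg (fun x : Plane => x 0) he
    have e1 := congrArg (fun x : Plane => x 1) he
    simp only [Matrix.cons_val_zero, Matrix.cons_val_one] at e0 e1
    rcases gridAdj_segments (hp.adj m hm) (hp.adj m' hm') h0 h1 h0' h1'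
      (mul_left_cancel₀ hh.ne' e0) (mul_left_cancel₀ hh.ne' e1) with ⟨hu, rfl⟩ | ⟨hu, hv⟩
    · rw [hp.inj m hm m' hm' hu]
    · exact (hp.eq_of_reversed hm hm' hu hv).elim
  · have := hK.lipschitzOnWith (s := Icc 0 1) |>.locallyBoundedVariationOn
    simpa using this 0 1 (by simp) (by simp)

/-- The image of a simple closed grid polygon is the boundary of the set of enclosed cells. -/
theorem IsGridCycle.image_gridCurve (hp : IsGridCycle n p) (hh : 0 < h) :
    gridCurve h n p '' Icc 0 1 = boundaryEdges h (enclosed n p) := by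
  have hn : 0 < n := by have := hp.three_le; omega
  have hn' : (0 : ℝ) < n := by exact_mod_cast hn
  have h1 : gridCurve h n p '' Icc 0 1 = {x | ∃ m < n, ∃ r : ℝ, 0 ≤ r ∧ r ≤ 1 ∧
      x 0 / h = (p m).1 + r * ((p (m + 1)).1 - (p m).1) ∧
      x 1 / h = (p m).2 + r * ((p (m + 1)).2 - (p m).2)} := by
    ext x
    constructor
    · rintro ⟨t, ht, rfl⟩
      have h0 : 0 ≤ n * t := mul_nonneg hn'.le ht.1
      have : ∃ m < n, ∃ r : ℝ, 0 ≤ r ∧ r ≤ 1 ∧ t = (m + r) / n := by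
        rcases ht.2.lt_or_eq with h1 | rfl
        · refine ⟨⌊n * t⌋₊, ?_, n * t - ⌊n * t⌋₊, ?_, ?_, ?_⟩
          · rw [Nat.floor_lt h0]
            nlinarith
          · linarith [Nat.floor_le h0]
          · linarith [Nat.lt_floor_add_one (n * t)]
          · field_simp; ring
        · refine ⟨n - 1, by omega, 1, zero_le_one, le_rfl, ?_⟩
          rw [Nat.cast_sub (by omega)]
          field_simp
          simp
      obtain ⟨m, hm, r, hr0, hr1, rfl⟩ := this
      refine ⟨m, hm, r, hr0, hr1, ?_⟩
      rw [gridCurve_eq hn hm hr0 hr1]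
      simp [hh.ne']
    · rintro ⟨m, hm, r, hr0, hr1, e0, e1⟩
      have hm1 : (m : ℝ) + 1 ≤ n := by exact_mod_cast hm
      refine ⟨(m + r) / n, ⟨by positivity, ?_⟩, ?_⟩
      · rw [div_le_one hn']
        linarith
      · rw [gridCurve_eq hn hm hr0 hr1, ← e0, ← e1]
        ext i
        fin_cases i <;> simp [hh.ne', mul_div_cancel₀]
  rw [h1]
  ext x
  simp only [boundaryEdges, mem_ofPred_eq, hp.vJump_enclosed_iff, hp.hJump_enclosed_iff]
  constructor
  · rintro ⟨m, hm, r, hr0, hr1, e0, e1⟩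
    rcases hp.adj m hm with ⟨e, h2 | h2⟩ | ⟨e, h2 | h2⟩
    · refine Or.inl ⟨p m, ⟨m, hm, e, rfl, by omega⟩, ?_, ?_, ?_⟩ <;> simp [e0, e1, e, h2] <;> linarith
    · refine Or.inl ⟨p (m + 1), ⟨m, hm, e, e, by omega⟩, ?_, ?_, ?_⟩ <;> simp [e0, e1, e, h2] <;>
      linarith
    · refine Or.inr ⟨p m, ⟨m, hm, e, rfl, by omega⟩, ?_, ?_, ?_⟩ <;> simp [e0, e1, e, h2] <;> linarith
    · refine Or.inr ⟨p (m + 1), ⟨m, hm, e, e, by omega⟩, ?_, ?_, ?_⟩ <;> simp [e0, e1, e, h2] <;>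
      linarith
  · rintro (⟨w, ⟨m, hm, ⟨e, e', e''⟩⟩, g1, g2, g3⟩ | ⟨w, ⟨m, hm, ⟨e, e', e''⟩⟩, g1, g2, g3⟩)
    · rcases hp.adj m hm with ⟨-, h2 | h2⟩ | ⟨h3, h2 | h2⟩
      · have h4 : (p m).2 = w.2 := by omega
        refine ⟨m, hm, x 1 / h - w.2, by linarith, by linarith, ?_, ?_⟩
        · rw [g1, ← e, e']; simp
        · rw [h2, h4]; push_cast; ring
      · have h4 : (p m).2 = w.2 + 1 := by omega
        have h5 : (p (m + 1)).2 = w.2 := by omega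
        refine ⟨m, hm, w.2 + 1 - x 1 / h, by linarith, by linarith, ?_, ?_⟩
        · rw [g1, ← e, e']; simp
        · rw [h4, h5]; push_cast; ring
      · omega
      · omega
    · rcases hp.adj m hm with ⟨h3, h2 | h2⟩ | ⟨-, h2 | h2⟩
      · omega
      · omega
      · have h4 : (p m).1 = w.1 := by omega
        refine ⟨m, hm, x 0 / h - w.1, by linarith, by linarith, ?_, ?_⟩
        · rw [h2, h4]; push_cast; ring
        · rw [g1, ← e, e']; simp
      · have h4 : (p m).1 = w.1 + 1 := by omega
        have h5 : (p (m + 1)).1 = w.1 := by omega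
        refine ⟨m, hm, w.1 + 1 - x 0 / h, by linarith, by linarith, ?_, ?_⟩
        · rw [h4, h5]; push_cast; ring
        · rw [g1, ← e, e']; simp

end Polygon

/-! ### Circulations along general test functions -/

section Strong

variable {τ ε h : ℝ} {Ω S : Set Plane} {A : Plane → Mat} {φ : Plane → ℝ} {P D : Set (ℤ × ℤ)}

/-- The curl of an admissible field vanishes away from `S`. -/
theorem Admissible.curlPairing_eq_zero (hA : Admissible τ ε Ω A S)
    (hφ : IsTest Ω φ) (h0 : ∀ s ∈ S, φ =ᶠ[𝓝 s] 0) : curlPairing Ω A φ = 0 := by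
  have hcompact : IsCompact (tsupport φ) := hφ.2.1
  obtain ⟨U, hU, hKU, -, h⟩ : ∃ U, IsOpen U ∧ tsupport φ ⊆ U ∧ U ⊆ Ω ∧
      ∀ ψ, IsTest U ψ → curlPairing Ω A ψ = 0 := by
    refine hcompact.induction_on (p := fun K => ∃ U, IsOpen U ∧ K ⊆ U ∧ U ⊆ Ω ∧
      ∀ ψ, IsTest U ψ → curlPairing Ω A ψ = 0) ?_ ?_ ?_ ?_
    · refine ⟨∅, isOpen_empty, Subset.rfl, empty_subset _, fun ψ hψ => ?_⟩
      have : ψ = 0 := by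
        ext x
        exact hψ.eq_zero (notMem_empty x)
      rw [this, curlPairing_zero]
    · rintro K K' hKK' ⟨U, hU, hKU, h⟩
      exact ⟨U, hU, hKK'.trans hKU, h⟩
    · rintro K K' ⟨U, hU, hKU, hUΩ, h⟩ ⟨V, hV, hKV, hVΩ, h'⟩
      refine ⟨U ∪ V, hU.union hV, union_subset_union hKU hKV, union_subset hUΩ hVΩ,
        fun ψ hψ => ?_⟩
      have hcpt : IsCompact (tsupport ψ \ V) := (show IsCompact (tsupport ψ) from hψ.2.1).diff hV
      obtain ⟨ρ, hρ, hρ1⟩ := exists_isTest_eq_one hcpt hU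
        fun x hx => (hψ.2.2 hx.1).resolve_right hx.2
      have h1 : IsTest U (ρ * ψ) :=
        ⟨hρ.1.mul hψ.1, hψ.2.1.mul_left, (tsupport_mul_subset_left).trans hρ.2.2⟩
      have h2' : IsTest (U ∪ V) (ψ - ρ * ψ) := hψ.sub (h1.mono subset_union_left)
      have h2 : IsTest V (ψ - ρ * ψ) := by
        refine h2'.of_tsupport_subset fun x hx => ?_
        by_contra hxV
        refine absurd hx (notMem_tsupport_iff_eventuallyEq.2 ?_)
        by_cases hxψ : x ∈ tsupport ψ
        · filter_upwards [hρ1 x ⟨hxψ, hxV⟩] with y hy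
          simp [hy]
        · filter_upwards [notMem_tsupport_iff_eventuallyEq.1 hxψ] with y hy
          simp [hy]
      have h3 := curlPairing_add (Ω := Ω) hA.integrable (h1.mono hUΩ) (h2.mono hVΩ)
      rw [h _ h1, h' _ h2, add_sub_cancel, add_zero] at h3
      exact h3
    · intro x hx
      have hxS : x ∉ S := fun hxS =>
        absurd hx (notMem_tsupport_iff_eventuallyEq.2 (h0 x hxS))
      have hxc : x ∉ curlSupport Ω A := fun h => hxS (hA.curl h)
      have : ∃ U, IsOpen U ∧ U ⊆ Ω ∧ x ∈ U ∧ ∀ ψ, IsTest U ψ → curlPairing Ω A ψ = 0 := by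
        by_contra hcon
        refine hxc ⟨hφ.2.2 hx, fun U hU hUΩ hxU => ?_⟩
        by_contra hcon'
        refine hcon ⟨U, hU, hUΩ, hxU, fun ψ hψ => ?_⟩
        by_contra hne
        exact hcon' ⟨ψ, hψ, hne⟩
      obtain ⟨U, hU, hUΩ, hxU, h⟩ := this
      exact ⟨U, mem_nhdsWithin_of_mem_nhds (hU.mem_nhds hxU), U, hU, Subset.rfl, hUΩ, h⟩
  exact h φ (hφ.of_tsupport_subset hKU)

theorem Admissible.curlPairing_congr (hA : Admissible τ ε Ω A S) {ψ : Plane → ℝ}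
    (hφ : IsTest Ω φ) (hψ : IsTest Ω ψ) (h0 : ∀ s ∈ S, φ =ᶠ[𝓝 s] ψ) :
    curlPairing Ω A φ = curlPairing Ω A ψ := by
  have := hA.curlPairing_eq_zero (hφ.sub hψ) fun s hs => by
    filter_upwards [h0 s hs] with x hx
    simp [hx]
  rw [curlPairing_sub hA.integrable hφ hψ] at this
  exact sub_eq_zero.1 this

/-- Membership in `P` is constant on the block of nine cells around each point of `S`, so that the
boundary of `P` keeps a distance of order `h` from `S`. -/
def SafeCells (h : ℝ) (S : Set Plane) (P : Set (ℤ × ℤ)) : Prop :=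
  ∀ s ∈ S, ∀ k : ℤ × ℤ, |k.1 - (cellOf h s).1| ≤ 1 → |k.2 - (cellOf h s).2| ≤ 1 →
    (k ∈ P ↔ cellOf h s ∈ P)

theorem VJump.of_jumps_subset (hDP : jumps D ⊆ jumps P) {w : ℤ × ℤ} (hw : VJump D w) :
    VJump P w := by
  rcases hDP (show (true, w) ∈ jumps D from Or.inl ⟨rfl, hw⟩) with h | h
  · exact h.2
  · simp at h

theorem HJump.of_jumps_subset (hDP : jumps D ⊆ jumps P) {w : ℤ × ℤ} (hw : HJump D w) :
    HJump P w := by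
  rcases hDP (show (false, w) ∈ jumps D from Or.inr ⟨rfl, hw⟩) with h | h
  · simp at h
  · exact h.2

theorem SafeCells.of_jumps_subset (hP : SafeCells h S P) (hDP : jumps D ⊆ jumps P) :
    SafeCells h S D := by
  intro s hs
  have hs' := hP s hs
  generalize cellOf h s = c at *
  obtain ⟨i, j⟩ := c
  simp only at hs' ⊢
  have hV : ∀ l m : ℤ, |l - i| ≤ 1 → |l - 1 - i| ≤ 1 → |m - j| ≤ 1 →
      ((l - 1, m) ∈ D ↔ (l, m) ∈ D) := by
    intro l m h1 h2 h3
    by_contra hcon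
    have := VJump.of_jumps_subset hDP (w := (l, m)) hcon
    exact this ((hs' (l - 1, m) h2 h3).trans (hs' (l, m) h1 h3).symm)
  have hH : ∀ l m : ℤ, |l - i| ≤ 1 → |m - j| ≤ 1 → |m - 1 - j| ≤ 1 →
      ((l, m - 1) ∈ D ↔ (l, m) ∈ D) := by
    intro l m h1 h2 h3
    by_contra hcon
    have := HJump.of_jumps_subset hDP (w := (l, m)) hcon
    exact this ((hs' (l, m - 1) h1 h3).trans (hs' (l, m) h1 h2).symm)
  rintro ⟨l, m⟩ hl hm
  simp only at hl hm
  have h1 : (l, m) ∈ D ↔ (i, m) ∈ D := by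
    have : l = i - 1 ∨ l = i ∨ l = i + 1 := by rw [abs_le] at hl; omega
    rcases this with rfl | rfl | rfl
    · exact hV i m (by simp) (by simp) hm
    · rfl
    · have := hV (i + 1) m (by simp) (by simp) hm
      rw [add_sub_cancel_right] at this
      exact this.symm
  rw [h1]
  have : m = j - 1 ∨ m = j ∨ m = j + 1 := by rw [abs_le] at hm; omega
  rcases this with rfl | rfl | rfl
  · exact hH i j (by simp) (by simp) (by simp)
  · rfl
  · have := hH i (j + 1) (by simp) (by simp) (by simp)
    rw [add_sub_cancel_right] at this
    exact this.symm

theorem abs_coord_sub_le (x y : Plane) (i : Fin 2) : |x i - y i| ≤ dist x y := by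
  rw [EuclideanSpace.dist_eq]
  refine Real.abs_le_sqrt ?_
  rw [← sq_abs, ← Real.dist_eq]
  exact Finset.single_le_sum (f := fun i => dist (x i) (y i) ^ 2) (fun _ _ => sq_nonneg _)
    (Finset.mem_univ i)

theorem dist_le_of_coord {x y : Plane} {a b : ℝ} (h0 : |x 0 - y 0| ≤ a) (h1 : |x 1 - y 1| ≤ b) :
    dist x y ≤ a + b := by
  have ha := (abs_nonneg _).trans h0
  have hb := (abs_nonneg _).trans h1
  rw [EuclideanSpace.dist_eq]
  refine Real.sqrt_le_iff.2 ⟨by positivity, ?_⟩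
  simp only [Fin.sum_univ_two, Real.dist_eq, sq_abs]
  nlinarith [sq_abs (x 0 - y 0), sq_abs (x 1 - y 1), abs_nonneg (x 0 - y 0), abs_nonneg (x 1 - y 1)]

theorem abs_cellOf_sub_le (hh : 0 < h) {x y : Plane} (hxy : dist x y < h) :
    |(cellOf h x).1 - (cellOf h y).1| ≤ 1 ∧ |(cellOf h x).2 - (cellOf h y).2| ≤ 1 := by
  have key : ∀ i : Fin 2, |⌊x i / h⌋ - ⌊y i / h⌋| ≤ 1 := by
    intro i
    have h1 := (abs_coord_sub_le x y i).trans_lt hxy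
    have h2 : |x i / h - y i / h| < 1 := by
      rw [← sub_div, abs_div, abs_of_pos hh, div_lt_one hh]
      exact h1
    rw [abs_lt] at h2
    have a1 : ((⌊x i / h⌋ - ⌊y i / h⌋ : ℤ) : ℝ) < 2 := by
      push_cast
      linarith [Int.floor_le (x i / h), Int.lt_floor_add_one (y i / h)]
    have a2 : (-2 : ℝ) < ((⌊x i / h⌋ - ⌊y i / h⌋ : ℤ) : ℝ) := by
      push_cast
      linarith [Int.floor_le (y i / h), Int.lt_floor_add_one (x i / h)]
    have b1 : ⌊x i / h⌋ - ⌊y i / h⌋ < 2 := by exact_mod_cast a1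
    have b2 : -2 < ⌊x i / h⌋ - ⌊y i / h⌋ := by exact_mod_cast a2
    rw [abs_le]
    omega
  exact ⟨key 0, key 1⟩

theorem SafeCells.mem_region_iff (hP : SafeCells h S P) (hh : 0 < h) {s x : Plane} (hs : s ∈ S)
    (hx : dist x s < h) : x ∈ region h P ↔ cellOf h s ∈ P :=
  hP s hs _ (abs_cellOf_sub_le hh hx).1 (abs_cellOf_sub_le hh hx).2

open Classical in
/-- A test function that equals `1` on the region of a safe set of cells and `0` on the part of `S`
outside of it. -/
theorem exists_isTest_region (hΩ : IsOpen Ω) (hh : 0 < h) (hP : P.Finite)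
    (hPΩ : ∀ k ∈ P, closedCell h k ⊆ Ω) (hsafe : SafeCells h S P) :
    ∃ ρ, IsTest Ω ρ ∧ (∀ x ∈ region h P, ρ x = 1) ∧
      tsupport ρ ⊆ Metric.thickening h (region h P) ∧
      ∀ s ∈ S, ρ =ᶠ[𝓝 s] fun _ => if cellOf h s ∈ P then 1 else 0 := by
  have hK : IsCompact (⋃ k ∈ P, closedCell h k) :=
    hP.isCompact_biUnion fun k _ => isCompact_closedCell hh
  have hmem : ∀ x ∈ region h P, x ∈ ⋃ k ∈ P, closedCell h k := fun x hx =>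
    mem_biUnion hx mem_closedCell_cellOf
  obtain ⟨ρ, hρ, hρ1⟩ := exists_isTest_eq_one hK
    (hΩ.inter (Metric.isOpen_thickening (δ := h) (E := region h P))) (by
      refine iUnion₂_subset fun k hk => subset_inter (hPΩ k hk) ?_
      refine (closedCell_subset_closure hh).trans ?_
      refine (closure_mono ((openCell_subset_interior_region hk).trans interior_subset)).trans ?_
      exact Metric.closure_subset_thickening hh _)
  refine ⟨ρ, hρ.mono inter_subset_left, fun x hx => (hρ1 x (hmem x hx)).eq_of_nhds,
    hρ.2.2.trans inter_subset_right, fun s hs => ?_⟩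
  split_ifs with hsP
  · exact hρ1 s (hmem s hsP)
  · refine hρ.eventually_eq_zero fun h' => hsP ?_
    obtain ⟨y, hy, hys⟩ := Metric.mem_thickening_iff.1 h'.2
    rw [dist_comm] at hys
    exact (hsafe.mem_region_iff hh hs hys).1 hy

open Classical in
/-- The circulation along a simple closed polygon of the grid lies in the lattice. -/
theorem Admissible.inLattice_enclosed (hΩ : IsOpen Ω) (hA : Admissible τ ε Ω A S) (hh : 0 < h)
    {n : ℕ} {p : ℕ → ℤ × ℤ} (hp : IsGridCycle n p)
    (hPΩ : ∀ k ∈ enclosed n p, closedCell h k ⊆ Ω) (hsafe : SafeCells h S (enclosed n p))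
    (hφ : IsTest Ω φ)
    (hφS : ∀ s ∈ S, φ =ᶠ[𝓝 s] fun _ => if cellOf h s ∈ enclosed n p then 1 else 0) :
    InLattice (τ * ε) (curlPairing Ω A φ) := by
  have hfin := hp.finite_enclosed
  obtain ⟨ρ, hρ, hρ1, hρ2, hρS⟩ := exists_isTest_region hΩ hh hfin hPΩ hsafe
  rw [hA.curlPairing_congr hφ hρ fun s hs => (hφS s hs).trans (hρS s hs).symm]
  have hcl : closure (region h (enclosed n p)) ⊆ ⋃ k ∈ enclosed n p, closedCell h k := by
    refine closure_minimal (fun x hx => mem_biUnion hx mem_closedCell_cellOf) ?_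
    exact (hfin.isCompact_biUnion fun k _ => isCompact_closedCell hh).isClosed
  have hclΩ : closure (region h (enclosed n p)) ⊆ Ω := hcl.trans (iUnion₂_subset hPΩ)
  -- `S` stays away from the polygon, by the safety of the enclosed set of cells
  have hint : ∀ s ∈ S, cellOf h s ∈ enclosed n p → s ∈ interior (region h (enclosed n p)) := by
    intro s hs hsP
    rw [mem_interior_iff_mem_nhds]
    filter_upwards [Metric.ball_mem_nhds s hh] with x hx
    exact (hsafe.mem_region_iff hh hs hx).2 hsP
  refine hA.circulation _ (hp.isSimpleClosedRectifiable hh) ?_ (interior (region h (enclosed n p)))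
    ⟨isOpen_interior, ?_, interior_subset.trans (subset_closure.trans hclΩ), ?_⟩ ρ
    ⟨hρ, fun x hx => hρ1 x (interior_subset hx), ?_⟩
  · rw [hp.image_gridCurve hh, ← frontier_interior_region hh]
    intro x hx
    refine ⟨hclΩ (closure_mono interior_subset hx.1), fun hxS => ?_⟩
    rw [isOpen_interior.frontier_eq] at hx
    by_cases hxP : cellOf h x ∈ enclosed n p
    · exact hx.2 (hint x hxS hxP)
    · obtain ⟨y, hy, hyx⟩ := Metric.mem_closure_iff.1 hx.1 h hh
      rw [dist_comm] at hyx
      exact hxP ((hsafe.mem_region_iff hh hxS hyx).1 (interior_subset hy))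
  · exact ((hfin.isCompact_biUnion fun k _ => isCompact_closedCell hh).isBounded.subset
      (subset_closure.trans hcl)).subset interior_subset
  · rw [frontier_interior_region hh, hp.image_gridCurve hh]
  · rintro x ⟨hx, hxD⟩
    refine ⟨hρ.2.2 hx, fun hxS => hxD (hint x hxS ?_)⟩
    obtain ⟨y, hy, hxy⟩ := Metric.mem_thickening_iff.1 (hρ2 hx)
    rw [dist_comm] at hxy
    exact (hsafe.mem_region_iff hh hxS hxy).1 hy

theorem mem_of_convex_of_row (hΩ : Convex ℝ Ω) {x a b : Plane} (ha : a ∈ Ω) (hb : b ∈ Ω)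
    (ha1 : a 1 = x 1) (hb1 : b 1 = x 1) (ha0 : a 0 ≤ x 0) (hb0 : x 0 ≤ b 0) : x ∈ Ω := by
  rcases ha0.eq_or_lt with h | h
  · have : a = x := by ext i; fin_cases i <;> assumption
    exact this ▸ ha
  have hpos : 0 < b 0 - a 0 := by linarith
  have := hΩ ha hb (a := (b 0 - x 0) / (b 0 - a 0)) (b := (x 0 - a 0) / (b 0 - a 0))
    (div_nonneg (by linarith) hpos.le) (div_nonneg (by linarith) hpos.le)
    (by field_simp; ring)
  convert this using 1
  ext i
  fin_cases i
  · simp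
    field_simp
    ring
  · simp [ha1, hb1]
    field_simp
    ring

theorem vEdge_subset_closedCell (w : ℤ × ℤ) :
    vEdge h w ⊆ closedCell h w ∧ vEdge h w ⊆ closedCell h (w.1 - 1, w.2) := by
  constructor <;> rintro x ⟨h1, h2, h3⟩ <;> refine ⟨⟨?_, ?_⟩, h2, h3⟩ <;> simp [h1]

/-- The cells enclosed by a polygon in the boundary of `P` stay in a convex set that contains the
cells of `P`. -/
theorem closedCell_enclosed_subset (hΩ : Convex ℝ Ω) (hh : 0 < h) {n : ℕ} {p : ℕ → ℤ × ℤ}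
    (hp : IsGridCycle n p) (hPΩ : ∀ k ∈ P, closedCell h k ⊆ Ω)
    (hstep : ∀ m < n, JumpStep P (p m) (p (m + 1))) {k : ℤ × ℤ} (hk : k ∈ enclosed n p) :
    closedCell h k ⊆ Ω := by
  obtain ⟨⟨m, hm, w, hw, hw2, hw1⟩, m', hm', w', hw', hw2', hw1'⟩ :=
    hp.exists_vEdge_of_mem_enclosed hk
  have hedge : ∀ w, VJump P w → vEdge h w ⊆ Ω := by
    intro w hw
    by_cases hwP : w ∈ P
    · exact (vEdge_subset_closedCell w).1.trans (hPΩ _ hwP)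
    · refine (vEdge_subset_closedCell w).2.trans (hPΩ _ ?_)
      by_contra h'
      exact hw ⟨fun h => absurd h h', fun h => absurd h hwP⟩
  intro x hx
  have h1 : ((k.1 : ℝ) + 1) ≤ w.1 := by exact_mod_cast hw1
  have h1' : (w'.1 : ℝ) ≤ k.1 := by exact_mod_cast hw1'
  obtain ⟨⟨hx1, hx2⟩, hx3, hx4⟩ := hx
  have hv : ∀ w : ℤ × ℤ, w.2 = k.2 → (!₂[h * w.1, x 1] : Plane) ∈ vEdge h w := by
    intro w hw
    refine ⟨?_, ?_, ?_⟩ <;> simp [hw, hh.ne', hx3, hx4]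
  refine mem_of_convex_of_row hΩ (hedge _ ((hstep m' hm').vJump hw') (hv w' hw2'))
    (hedge _ ((hstep m hm).vJump hw) (hv w hw2)) (by simp) (by simp) ?_ ?_
  · rw [le_div_iff₀ hh] at hx1
    simp
    nlinarith
  · rw [div_le_iff₀ hh] at hx2
    simp
    nlinarith

open Classical in
/-- Test functions that are the indicator function of a set of cells near `S` pair with the field
to a lattice vector: the boundary of the set of cells is split into simple closed polygons. -/
theorem Admissible.inLattice_of_cells (hΩ : IsOpen Ω) (hconv : Convex ℝ Ω)
    (hA : Admissible τ ε Ω A S) (hh : 0 < h) (N : ℕ) :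
    ∀ P : Set (ℤ × ℤ), P.Finite → (jumps P).ncard ≤ N → (∀ k ∈ P, closedCell h k ⊆ Ω) →
      SafeCells h S P → ∀ φ, IsTest Ω φ →
      (∀ s ∈ S, φ =ᶠ[𝓝 s] fun _ => if cellOf h s ∈ P then 1 else 0) →
      InLattice (τ * ε) (curlPairing Ω A φ) := by
  induction N using Nat.strong_induction_on with
  | _ N ih =>
  intro P hP hN hPΩ hsafe φ hφ hφS
  rcases P.eq_empty_or_nonempty with rfl | hne
  · rw [hA.curlPairing_eq_zero hφ fun s hs => by filter_upwards [hφS s hs] with x hx; simp [hx]]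
    exact InLattice.zero _
  obtain ⟨n, p, hp, hstep⟩ := exists_isGridCycle hP hne
  set D := enclosed n p with hD
  have hDfin : D.Finite := hp.finite_enclosed
  have hDV : ∀ w, VJump D w → VJump P w := fun w hw => by
    obtain ⟨m, hm, he⟩ := (hp.vJump_enclosed_iff w).1 hw
    exact (hstep m hm).vJump he
  have hDH : ∀ w, HJump D w → HJump P w := fun w hw => by
    obtain ⟨m, hm, he⟩ := (hp.hJump_enclosed_iff w).1 hw
    exact (hstep m hm).hJump he
  have hDP : jumps D ⊆ jumps P := by
    rintro ⟨b, w⟩ (⟨rfl, hw⟩ | ⟨rfl, hw⟩)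
    · exact Or.inl ⟨rfl, hDV w hw⟩
    · exact Or.inr ⟨rfl, hDH w hw⟩
  have hDΩ : ∀ k ∈ D, closedCell h k ⊆ Ω := fun k hk =>
    closedCell_enclosed_subset hconv hh hp hPΩ hstep hk
  have hDsafe : SafeCells h S D := hsafe.of_jumps_subset hDP
  obtain ⟨ρ, hρ, -, -, hρS⟩ := exists_isTest_region hΩ hh hDfin hDΩ hDsafe
  have hρL : InLattice (τ * ε) (curlPairing Ω A ρ) :=
    hA.inLattice_enclosed hΩ hh hp hDΩ hDsafe hρ hρS
  -- two neighbouring cells separated by the boundaries of both `P` and `D`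
  obtain ⟨e, a, b, haP, haD, hsep⟩ : ∃ (e : Bool × ℤ × ℤ) (a b : ℤ × ℤ), ¬(a ∈ P ↔ b ∈ P) ∧
      ¬(a ∈ D ↔ b ∈ D) ∧ ∀ X : Set (ℤ × ℤ), e ∈ jumps X ↔ ¬(a ∈ X ↔ b ∈ X) := by
    have hn : 0 < n := by have := hp.three_le; omega
    rcases hp.adj 0 hn with ⟨he, -⟩ | ⟨he, -⟩
    · have hV : VJump D ((p 0).1, min (p 0).2 (p (0 + 1)).2) :=
        (hp.vJump_enclosed_iff _).2 ⟨0, hn, he, rfl, rfl⟩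
      exact ⟨(true, ((p 0).1, min (p 0).2 (p (0 + 1)).2)), _, _, hDV _ hV, hV,
        fun X => by simp [jumps, VJump]⟩
    · have hV : HJump D (min (p 0).1 (p (0 + 1)).1, (p 0).2) :=
        (hp.hJump_enclosed_iff _).2 ⟨0, hn, he, rfl, rfl⟩
      exact ⟨(false, (min (p 0).1 (p (0 + 1)).1, (p 0).2)), _, _, hDH _ hV, hV,
        fun X => by simp [jumps, HJump]⟩
  -- the induction hypothesis for sets obtained from `P` and `D`
  have hrec : ∀ f : Prop → Prop → Prop, ¬ f False False →
      (f (a ∈ P) (a ∈ D) ↔ f (b ∈ P) (b ∈ D)) → ∃ ψ, IsTest Ω ψ ∧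
        (∀ s ∈ S, ψ =ᶠ[𝓝 s] fun _ => if f (cellOf h s ∈ P) (cellOf h s ∈ D) then 1 else 0) ∧
        InLattice (τ * ε) (curlPairing Ω A ψ) := by
    intro f hf hab
    let X : Set (ℤ × ℤ) := {k | f (k ∈ P) (k ∈ D)}
    have hX : X ⊆ P ∪ D := fun k hk => by
      by_contra h'
      simp only [mem_union, not_or] at h'
      simp only [X, mem_ofPred_eq, h'.1, h'.2] at hk
      exact hf hk
    have hcomb : ∀ k l : ℤ × ℤ, (k ∈ P ↔ l ∈ P) → (k ∈ D ↔ l ∈ D) → (k ∈ X ↔ l ∈ X) := by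
      intro k l h1 h2
      simp only [X, mem_ofPred_eq, h1, h2]
    have hXfin : X.Finite := (hP.union hDfin).subset hX
    have hXP : jumps X ⊆ jumps P := by
      rintro ⟨b, w⟩ (⟨rfl, hw⟩ | ⟨rfl, hw⟩)
      · refine Or.inl ⟨rfl, ?_⟩
        by_contra hc
        exact hw (hcomb _ _ (not_not.1 hc) (by_contra fun hc' => hc (hDV w hc')))
      · refine Or.inr ⟨rfl, ?_⟩
        by_contra hc
        exact hw (hcomb _ _ (not_not.1 hc) (by_contra fun hc' => hc (hDH w hc')))
    have hXΩ : ∀ k ∈ X, closedCell h k ⊆ Ω := fun k hk => (hX hk).elim (hPΩ k) (hDΩ k)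
    have hXsafe := hsafe.of_jumps_subset hXP
    obtain ⟨ψ, hψ, -, -, hψS⟩ := exists_isTest_region hΩ hh hXfin hXΩ hXsafe
    have hlt : (jumps X).ncard < (jumps P).ncard := by
      refine Set.ncard_lt_ncard ⟨hXP, fun hPX => ?_⟩ (jumps_finite hP)
      exact (hsep X).1 (hPX ((hsep P).2 haP)) hab
    exact ⟨ψ, hψ, hψS, ih _ (hlt.trans_le hN) X hXfin le_rfl hXΩ hXsafe ψ hψ hψS⟩
  by_cases hal : a ∈ P ↔ a ∈ D
  · have key : ∀ p q r s : Prop, ¬(p ↔ q) → ¬(r ↔ s) → (p ↔ r) →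
        (((p ∧ ¬r) ↔ (q ∧ ¬s)) ∧ ((r ∧ ¬p) ↔ (s ∧ ¬q))) := by
      intro p q r s
      tauto
    have hk := key _ _ _ _ haP haD hal
    obtain ⟨ψ₁, h1, h1S, h1L⟩ := hrec (fun p d => p ∧ ¬d) (by simp) hk.1
    obtain ⟨ψ₂, h2, h2S, h2L⟩ := hrec (fun p d => d ∧ ¬p) (by simp) hk.2
    rw [hA.curlPairing_congr hφ ((h1.add hρ).sub h2) fun s hs => ?_,
      curlPairing_sub hA.integrable (h1.add hρ) h2, curlPairing_add hA.integrable h1 hρ]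
    · exact (h1L.add hρL).sub h2L
    · filter_upwards [hφS s hs, hρS s hs, h1S s hs, h2S s hs] with x e0 e1 e2 e3
      simp only [Pi.sub_apply, Pi.add_apply, e0, e1, e2, e3]
      by_cases c1 : cellOf h s ∈ P <;> by_cases c2 : cellOf h s ∈ D <;> simp [c1, c2]
  · have key : ∀ p q r s : Prop, ¬(p ↔ q) → ¬(r ↔ s) → ¬(p ↔ r) →
        (((p ∨ r) ↔ (q ∨ s)) ∧ ((p ∧ r) ↔ (q ∧ s))) := by
      intro p q r s
      tauto
    have hk := key _ _ _ _ haP haD hal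
    obtain ⟨ψ₁, h1, h1S, h1L⟩ := hrec (fun p d => p ∨ d) (by simp) hk.1
    obtain ⟨ψ₂, h2, h2S, h2L⟩ := hrec (fun p d => p ∧ d) (by simp) hk.2
    rw [hA.curlPairing_congr hφ ((h1.add h2).sub hρ) fun s hs => ?_,
      curlPairing_sub hA.integrable (h1.add h2) hρ, curlPairing_add hA.integrable h1 h2]
    · exact (h1L.add h2L).sub hρL
    · filter_upwards [hφS s hs, hρS s hs, h1S s hs, h2S s hs] with x e0 e1 e2 e3
      simp only [Pi.sub_apply, Pi.add_apply, e0, e1, e2, e3]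
      by_cases c1 : cellOf h s ∈ P <;> by_cases c2 : cellOf h s ∈ D <;> simp [c1, c2]

/-- Near `S`, a test function that is locally an integer constant keeps its value on balls of a
uniform radius. -/
theorem IsIntegerNear.exists_uniform_radius (hΩ : IsOpen Ω) (hS : ∃ C, IsClosed C ∧ S = Ω ∩ C)
    (hφ : IsTest Ω φ) (hint : IsIntegerNear S φ) :
    ∃ r > 0, Metric.thickening r (tsupport φ) ⊆ Ω ∧ ∀ s ∈ S, ∀ x, dist x s < r → φ x = φ s := by
  obtain ⟨C, hC, rfl⟩ := hS
  have hK : IsCompact (tsupport φ) := hφ.2.1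
  obtain ⟨r₀, hr₀, hr₀Ω⟩ := hK.exists_cthickening_subset_open hΩ hφ.2.2
  have hK1 : IsCompact (Metric.cthickening r₀ (tsupport φ) ∩ C) := hK.cthickening.inter_right hC
  let c : Plane → Set Plane := fun s => {x | φ =ᶠ[𝓝 x] fun _ => φ s}
  obtain ⟨δ, hδ, hδc⟩ := lebesgue_number_lemma_of_metric hK1 (c := c)
    (fun s => isOpen_setOfPred_eventually_nhds) (fun s hs => mem_iUnion.2
      ⟨s, hint.eventuallyEq ⟨hr₀Ω hs.1, hs.2⟩⟩)
  refine ⟨min δ r₀, lt_min hδ hr₀, ?_, fun s hs x hx => ?_⟩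
  · exact (Metric.thickening_mono (min_le_right _ _) _).trans
      ((Metric.thickening_subset_cthickening _ _).trans hr₀Ω)
  by_cases hsK : s ∈ Metric.cthickening r₀ (tsupport φ)
  · obtain ⟨t, ht⟩ := hδc s ⟨hsK, hs.2⟩
    have h1 : φ x = φ t := (ht (Metric.mem_ball.2 (hx.trans_le (min_le_left _ _)))).eq_of_nhds
    have h2 : φ s = φ t := (ht (Metric.mem_ball_self hδ)).eq_of_nhds
    rw [h1, h2]
  · have h1 : x ∉ tsupport φ := fun h' => hsK (Metric.thickening_subset_cthickening _ _
      (Metric.mem_thickening_iff.2 ⟨x, h', by rw [dist_comm]; exact hx.trans_le (min_le_right _ _)⟩))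
    have h2 : s ∉ tsupport φ := fun h' => hsK (Metric.self_subset_cthickening _ h')
    rw [image_eq_zero_of_notMem_tsupport h1, image_eq_zero_of_notMem_tsupport h2]

theorem sum_ite_le_eq (N : ℕ) (m : ℤ) [∀ n : ℕ, Decidable ((n + 1 : ℤ) ≤ m)] :
    ∑ n ∈ Finset.range N, (if (n + 1 : ℤ) ≤ m then (1 : ℝ) else 0) =
      ((min (max m 0) N : ℤ) : ℝ) := by
  induction N with
  | zero => simp
  | succ N ih =>
    rw [Finset.sum_range_succ, ih]
    split_ifs with h
    · have : min (max m 0) ((N + 1 : ℕ) : ℤ) = min (max m 0) N + 1 := by push_cast; omega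
      rw [this]
      push_cast
      ring
    · have : min (max m 0) ((N + 1 : ℕ) : ℤ) = min (max m 0) N := by push_cast; omega
      rw [this, add_zero]

/-- For an admissible pair on a convex domain, every test function that is integer near `S` pairs
with the field to a lattice vector. -/
theorem Admissible.inLattice (hΩ : IsOpen Ω) (hconv : Convex ℝ Ω) (hA : Admissible τ ε Ω A S)
    (hφ : IsTest Ω φ) (hint : IsIntegerNear S φ) :
    InLattice (τ * ε) (curlPairing Ω A φ) := by
  classical
  obtain ⟨r, hr, hrΩ, hrS⟩ := hint.exists_uniform_radius hΩ hA.relClosed hφ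
  have hh : 0 < r / 4 := by positivity
  set h := r / 4 with hhr
  let ctr : ℤ × ℤ → Plane := fun k => !₂[h * (k.1 + 1 / 2), h * (k.2 + 1 / 2)]
  let f : ℤ × ℤ → ℤ := fun k => round (φ (ctr k))
  -- near `S`, the function `f` of the cell is the value of `φ`
  have hf : ∀ s ∈ S, ∀ k : ℤ × ℤ, |k.1 - (cellOf h s).1| ≤ 1 → |k.2 - (cellOf h s).2| ≤ 1 →
      (f k : ℝ) = φ s := by
    intro s hs k h1 h2
    have key : ∀ (a : ℝ) (m : ℤ), |m - ⌊a / h⌋| ≤ 1 → |h * (m + 1 / 2) - a| ≤ 3 / 2 * h := by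
      intro a m hm
      have b1 := Int.floor_le (a / h)
      have b2 := Int.lt_floor_add_one (a / h)
      rw [abs_le] at hm
      have c1 : (m : ℝ) - ⌊a / h⌋ ≤ 1 := by exact_mod_cast hm.2
      have c2 : (-1 : ℝ) ≤ (m : ℝ) - ⌊a / h⌋ := by exact_mod_cast hm.1
      rw [le_div_iff₀ hh] at b1
      rw [div_lt_iff₀ hh] at b2
      rw [abs_le]
      constructor <;> nlinarith
    have hd : dist (ctr k) s < r := by
      have := dist_le_of_coord (x := ctr k) (y := s) (key _ _ h1) (key _ _ h2)
      linarith
    have h3 := hrS s hs _ hd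
    obtain ⟨n, hn⟩ := hint.exists_int hs
    simp only [f, h3, hn, round_intCast]
  have hcell : ∀ k : ℤ × ℤ, f k ≠ 0 → ctr k ∈ tsupport φ := by
    intro k hk
    by_contra h'
    simp [f, image_eq_zero_of_notMem_tsupport h'] at hk
  have hself : ∀ s, |(cellOf h s).1 - (cellOf h s).1| ≤ 1 ∧ |(cellOf h s).2 - (cellOf h s).2| ≤ 1 :=
    fun s => by simp
  -- cells with `f ≠ 0` are contained in `Ω`
  have hcΩ : ∀ k, f k ≠ 0 → closedCell h k ⊆ Ω := by
    rintro k hk x ⟨⟨h1, h2⟩, h3, h4⟩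
    refine hrΩ (Metric.mem_thickening_iff.2 ⟨_, hcell k hk, ?_⟩)
    rw [le_div_iff₀ hh] at h1 h3
    rw [div_le_iff₀ hh] at h2 h4
    have := dist_le_of_coord (x := x) (y := ctr k) (a := h) (b := h)
      (abs_le.2 (by constructor <;> simp [ctr] <;> linarith))
      (abs_le.2 (by constructor <;> simp [ctr] <;> linarith))
    linarith
  have hfin : {k | f k ≠ 0}.Finite := by
    have hb : Bornology.IsBounded (tsupport φ) := (show IsCompact (tsupport φ) from hφ.2.1).isBounded
    obtain ⟨R, hR⟩ := hb.exists_norm_le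
    refine ((finite_Icc (-⌈R / h + 1⌉) ⌈R / h + 1⌉).prod
      (finite_Icc (-⌈R / h + 1⌉) ⌈R / h + 1⌉)).subset fun k hk => ?_
    have h1 := hR _ (hcell k hk)
    have key : ∀ m : ℤ, |h * ((m : ℝ) + 1 / 2)| ≤ R → m ∈ Icc (-⌈R / h + 1⌉) ⌈R / h + 1⌉ := by
      intro m hm
      rw [abs_mul, abs_of_pos hh, ← le_div_iff₀' hh, abs_le] at hm
      have hc := Int.le_ceil (R / h + 1)
      constructor
      · have : (-⌈R / h + 1⌉ : ℝ) ≤ m := by linarith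
        exact_mod_cast this
      · have : (m : ℝ) ≤ ⌈R / h + 1⌉ := by linarith
        exact_mod_cast this
    exact ⟨key _ ((PiLp.norm_apply_le (ctr k) 0).trans h1), key _ ((PiLp.norm_apply_le (ctr k) 1).trans h1)⟩
  obtain ⟨N, hN⟩ : ∃ N : ℕ, ∀ k, |f k| ≤ N := by
    obtain ⟨M, hM⟩ := (hfin.image fun k => |f k|).bddAbove
    refine ⟨M.toNat, fun k => ?_⟩
    by_cases hk : f k = 0
    · simp [hk]
    · exact (hM ⟨k, hk, rfl⟩).trans (Int.self_le_toNat M)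
  have hset : ∀ g : ℤ → Prop, ¬ g 0 → ∃ ψ, IsTest Ω ψ ∧
      (∀ s ∈ S, ψ =ᶠ[𝓝 s] fun _ => if g (f (cellOf h s)) then 1 else 0) ∧
      InLattice (τ * ε) (curlPairing Ω A ψ) := by
    intro g hg
    let P : Set (ℤ × ℤ) := {k | g (f k)}
    have hPf : ∀ k ∈ P, f k ≠ 0 := fun k hk h0 => hg (by simpa [P, h0] using hk)
    have hP : P.Finite := hfin.subset hPf
    have hPΩ : ∀ k ∈ P, closedCell h k ⊆ Ω := fun k hk => hcΩ k (hPf k hk)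
    have hsafe : SafeCells h S P := by
      intro s hs k h1 h2
      have e1 := hf s hs k h1 h2
      have e2 := hf s hs _ (hself s).1 (hself s).2
      have e3 : f k = f (cellOf h s) := by exact_mod_cast e1.trans e2.symm
      simp only [P, mem_ofPred_eq, e3]
    obtain ⟨ψ, hψ, -, -, hψS⟩ := exists_isTest_region hΩ hh hP hPΩ hsafe
    exact ⟨ψ, hψ, hψS, hA.inLattice_of_cells hΩ hconv hh _ P hP le_rfl hPΩ hsafe ψ hψ hψS⟩
  choose ψ hψ hψS hψL using fun n : ℕ => hset (fun m => (n + 1 : ℤ) ≤ m) (by omega)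
  choose χ hχ hχS hχL using fun n : ℕ => hset (fun m => (n + 1 : ℤ) ≤ -m) (by omega)
  have h1 := IsTest.sum (Finset.range N) fun n _ => hψ n
  have h2 := IsTest.sum (Finset.range N) fun n _ => hχ n
  rw [hA.curlPairing_congr hφ (h1.sub h2) fun s hs => ?_, curlPairing_sub hA.integrable h1 h2,
    curlPairing_sum hA.integrable _ fun n _ => hψ n, curlPairing_sum hA.integrable _ fun n _ => hχ n]
  · exact (InLattice.sum _ fun n _ => hψL n).sub (InLattice.sum _ fun n _ => hχL n)
  · have e1 := (Finset.eventually_all (Finset.range N)).2 fun n _ => hψS n s hs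
    have e2 := (Finset.eventually_all (Finset.range N)).2 fun n _ => hχS n s hs
    filter_upwards [hint.eventuallyEq hs, e1, e2] with x a1 a2 a3
    simp only [Pi.sub_apply, Finset.sum_apply]
    have b2 := (Finset.sum_congr rfl a2).trans (@sum_ite_le_eq N (f (cellOf h s)) fun _ => Classical.propDecidable _)
    have b3 := (Finset.sum_congr rfl a3).trans (@sum_ite_le_eq N (-f (cellOf h s)) fun _ => Classical.propDecidable _)
    rw [b2, b3, a1, ← hf s hs _ (hself s).1 (hself s).2]
    have := hN (cellOf h s)
    rw [abs_le] at this
    rw [← Int.cast_sub]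
    congr 1
    omega

end Strong

/-! ### Coordinates and affine changes of variables -/

/-- The point of the plane with coordinates `(s, y)`. -/
noncomputable def pt (p : ℝ × ℝ) : Plane := !₂[p.1, p.2]

@[simp] theorem pt_zero (p : ℝ × ℝ) : pt p 0 = p.1 := rfl

@[simp] theorem pt_one (p : ℝ × ℝ) : pt p 1 = p.2 := rfl

theorem pt_coord (x : Plane) : pt (x 0, x 1) = x := by
  ext i
  fin_cases i <;> rfl

theorem measurable_coord (i : Fin 2) : Measurable fun x : Plane => x i :=
  (continuous_coord i).measurable

theorem measurePreserving_pt : MeasurePreserving pt :=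
  (EuclideanSpace.volume_preserving_symm_measurableEquiv_toLp (Fin 2)).symm.comp
    (volume_preserving_finTwoArrow ℝ).symm

theorem measurableEmbedding_pt : MeasurableEmbedding pt :=
  (MeasurableEquiv.toLp 2 (Fin 2 → ℝ)).measurableEmbedding.comp
    (MeasurableEquiv.finTwoArrow (α := ℝ)).symm.measurableEmbedding

theorem measurable_pt : Measurable pt := measurableEmbedding_pt.measurable

theorem integral_comp_pt (f : Plane → ℝ) : ∫ p, f (pt p) = ∫ x, f x :=
  measurePreserving_pt.integral_comp measurableEmbedding_pt f

theorem lintegral_comp_pt (f : Plane → ℝ≥0∞) : ∫⁻ p, f (pt p) = ∫⁻ x, f x :=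
  measurePreserving_pt.lintegral_comp_emb measurableEmbedding_pt f

theorem integrable_comp_pt {f : Plane → ℝ} : Integrable (fun p => f (pt p)) ↔ Integrable f :=
  measurePreserving_pt.integrable_comp_emb measurableEmbedding_pt

theorem hasDerivAt_pt_snd {φ : Plane → ℝ} (hφ : Differentiable ℝ φ) (s y : ℝ) :
    HasDerivAt (fun y => φ (pt (s, y))) (perpGrad φ (pt (s, y)) 0) y := by
  have h1 : HasDerivAt (fun y : ℝ => pt (s, y)) (EuclideanSpace.single (1 : Fin 2) (1 : ℝ)) y := by
    have h2 : (fun y : ℝ => pt (s, y)) =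
        fun y => pt (s, 0) + y • EuclideanSpace.single (1 : Fin 2) (1 : ℝ) := by
      ext y i
      fin_cases i <;> simp [pt]
    rw [h2]
    simpa using ((hasDerivAt_id y).smul_const (EuclideanSpace.single (1 : Fin 2) (1 : ℝ))).const_add
      (pt (s, 0))
  exact (hφ _).hasFDerivAt.comp_hasDerivAt y h1

/-- Integrals over vertical segments of the vertical derivative of a test function. -/
theorem integral_perpGrad_pt_snd {φ : Plane → ℝ} (hφ : ContDiff ℝ ∞ φ) (s a b : ℝ) :
    ∫ y in a..b, perpGrad φ (pt (s, y)) 0 = φ (pt (s, b)) - φ (pt (s, a)) := by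
  have hc : Continuous fun y : ℝ => pt (s, y) := by
    unfold pt
    fun_prop
  refine intervalIntegral.integral_eq_sub_of_hasDerivAt
    (fun y _ => hasDerivAt_pt_snd (hφ.differentiable (by simp)) s y) ?_
  exact (((continuous_apply 0).comp (continuous_perpGrad hφ)).comp hc).intervalIntegrable _ _

section Affine

variable {φ : Plane → ℝ} {A : Plane → Mat} {Ω S : Set Plane} {c : Plane} {r : ℝ}

/-- The homothety `x ↦ c + r x`. -/
noncomputable def homothety (c : Plane) (r : ℝ) (x : Plane) : Plane := c + r • x

@[simp] theorem homothety_coord (c x : Plane) (r : ℝ) (i : Fin 2) :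
    homothety c r x i = c i + r * x i := by simp [homothety]

theorem homothety_homothety (hr : r ≠ 0) (x : Plane) :
    homothety c r (homothety (-(r⁻¹ • c)) r⁻¹ x) = x := by
  ext i
  simp
  field_simp
  ring

theorem homothety_homothety' (hr : r ≠ 0) (x : Plane) :
    homothety (-(r⁻¹ • c)) r⁻¹ (homothety c r x) = x := by
  ext i
  simp
  field_simp
  ring

/-- A homothety of nonzero ratio as a homeomorphism. -/
noncomputable def homothetyHomeo (c : Plane) (hr : r ≠ 0) : Plane ≃ₜ Plane where
  toFun := homothety c r
  invFun := homothety (-(r⁻¹ • c)) r⁻¹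
  left_inv := homothety_homothety' hr
  right_inv := homothety_homothety hr
  continuous_toFun := by unfold homothety; fun_prop
  continuous_invFun := by unfold homothety; fun_prop

theorem dist_homothety (x y : Plane) : dist (homothety c r x) (homothety c r y) = |r| * dist x y := by
  simp [homothety, dist_smul₀]

theorem contDiff_homothety : ContDiff ℝ ∞ (homothety c r) := by
  unfold homothety
  fun_prop

theorem measurable_homothety : Measurable (homothety c r) :=
  contDiff_homothety.continuous.measurable

theorem map_homothety (hr : r ≠ 0) :
    Measure.map (homothety c r) volume = ENNReal.ofReal ((r ^ 2)⁻¹) • (volume : Measure Plane) := by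
  have h1 : homothety c r = (fun x => c + x) ∘ (fun x => r • x) := rfl
  rw [h1, ← Measure.map_map (by fun_prop) (by fun_prop), Measure.map_addHaar_smul _ hr,
    Measure.map_smul, map_add_left_eq_self]
  simp

theorem lintegral_homothety (hr : r ≠ 0) (f : Plane → ℝ≥0∞) :
    ∫⁻ x, f (homothety c r x) = ENNReal.ofReal ((r ^ 2)⁻¹) * ∫⁻ x, f x := by
  have := (homothetyHomeo c hr).measurableEmbedding.lintegral_map (μ := volume) f
  simp only [homothetyHomeo, Homeomorph.homeomorph_mk_coe, Equiv.coe_fn_mk] at this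
  rw [← this, map_homothety hr, lintegral_smul_measure, smul_eq_mul]

theorem integral_homothety (hr : r ≠ 0) (f : Plane → ℝ) :
    ∫ x, f (homothety c r x) = (r ^ 2)⁻¹ * ∫ x, f x := by
  have := (homothetyHomeo c hr).measurableEmbedding.integral_map (μ := volume) f
  simp only [homothetyHomeo, Homeomorph.homeomorph_mk_coe, Equiv.coe_fn_mk] at this
  rw [← this, map_homothety hr, integral_smul_measure, smul_eq_mul,
    ENNReal.toReal_ofReal (by positivity)]

theorem integrable_homothety (hr : r ≠ 0) {f : Plane → ℝ} (hf : Integrable f) :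
    Integrable fun x => f (homothety c r x) := by
  have := (homothetyHomeo c hr).measurableEmbedding.integrable_map_iff (μ := volume) (g := f)
  simp only [homothetyHomeo, Homeomorph.homeomorph_mk_coe, Equiv.coe_fn_mk] at this
  refine this.1 ?_
  rw [map_homothety hr]
  exact hf.smul_measure (by simp)

theorem perpGrad_homothety (hφ : Differentiable ℝ φ) (x : Plane) :
    perpGrad (fun x => φ (homothety c r x)) x = r • perpGrad φ (homothety c r x) := by
  have h1 : HasFDerivAt (homothety c r) (r • ContinuousLinearMap.id ℝ Plane) x :=
    ((hasFDerivAt_id x).const_smul r).const_add c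
  have h2 := ((hφ (homothety c r x)).hasFDerivAt.comp x h1).fderiv
  have h3 : (φ ∘ homothety c r) = fun x => φ (homothety c r x) := rfl
  rw [h3] at h2
  ext i
  fin_cases i <;> simp [perpGrad, h2]

theorem IsTest.homothety (hr : r ≠ 0) (h : IsTest Ω φ) :
    IsTest (homothety c r ⁻¹' Ω) (fun x => φ (homothety c r x)) := by
  refine ⟨h.1.comp contDiff_homothety, h.2.1.comp_homeomorph (homothetyHomeo c hr), ?_⟩
  refine (tsupport_comp_subset_preimage φ (contDiff_homothety (c := c) (r := r)).continuous).trans ?_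
  exact preimage_mono h.2.2

/-- The curl pairing scales linearly under homotheties. -/
theorem curlPairing_homothety (hr : r ≠ 0) (hφ : IsTest Ω φ) :
    curlPairing (homothety c r ⁻¹' Ω) (fun x => A (homothety c r x))
      (fun x => φ (homothety c r x)) = r⁻¹ • curlPairing Ω A φ := by
  ext i
  rw [Pi.smul_apply, curlPairing_eq_integral hφ, curlPairing_eq_integral (hφ.homothety hr)]
  simp only [perpGrad_homothety hφ.differentiable, Matrix.mulVec_smul, Pi.smul_apply, smul_eq_mul]
  rw [integral_const_mul, integral_homothety hr (fun x => (A x *ᵥ perpGrad φ x) i)]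
  field_simp

theorem IsIntegerNear.homothety (h : IsIntegerNear S φ) :
    IsIntegerNear (homothety c r ⁻¹' S) (fun x => φ (homothety c r x)) := by
  intro s hs
  obtain ⟨n, hn⟩ := h _ hs
  exact ⟨n, (contDiff_homothety (c := c) (r := r)).continuous.continuousAt.eventually hn⟩

end Affine

/-! ### Horizontal strips and shears -/

/-- The height `-1/2 + i ℓ`. -/
noncomputable def level (ℓ : ℝ) (i : ℤ) : ℝ := -1 / 2 + i * ℓ

/-- The index `i` of the horizontal strip `level ℓ i ≤ y < level ℓ (i + 1)` that contains the
height `y`. -/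
noncomputable def strip (ℓ y : ℝ) : ℤ := ⌊(y + 1 / 2) / ℓ⌋

theorem strip_eq_iff {ℓ y : ℝ} (hℓ : 0 < ℓ) {i : ℤ} :
    strip ℓ y = i ↔ level ℓ i ≤ y ∧ y < level ℓ (i + 1) := by
  rw [strip, Int.floor_eq_iff, le_div_iff₀ hℓ, div_lt_iff₀ hℓ, level, level]
  push_cast
  constructor <;> rintro ⟨h1, h2⟩ <;> constructor <;> linarith

theorem measurable_strip (ℓ : ℝ) : Measurable (strip ℓ) :=
  Int.measurable_floor.comp ((measurable_id.add_const _).div_const _)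

theorem level_add_one (ℓ : ℝ) (i : ℤ) : level ℓ (i + 1) = level ℓ i + ℓ := by
  simp only [level]
  push_cast
  ring

theorem level_mono {ℓ : ℝ} (hℓ : 0 ≤ ℓ) : Monotone (level ℓ) := by
  intro i j hij
  have : (i : ℝ) ≤ j := by exact_mod_cast hij
  have := mul_le_mul_of_nonneg_right this hℓ
  simp only [level]
  linarith

/-- Integral of the derivative of `g` against a function that is constant on the strips. -/
theorem integral_strip_mul_deriv {ℓ : ℝ} (hℓ : 0 < ℓ) {N : ℕ} (hN : 1 ≤ N * ℓ) {g g' : ℝ → ℝ}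
    (hg : ∀ a b, ∫ y in a..b, g' y = g b - g a) (hg' : Continuous g')
    (hsupp : ∀ y, 1 / 2 ≤ |y| → g' y = 0) (e : ℤ → ℝ) :
    ∫ y, e (strip ℓ y) * g' y =
      ∑ i ∈ Finset.range N, e i * (g (level ℓ (i + 1)) - g (level ℓ i)) := by
  have hl : ∀ i : ℤ, level ℓ i ≤ level ℓ (i + 1) := fun i => level_mono hℓ.le (by omega)
  have hae : ∀ i : ℤ, ∀ᵐ y, y ∈ uIoc (level ℓ i) (level ℓ (i + 1)) →
      e (strip ℓ y) * g' y = e i * g' y := by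
    intro i
    filter_upwards [(measure_singleton (μ := volume) (level ℓ (i + 1)) : _) |>
      compl_mem_ae_iff.2] with y hy hy'
    rw [uIoc_of_le (hl i)] at hy'
    rw [(strip_eq_iff hℓ).2 ⟨hy'.1.le, lt_of_le_of_ne hy'.2 hy⟩]
  have hint : ∀ i : ℤ, IntervalIntegrable (fun y => e (strip ℓ y) * g' y) volume
      (level ℓ i) (level ℓ (i + 1)) := fun i =>
    ((hg'.const_mul (e i)).intervalIntegrable _ _).congr_ae <| by
      rw [EventuallyEq, ae_restrict_iff' measurableSet_uIoc]
      filter_upwards [hae i] with y hy hy' using (hy hy').symm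
  have h0 : level ℓ (0 : ℕ) = -1 / 2 := by simp [level]
  have h1 : 1 / 2 ≤ level ℓ N := by
    simp only [level, Int.cast_natCast]
    linarith
  have hsum := intervalIntegral.sum_integral_adjacent_intervals
    (f := fun y => e (strip ℓ y) * g' y) (μ := volume) (a := fun i : ℕ => level ℓ i) (n := N)
    (fun k _ => by push_cast; exact hint k)
  have htot : ∫ y in level ℓ (0 : ℕ)..level ℓ N, e (strip ℓ y) * g' y =
      ∫ y, e (strip ℓ y) * g' y := by
    rw [h0, intervalIntegral.integral_of_le (by linarith)]
    apply setIntegral_eq_integral_of_forall_compl_eq_zero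
    intro y hy
    rw [hsupp y, mul_zero]
    by_contra hlt
    rw [not_le, abs_lt] at hlt
    exact hy ⟨by linarith, by linarith⟩
  rw [← htot, ← hsum]
  refine Finset.sum_congr rfl fun i _ => ?_
  push_cast
  rw [intervalIntegral.integral_congr_ae (hae i), intervalIntegral.integral_const_mul, hg]

/-- The field `θ(x₁) v(x) ⊗ e₁`, whose only nonzero column is the first one. -/
noncomputable def shearField (θ : ℝ → ℝ) (v : Plane → Fin 2 → ℝ) (x : Plane) : Mat :=
  fun i j => if j = 0 then θ (x 0) * v x i else 0

theorem shearField_mulVec (θ : ℝ → ℝ) (v : Plane → Fin 2 → ℝ) (x : Plane) (w : Fin 2 → ℝ)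
    (i : Fin 2) : (shearField θ v x *ᵥ w) i = θ (x 0) * v x i * w 0 := by
  simp [shearField, Matrix.mulVec, dotProduct]

/-- A continuous density of total mass one, supported in `[a, b]`. -/
structure IsDensity (θ : ℝ → ℝ) (a b : ℝ) : Prop where
  continuous : Continuous θ
  mem : ∀ s, θ s ≠ 0 → s ∈ Ioo a b
  integral_eq_one : ∫ s, θ s = 1

theorem isOpen_square (r : ℝ) : IsOpen (square r) := by
  have h0 := continuous_coord 0
  have h1 := continuous_coord 1
  exact (isOpen_lt h0.abs continuous_const).inter (isOpen_lt h1.abs continuous_const)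

theorem convex_square (r : ℝ) : Convex ℝ (square r) := by
  have h : ∀ i : Fin 2, Convex ℝ {x : Plane | |x i| < r} := fun i => by
    have h := (convex_Ioo (-r) r).is_linear_preimage (𝕜 := ℝ) (f := fun x : Plane => x i)
      ⟨fun x y => by simp, fun c x => by simp⟩
    simpa only [abs_lt, mem_Ioo, preimage] using h
  exact (h 0).inter (h 1)

theorem measurableSet_square (r : ℝ) : MeasurableSet (square r) := (isOpen_square r).measurableSet

theorem square_subset_closedBall (r : ℝ) : square r ⊆ Metric.closedBall 0 (r + r) := by
  intro x hx
  have := dist_le_of_coord (x := x) (y := 0) (a := r) (b := r) (by simpa using hx.1.le)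
    (by simpa using hx.2.le)
  exact this

theorem volume_square_lt_top (r : ℝ) : volume (square r) < ⊤ :=
  (measure_mono (square_subset_closedBall r)).trans_lt (measure_closedBall_lt_top)

theorem IsDensity.exists_bound {θ : ℝ → ℝ} {a b : ℝ} (h : IsDensity θ a b) :
    ∃ C, ∀ s, ‖θ s‖ ≤ C := by
  have : HasCompactSupport θ := HasCompactSupport.intro (isCompact_Icc (a := a) (b := b))
    fun s hs => by
      by_contra h'
      exact hs (Ioo_subset_Icc_self (h.mem s h'))
  exact h.continuous.bounded_above_of_compact_support this

theorem IsL1.sub {Ω : Set Plane} {A B : Plane → Mat} (hA : IsL1 Ω A) (hB : IsL1 Ω B) :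
    IsL1 Ω (A - B) := fun i j => (hA i j).sub (hB i j)

theorem IsL1.add {Ω : Set Plane} {A B : Plane → Mat} (hA : IsL1 Ω A) (hB : IsL1 Ω B) :
    IsL1 Ω (A + B) := fun i j => (hA i j).add (hB i j)

theorem curlPairing_field_sub {Ω U : Set Plane} {A B : Plane → Mat} {φ : Plane → ℝ}
    (hA : IsL1 Ω A) (hB : IsL1 Ω B) (hφ : IsTest U φ) :
    curlPairing Ω (A - B) φ = curlPairing Ω A φ - curlPairing Ω B φ := by
  ext i
  simp only [curlPairing, Pi.sub_apply]
  rw [← integral_sub (integrableOn_mulVec_perpGrad hA hφ i) (integrableOn_mulVec_perpGrad hB hφ i)]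
  congr 1
  ext x
  simp [Matrix.sub_mulVec]

section Shear

variable {θ : ℝ → ℝ} {a b c ℓ : ℝ} {φ : Plane → ℝ} {e : ℤ → Fin 2 → ℝ}

theorem isL1_shearField (hθ : IsDensity θ a b) {v : Plane → Fin 2 → ℝ} {Ω : Set Plane}
    (hv : ∀ i, IntegrableOn (fun x => v x i) Ω) : IsL1 Ω (shearField θ v) := by
  intro i j
  by_cases hj : j = 0
  · obtain ⟨C, hC⟩ := hθ.exists_bound
    simp only [shearField, hj, if_true]
    exact (hv i).bdd_mul (c := C)
      (hθ.continuous.comp (continuous_coord 0)).aestronglyMeasurable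
      (ae_of_all _ fun x => hC _)
  · simp [shearField, hj]

theorem integrableOn_strip (he : ∀ i k, 0 ≤ e i k ∧ e i k < c) {Ω : Set Plane}
    (hΩ : volume Ω < ⊤) (k : Fin 2) :
    IntegrableOn (fun x : Plane => e (strip ℓ (x 1)) k) Ω := by
  have hm : Measurable fun x : Plane => e (strip ℓ (x 1)) k :=
    (measurable_from_top (f := fun i : ℤ => e i k)).comp
      ((measurable_strip ℓ).comp (measurable_coord 1))
  refine Measure.integrableOn_of_bounded (M := c) hΩ.ne hm.aestronglyMeasurable
    (ae_of_all _ fun x => ?_)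
  rw [Real.norm_eq_abs, abs_of_nonneg (he _ _).1]
  exact (he _ _).2.le

/-- The pairing of a test function with a shear that is constant in each strip only involves the
jumps of the test function between consecutive levels. -/
theorem curlPairing_shearField (hθ : IsDensity θ a b) (hℓ : 0 < ℓ) {N : ℕ} (hN : 1 ≤ N * ℓ)
    (he : ∀ i k, 0 ≤ e i k ∧ e i k < c) (hφ : IsTest (square (1 / 2)) φ)
    (hconst : ∀ s ∈ Ioo a b, ∀ i : ℕ, φ (pt (s, level ℓ i)) = φ (pt (a, level ℓ i))) (k : Fin 2) :
    curlPairing (square (1 / 2)) (shearField θ fun x => e (strip ℓ (x 1))) φ k =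
      ∑ i ∈ Finset.range N,
        e i k * (φ (pt (a, level ℓ (i + 1))) - φ (pt (a, level ℓ i))) := by
  have hL1 : IsL1 (square (1 / 2)) (shearField θ fun x => e (strip ℓ (x 1))) :=
    isL1_shearField hθ (integrableOn_strip he (volume_square_lt_top _))
  have hi : Integrable fun x => (shearField θ (fun x => e (strip ℓ (x 1))) x *ᵥ perpGrad φ x) k := by
    refine (integrableOn_iff_integrable_of_support_subset ?_).1
      (integrableOn_mulVec_perpGrad hL1 hφ k)
    intro x hx
    by_contra h
    exact hx (by simp [perpGrad_eq_zero_of_notMem_tsupport fun h' => h (hφ.2.2 h')])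
  rw [curlPairing_eq_integral hφ, ← integral_comp_pt, Measure.volume_eq_prod, integral_prod _
    (by rw [← Measure.volume_eq_prod]; exact integrable_comp_pt.2 hi)]
  simp only [shearField_mulVec, pt_zero, pt_one]
  have key : ∀ s, ∫ y, θ s * e (strip ℓ y) k * perpGrad φ (pt (s, y)) 0 = θ s *
      ∑ i ∈ Finset.range N, e i k * (φ (pt (a, level ℓ (i + 1))) - φ (pt (a, level ℓ i))) := by
    intro s
    simp only [mul_assoc]
    rw [integral_const_mul]
    by_cases hs : θ s = 0
    · simp [hs]
    · congr 1
      have hpt : Continuous fun y : ℝ => pt (s, y) := by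
        unfold pt
        fun_prop
      rw [integral_strip_mul_deriv hℓ hN (g := fun y => φ (pt (s, y)))
        (integral_perpGrad_pt_snd hφ.1 s)
        (((continuous_apply 0).comp (continuous_perpGrad hφ.1)).comp hpt) ?_ fun i => e i k]
      · refine Finset.sum_congr rfl fun i _ => ?_
        have := hconst s (hθ.mem s hs) (i + 1)
        push_cast at this
        rw [this, hconst s (hθ.mem s hs) i]
      · intro y hy
        rw [perpGrad_eq_zero_of_notMem_tsupport]
        · rfl
        · exact fun h => absurd (hφ.2.2 h).2 (not_lt.2 hy)
  simp only [key]
  rw [integral_mul_const, hθ.integral_eq_one, one_mul]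

end Shear

/-! ### Adjusting the phases -/

/-- A homomorphism to `ℝ` that takes values in `c ℤ` on the common kernel of finitely many
integer valued homomorphisms is, modulo `c ℤ`, a real linear combination of these. -/
theorem exists_combination_of_ker {G : Type*} [AddCommGroup G] (c : ℝ) (p : G →+ ℝ)
    (ev : ℕ → G →+ ℝ) (n : ℕ) : ∀ H : AddSubgroup G,
    (∀ g ∈ H, ∀ i, ∃ m : ℤ, ev i g = m) →
    (∀ g ∈ H, (∀ i < n, ev i g = 0) → ∃ k : ℤ, p g = c * k) →
    ∃ β : ℕ → ℝ, ∀ g ∈ H, ∃ k : ℤ, p g = ∑ i ∈ Finset.range n, ev i g * β i + c * k := by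
  induction n with
  | zero =>
    intro H _ h
    exact ⟨0, fun g hg => by simpa using h g hg (by simp)⟩
  | succ n ih =>
    intro H hint h
    obtain ⟨β, hβ⟩ := ih (H ⊓ (ev n).ker) (fun g hg => hint g hg.1) fun g hg hz =>
      h g hg.1 fun i hi => by
        rcases Nat.lt_succ_iff_lt_or_eq.1 hi with h' | rfl
        · exact hz i h'
        · exact hg.2
    -- the values of the last homomorphism form a cyclic group, generated by its value at `g₀`
    let D : AddSubgroup ℤ := (H.map (ev n)).comap (Int.castAddHom ℝ)
    obtain ⟨d, hd⟩ := Int.subgroup_cyclic D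
    obtain ⟨g₀, hg₀, hd₀⟩ : ∃ g₀ ∈ H, ev n g₀ = d := by
      have : d ∈ D := by
        rw [hd]
        exact AddSubgroup.mem_closure_of_mem rfl
      exact this
    have hmul : ∀ g ∈ H, ∃ m : ℤ, ev n g = m * d := by
      intro g hg
      obtain ⟨z, hz⟩ := hint g hg n
      have : z ∈ D := ⟨g, hg, hz⟩
      rw [hd, AddSubgroup.mem_closure_singleton] at this
      obtain ⟨m, hm⟩ := this
      refine ⟨m, ?_⟩
      rw [hz, ← hm]
      simp
    have hstep : ∀ g ∈ H, ∀ m : ℤ, ev n g = m * d → ∃ k : ℤ, p g =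
        ∑ i ∈ Finset.range n, ev i g * β i +
          m * (p g₀ - ∑ i ∈ Finset.range n, ev i g₀ * β i) + c * k := by
      intro g hg m hm
      obtain ⟨k, hk⟩ := hβ (g - m • g₀) ⟨H.sub_mem hg (H.zsmul_mem hg₀ m), by
        change ev n (g - m • g₀) = 0
        simp [hm, hd₀]⟩
      refine ⟨k, ?_⟩
      simp only [map_sub, map_zsmul, zsmul_eq_mul, sub_mul, Finset.sum_sub_distrib, mul_assoc,
        ← Finset.mul_sum] at hk
      linarith
    by_cases hd0 : d = 0
    · refine ⟨β, fun g hg => ?_⟩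
      obtain ⟨m, hm⟩ := hmul g hg
      have hz : ev n g = 0 := by simpa [hd0] using hm
      obtain ⟨k, hk⟩ := hstep g hg 0 (by simpa using hz)
      refine ⟨k, ?_⟩
      rw [Finset.sum_range_succ, hz, hk]
      simp
    · refine ⟨fun i => if i < n then β i else
        (p g₀ - ∑ i ∈ Finset.range n, ev i g₀ * β i) / d, fun g hg => ?_⟩
      obtain ⟨m, hm⟩ := hmul g hg
      obtain ⟨k, hk⟩ := hstep g hg m hm
      refine ⟨k, ?_⟩
      rw [Finset.sum_range_succ, hm, hk]
      have : (d : ℝ) ≠ 0 := by exact_mod_cast hd0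
      have hcongr : ∑ i ∈ Finset.range n, ev i g * (if i < n then β i else
          (p g₀ - ∑ i ∈ Finset.range n, ev i g₀ * β i) / d) =
          ∑ i ∈ Finset.range n, ev i g * β i :=
        Finset.sum_congr rfl fun i hi => by rw [if_pos (Finset.mem_range.1 hi)]
      rw [hcongr]
      simp only [lt_irrefl, if_false]
      field_simp

/-- The test functions on `Ω` that are locally integer constants near `S`, as a group. -/
def integerTests (Ω S : Set Plane) : AddSubgroup (Plane → ℝ) where
  carrier := {φ | IsTest Ω φ ∧ IsIntegerNear S φ}
  add_mem' h h' := ⟨h.1.add h'.1, h.2.add h'.2⟩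
  zero_mem' := ⟨IsTest.zero, isIntegerNear_of_eventuallyEq_zero fun _ _ => EventuallyEq.rfl⟩
  neg_mem' h := ⟨h.1.neg, h.2.neg⟩

/-- Suppose that `S` contains the horizontal segments `[a, b] × {level ℓ i}` and that the
circulations of `A` are quantized for those test functions that vanish on these segments. Then the
circulations can be quantized for all test functions by adding, in the column over `[a, b]`, a
shear that is constant in each strip: the shear shifts the circulation between consecutive
segments by an arbitrary amount. -/
theorem exists_shear_inLattice {c a b ℓ : ℝ} (hc : 0 < c) {A : Plane → Mat} {S : Set Plane}
    {θ : ℝ → ℝ} {N : ℕ} (hA : IsL1 (square (1 / 2)) A) (hℓ : 0 < ℓ) (hN : 1 ≤ N * ℓ)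
    (hab : a ≤ b) (hθ : IsDensity θ a b)
    (hS : ∀ s ∈ Icc a b, ∀ i : ℕ, |level ℓ i| < 1 / 2 → pt (s, level ℓ i) ∈ S)
    (hker : ∀ φ, IsTest (square (1 / 2)) φ → IsIntegerNear S φ →
      (∀ s ∈ Icc a b, ∀ i : ℕ, φ (pt (s, level ℓ i)) = 0) →
      InLattice c (curlPairing (square (1 / 2)) A φ)) :
    ∃ e : ℤ → Fin 2 → ℝ, (∀ i k, 0 ≤ e i k ∧ e i k < c) ∧
      ∀ φ, IsTest (square (1 / 2)) φ → IsIntegerNear S φ → InLattice c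
        (curlPairing (square (1 / 2)) (A - shearField θ fun x => e (strip ℓ (x 1))) φ) := by
  set Q := square (1 / 2) with hQ
  have hout : ∀ φ, IsTest Q φ → ∀ s, ∀ y, 1 / 2 ≤ |y| → φ (pt (s, y)) = 0 := fun φ hφ s y hy =>
    hφ.eq_zero fun h => absurd h.2 (not_lt.2 hy)
  have hconst : ∀ φ, IsTest Q φ → IsIntegerNear S φ → ∀ s ∈ Icc a b, ∀ i : ℕ,
      φ (pt (s, level ℓ i)) = φ (pt (a, level ℓ i)) := by
    intro φ hφ hi s hs i
    by_cases hl : |level ℓ i| < 1 / 2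
    · have hpt : Continuous fun s : ℝ => pt (s, level ℓ i) := by
        unfold pt
        fun_prop
      have hpre : IsPreconnected ((fun s => pt (s, level ℓ i)) '' Icc a b) :=
        isPreconnected_Icc.image _ hpt.continuousOn
      refine (hi.mono ?_).eq_of_isPreconnected hpre ⟨s, hs, rfl⟩ ⟨a, ⟨le_rfl, hab⟩, rfl⟩
      rintro _ ⟨s, hs, rfl⟩
      exact hS s hs i hl
    · rw [hout φ hφ _ _ (not_lt.1 hl), hout φ hφ _ _ (not_lt.1 hl)]
  have hinteger : ∀ φ, IsTest Q φ → IsIntegerNear S φ → ∀ i : ℕ,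
      ∃ m : ℤ, φ (pt (a, level ℓ i)) = m := by
    intro φ hφ hi i
    by_cases hl : |level ℓ i| < 1 / 2
    · exact hi.exists_int (hS a ⟨le_rfl, hab⟩ i hl)
    · exact ⟨0, by simpa using hout φ hφ _ _ (not_lt.1 hl)⟩
  have hbig : ∀ φ, IsTest Q φ → ∀ i : ℕ, N ≤ i → φ (pt (a, level ℓ i)) = 0 := by
    intro φ hφ i hi
    refine hout φ hφ _ _ (le_trans ?_ (le_abs_self _))
    have h1 : level ℓ N ≤ level ℓ i := level_mono hℓ.le (by exact_mod_cast hi)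
    have h2 : level ℓ N = -1 / 2 + N * ℓ := by simp [level]
    linarith
  have hβ : ∀ k : Fin 2, ∃ β : ℕ → ℝ, ∀ φ, IsTest Q φ → IsIntegerNear S φ → ∃ z : ℤ,
      curlPairing Q A φ k = ∑ i ∈ Finset.range N, φ (pt (a, level ℓ i)) * β i + c * z := by
    intro k
    let p : integerTests Q S →+ ℝ := AddMonoidHom.mk' (fun φ => curlPairing Q A φ.1 k)
      fun φ ψ => by
        have := congrFun (curlPairing_add hA φ.2.1 ψ.2.1) k
        exact this
    let ev : ℕ → integerTests Q S →+ ℝ := fun i => AddMonoidHom.mk'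
      (fun φ => φ.1 (pt (a, level ℓ i))) fun φ ψ => rfl
    obtain ⟨β, h⟩ := exists_combination_of_ker c p ev N ⊤ (fun φ _ i => hinteger φ.1 φ.2.1 φ.2.2 i)
      fun φ _ hz => by
        obtain ⟨v, hv⟩ := hker φ.1 φ.2.1 φ.2.2 fun s hs i => by
          rw [hconst φ.1 φ.2.1 φ.2.2 s hs i]
          by_cases hi : i < N
          · exact hz i hi
          · exact hbig φ.1 φ.2.1 i (not_lt.1 hi)
        exact ⟨v k, hv k⟩
    exact ⟨β, fun φ h1 h2 => h ⟨φ, h1, h2⟩ trivial⟩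
  choose β hβ using hβ
  -- the shear in a strip is the sum of the defects of the segments below it, reduced modulo `c`
  let B : ℕ → Fin 2 → ℝ := fun i k => -∑ j ∈ Finset.range (i + 1), β k j
  let e : ℤ → Fin 2 → ℝ := fun i k => c * Int.fract (B i.toNat k / c)
  have he : ∀ i k, 0 ≤ e i k ∧ e i k < c := fun i k =>
    ⟨mul_nonneg hc.le (Int.fract_nonneg _), by
      have := mul_lt_mul_of_pos_left (Int.fract_lt_one (B i.toNat k / c)) hc
      simpa [e] using this⟩
  have heB : ∀ (i : ℕ) k, e i k = B i k - c * ⌊B i k / c⌋ := by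
    intro i k
    simp only [e, Int.toNat_natCast, Int.fract]
    field_simp
  refine ⟨e, he, fun φ hφ hi => ?_⟩
  have hL1 : IsL1 Q (shearField θ fun x => e (strip ℓ (x 1))) :=
    isL1_shearField hθ (integrableOn_strip he (volume_square_lt_top _))
  rw [curlPairing_field_sub hA hL1 hφ]
  choose z hz using fun k => hβ k φ hφ hi
  choose m hm using hinteger φ hφ hi
  refine ⟨fun k => z k + ∑ i ∈ Finset.range N, ⌊B i k / c⌋ * (m (i + 1) - m i), fun k => ?_⟩
  rw [Pi.sub_apply, hz, curlPairing_shearField hθ hℓ hN he hφ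
    (fun s hs i => hconst φ hφ hi s (Ioo_subset_Icc_self hs) i)]
  have hstep : ∀ i : ℕ, φ (pt (a, level ℓ (i + 1))) = m (i + 1) := fun i => by
    have := hm (i + 1)
    push_cast at this
    exact this
  have hm0 : (m 0 : ℝ) = 0 := by
    rw [← hm 0]
    exact hout φ hφ _ _ (by norm_num [level])
  have hmN : (m N : ℝ) = 0 := by
    rw [← hm N]
    exact hbig φ hφ N le_rfl
  have habel : ∀ n : ℕ, ∑ i ∈ Finset.range n, B i k * ((m (i + 1) : ℝ) - m i) =
      B n k * m n + ∑ i ∈ Finset.range n, m i * β k i + m n * β k n := by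
    intro n
    induction n with
    | zero => simp [hm0]
    | succ n ih =>
      rw [Finset.sum_range_succ, ih, Finset.sum_range_succ (fun i => (m i : ℝ) * β k i)]
      have : B (n + 1) k = B n k - β k (n + 1) := by
        simp only [B]
        rw [Finset.sum_range_succ _ (n + 1)]
        ring
      rw [this]
      ring
  have habelN := habel N
  rw [hmN] at habelN
  simp only [hstep, hm, heB]
  push_cast
  simp only [sub_mul, Finset.sum_sub_distrib, habelN]
  rw [mul_add, Finset.mul_sum]
  simp only [mul_assoc]
  ring

/-! ### Vertical primitives in the strips -/

section Primitive

variable {ℓ : ℝ}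

/-- The indicator of `y'` lying below `y` in the same strip. -/
noncomputable def stripKernel (ℓ y y' : ℝ) : ℝ :=
  if strip ℓ y' = strip ℓ y ∧ y' ≤ y then 1 else 0

theorem measurableSet_stripKernel (ℓ : ℝ) :
    MeasurableSet {p : ℝ × ℝ | strip ℓ p.2 = strip ℓ p.1 ∧ p.2 ≤ p.1} :=
  (measurableSet_eq_fun ((measurable_strip ℓ).comp measurable_snd)
    ((measurable_strip ℓ).comp measurable_fst)).inter
      (measurableSet_le measurable_snd measurable_fst)

theorem measurable_stripKernel (ℓ : ℝ) :
    Measurable fun p : ℝ × ℝ => stripKernel ℓ p.1 p.2 :=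
  Measurable.ite (measurableSet_stripKernel ℓ) measurable_const measurable_const

theorem norm_stripKernel_le (ℓ y y' : ℝ) : ‖stripKernel ℓ y y'‖ ≤ 1 := by
  unfold stripKernel
  split_ifs <;> simp

theorem lintegral_stripKernel_le (hℓ : 0 < ℓ) (y' : ℝ) :
    ∫⁻ y, ‖stripKernel ℓ y y'‖ₑ ≤ ENNReal.ofReal ℓ := by
  have h : ∀ y, ‖stripKernel ℓ y y'‖ₑ ≤
      (Ico (level ℓ (strip ℓ y')) (level ℓ (strip ℓ y' + 1))).indicator 1 y := by
    intro y
    by_cases hy : strip ℓ y = strip ℓ y'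
    · have : y ∈ Ico (level ℓ (strip ℓ y')) (level ℓ (strip ℓ y' + 1)) := (strip_eq_iff hℓ).1 hy
      rw [indicator_of_mem this]
      unfold stripKernel
      split_ifs <;> simp
    · rw [stripKernel, if_neg fun h' => hy h'.1.symm]
      simp
  refine (lintegral_mono h).trans ?_
  rw [lintegral_indicator_one measurableSet_Ico, Real.volume_Ico, level_add_one]
  simp

theorem integral_stripKernel_mul {g g' : ℝ → ℝ} (hℓ : 0 < ℓ)
    (hg : ∀ a b, ∫ y in a..b, g' y = g b - g a) (y' : ℝ)
    (hz : ∀ i : ℤ, g (level ℓ i) = 0) : ∫ y, stripKernel ℓ y y' * g' y = -g y' := by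
  have hy' := (strip_eq_iff hℓ).1 (rfl : strip ℓ y' = strip ℓ y')
  have h : (fun y => stripKernel ℓ y y' * g' y) =
      (Ico y' (level ℓ (strip ℓ y' + 1))).indicator g' := by
    ext y
    by_cases hy : y ∈ Ico y' (level ℓ (strip ℓ y' + 1))
    · have : strip ℓ y = strip ℓ y' := (strip_eq_iff hℓ).2 ⟨hy'.1.trans hy.1, hy.2⟩
      rw [indicator_of_mem hy, stripKernel, if_pos ⟨this.symm, hy.1⟩, one_mul]
    · rw [indicator_of_notMem hy, stripKernel, if_neg, zero_mul]
      rintro ⟨h1, h2⟩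
      exact hy ⟨h2, ((strip_eq_iff hℓ).1 h1.symm).2⟩
  rw [h, integral_indicator measurableSet_Ico, integral_Ico_eq_integral_Ioc,
    ← intervalIntegral.integral_of_le hy'.2.le, hg, hz, zero_sub]

/-- Integration by parts in each strip, against a function that vanishes at the levels. -/
theorem integral_primitive_mul {f g g' : ℝ → ℝ} (hℓ : 0 < ℓ) (hf : Integrable f)
    (hg' : Integrable g') (hg : ∀ a b, ∫ y in a..b, g' y = g b - g a)
    (hz : ∀ i : ℤ, g (level ℓ i) = 0) :
    ∫ y, (∫ y', stripKernel ℓ y y' * f y') * g' y = -∫ y, f y * g y := by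
  have hint : Integrable (fun p : ℝ × ℝ => stripKernel ℓ p.1 p.2 * (g' p.1 * f p.2))
      (volume.prod volume) :=
    (hg'.mul_prod hf).bdd_mul (c := 1) (measurable_stripKernel ℓ).aestronglyMeasurable
      (ae_of_all _ fun p => norm_stripKernel_le _ _ _)
  calc ∫ y, (∫ y', stripKernel ℓ y y' * f y') * g' y
      = ∫ y, ∫ y', stripKernel ℓ y y' * (g' y * f y') := by
        congr 1
        ext y
        rw [← integral_mul_const]
        congr 1
        ext y'
        ring
    _ = ∫ y', ∫ y, stripKernel ℓ y y' * (g' y * f y') := integral_integral_swap hint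
    _ = ∫ y', -(f y' * g y') := by
        congr 1
        ext y'
        rw [← mul_neg, ← integral_stripKernel_mul hℓ hg y' hz, ← integral_const_mul]
        congr 1
        ext y
        ring
    _ = -∫ y, f y * g y := integral_neg _

/-- The vertical primitive of `f` that vanishes at the bottom of each strip. -/
noncomputable def primitive (ℓ : ℝ) (f : Plane → ℝ) (x : Plane) : ℝ :=
  ∫ y, stripKernel ℓ (x 1) y * f (pt (x 0, y))

variable {f : Plane → ℝ}

theorem measurable_primitive_aux (hf : Measurable f) : Measurable
    fun q : (ℝ × ℝ) × ℝ => stripKernel ℓ q.1.2 q.2 * f (pt (q.1.1, q.2)) :=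
  ((measurable_stripKernel ℓ).comp (by fun_prop : Measurable fun q : (ℝ × ℝ) × ℝ =>
    (q.1.2, q.2))).mul (hf.comp (measurable_pt.comp (by fun_prop)))

theorem measurable_primitive (hf : Measurable f) : Measurable (primitive ℓ f) := by
  have h := (measurable_primitive_aux (ℓ := ℓ) hf).stronglyMeasurable.integral_prod_right'
    (ν := (volume : Measure ℝ))
  exact h.measurable.comp ((measurable_coord 0).prodMk (measurable_coord 1))

theorem lintegral_stripKernel_mul_le (hℓ : 0 < ℓ) {u : Plane → ℝ≥0∞} (hu : Measurable u) :
    ∫⁻ x : Plane, ∫⁻ y, ‖stripKernel ℓ (x 1) y‖ₑ * u (pt (x 0, y)) ≤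
      ENNReal.ofReal ℓ * ∫⁻ x, u x := by
  have hm : Measurable fun q : (ℝ × ℝ) × ℝ => ‖stripKernel ℓ q.1.2 q.2‖ₑ * u (pt (q.1.1, q.2)) :=
    ((measurable_stripKernel ℓ).comp (by fun_prop : Measurable fun q : (ℝ × ℝ) × ℝ =>
      (q.1.2, q.2))).enorm.mul (hu.comp (measurable_pt.comp (by fun_prop)))
  have hup : Measurable fun p : ℝ × ℝ => u (pt p) := hu.comp measurable_pt
  rw [← lintegral_comp_pt, ← lintegral_comp_pt u]
  simp only [pt_zero, pt_one]
  rw [Measure.volume_eq_prod, lintegral_prod _ (hm.lintegral_prod_right').aemeasurable,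
    lintegral_prod _ hup.aemeasurable,
    ← lintegral_const_mul _ hup.lintegral_prod_right']
  refine lintegral_mono fun s => ?_
  have hm' : Measurable fun q : ℝ × ℝ => ‖stripKernel ℓ q.1 q.2‖ₑ * u (pt (s, q.2)) :=
    (measurable_stripKernel ℓ).enorm.mul (hu.comp (measurable_pt.comp (by fun_prop)))
  have hms : Measurable fun y : ℝ => u (pt (s, y)) := hu.comp (measurable_pt.comp (by fun_prop))
  rw [lintegral_lintegral_swap hm'.aemeasurable, ← lintegral_const_mul _ hms]
  refine lintegral_mono fun y => ?_
  have hk : Measurable fun y' : ℝ => ‖stripKernel ℓ y' y‖ₑ :=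
    ((measurable_stripKernel ℓ).comp (by fun_prop : Measurable fun y' : ℝ => (y', y))).enorm
  dsimp only
  rw [lintegral_mul_const _ hk]
  gcongr
  exact lintegral_stripKernel_le hℓ y

theorem integrable_primitive (hℓ : 0 < ℓ) (hf : Measurable f) (hi : Integrable f) :
    Integrable (primitive ℓ f) := by
  refine ⟨(measurable_primitive hf).aestronglyMeasurable, ?_⟩
  refine lt_of_le_of_lt (lintegral_mono fun x => enorm_integral_le_lintegral_enorm _) ?_
  simp only [enorm_mul]
  refine (lintegral_stripKernel_mul_le hℓ hf.enorm).trans_lt ?_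
  exact ENNReal.mul_lt_top ENNReal.ofReal_lt_top hi.2

theorem sq_lintegral_mul_le {α : Type*} [MeasurableSpace α] {μ : Measure α} {k u : α → ℝ≥0∞}
    (hk : AEMeasurable k μ) (hu : AEMeasurable u μ) :
    (∫⁻ x, k x * u x ∂μ) ^ 2 ≤ (∫⁻ x, k x ^ 2 ∂μ) * ∫⁻ x, u x ^ 2 ∂μ := by
  have h := ENNReal.lintegral_mul_le_Lp_mul_Lq μ Real.HolderConjugate.two_two hk hu
  have h2 := pow_le_pow_left₀ zero_le h 2
  simp only [Pi.mul_apply] at h2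
  refine h2.trans_eq ?_
  rw [mul_pow, ← ENNReal.rpow_natCast, ← ENNReal.rpow_natCast, ← ENNReal.rpow_mul,
    ← ENNReal.rpow_mul]
  norm_num

theorem enorm_stripKernel_sq (ℓ y y' : ℝ) :
    ‖stripKernel ℓ y y'‖ₑ ^ 2 = ‖stripKernel ℓ y y'‖ₑ := by
  unfold stripKernel
  split_ifs <;> simp

theorem lintegral_stripKernel_le' (hℓ : 0 < ℓ) (y : ℝ) :
    ∫⁻ y', ‖stripKernel ℓ y y'‖ₑ ≤ ENNReal.ofReal ℓ := by
  have h : ∀ y', ‖stripKernel ℓ y y'‖ₑ ≤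
      (Ico (level ℓ (strip ℓ y)) (level ℓ (strip ℓ y + 1))).indicator 1 y' := by
    intro y'
    by_cases hy : strip ℓ y' = strip ℓ y
    · have : y' ∈ Ico (level ℓ (strip ℓ y)) (level ℓ (strip ℓ y + 1)) := (strip_eq_iff hℓ).1 hy
      rw [indicator_of_mem this]
      unfold stripKernel
      split_ifs <;> simp
    · rw [stripKernel, if_neg fun h' => hy h'.1]
      simp
  refine (lintegral_mono h).trans ?_
  rw [lintegral_indicator_one measurableSet_Ico, Real.volume_Ico, level_add_one]
  simp

theorem enorm_primitive_sq_le (hℓ : 0 < ℓ) (hf : Measurable f) (x : Plane) :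
    ‖primitive ℓ f x‖ₑ ^ 2 ≤ ENNReal.ofReal ℓ *
      ∫⁻ y, ‖stripKernel ℓ (x 1) y‖ₑ * ‖f (pt (x 0, y))‖ₑ ^ 2 := by
  have hk : Measurable fun y : ℝ => ‖stripKernel ℓ (x 1) y‖ₑ :=
    ((measurable_stripKernel ℓ).comp (by fun_prop : Measurable fun y' : ℝ => (x 1, y'))).enorm
  have hu : Measurable fun y : ℝ => ‖f (pt (x 0, y))‖ₑ :=
    (hf.comp (measurable_pt.comp (by fun_prop))).enorm
  have h1 : ‖primitive ℓ f x‖ₑ ≤ ∫⁻ y, ‖stripKernel ℓ (x 1) y‖ₑ *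
      (‖stripKernel ℓ (x 1) y‖ₑ * ‖f (pt (x 0, y))‖ₑ) := by
    refine (enorm_integral_le_lintegral_enorm _).trans_eq ?_
    simp only [enorm_mul, ← mul_assoc, ← sq, enorm_stripKernel_sq]
  have h2 := (pow_le_pow_left₀ zero_le h1 2).trans
    (sq_lintegral_mul_le hk.aemeasurable (hk.mul hu).aemeasurable)
  simp only [mul_pow, enorm_stripKernel_sq] at h2
  refine h2.trans ?_
  gcongr
  exact lintegral_stripKernel_le' hℓ _

/-- A Poincaré inequality in the strips. -/
theorem lintegral_primitive_sq_le (hℓ : 0 < ℓ) (hf : Measurable f) :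
    ∫⁻ x, ‖primitive ℓ f x‖ₑ ^ 2 ≤ ENNReal.ofReal ℓ ^ 2 * ∫⁻ x, ‖f x‖ₑ ^ 2 := by
  have h3 := lintegral_stripKernel_mul_le hℓ (u := fun x => ‖f x‖ₑ ^ 2) (hf.enorm.pow_const 2)
  refine (lintegral_mono fun x => enorm_primitive_sq_le hℓ hf x).trans ?_
  rw [lintegral_const_mul' _ _ ENNReal.ofReal_ne_top, pow_two, mul_assoc]
  gcongr

theorem continuous_pt (s : ℝ) : Continuous fun y : ℝ => pt (s, y) := by
  unfold pt
  fun_prop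

/-- Integration by parts in the strips of a column, against a test function that vanishes on the
levels inside of the column. -/
theorem integral_density_primitive {θ : ℝ → ℝ} {a b : ℝ} {Ω : Set Plane} {φ : Plane → ℝ}
    (hℓ : 0 < ℓ) (hθ : IsDensity θ a b) (hf : Measurable f) (hi : Integrable f) (hφ : IsTest Ω φ)
    (hz : ∀ s ∈ Ioo a b, ∀ i : ℤ, φ (pt (s, level ℓ i)) = 0) :
    ∫ x : Plane, θ (x 0) * primitive ℓ f x * perpGrad φ x 0 =
      -∫ x : Plane, θ (x 0) * f x * φ x := by
  obtain ⟨C, hC⟩ := hθ.exists_bound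
  obtain ⟨D, hD⟩ := exists_perpGrad_bound hφ
  obtain ⟨E, hE⟩ := hφ.1.continuous.bounded_above_of_compact_support hφ.2.1
  have hθm : AEStronglyMeasurable (fun x : Plane => θ (x 0)) volume :=
    (hθ.continuous.comp (continuous_coord 0)).aestronglyMeasurable
  have hg : Continuous fun x => perpGrad φ x 0 :=
    (continuous_apply 0).comp (continuous_perpGrad hφ.1)
  have h1 : Integrable fun x : Plane => θ (x 0) * primitive ℓ f x * perpGrad φ x 0 :=
    ((integrable_primitive hℓ hf hi).bdd_mul hθm (ae_of_all _ fun x => hC _)).mul_bdd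
      hg.aestronglyMeasurable (ae_of_all _ fun x => hD x 0)
  have h2 : Integrable fun x : Plane => θ (x 0) * f x * φ x :=
    (hi.bdd_mul hθm (ae_of_all _ fun x => hC _)).mul_bdd
      hφ.1.continuous.aestronglyMeasurable (ae_of_all _ fun x => hE x)
  have hsec : ∀ᵐ s : ℝ, Integrable fun y : ℝ => f (pt (s, y)) := by
    have := integrable_comp_pt.2 hi
    rw [Measure.volume_eq_prod] at this
    exact this.prod_right_ae
  rw [← integral_comp_pt, ← integral_comp_pt fun x => θ (x 0) * f x * φ x, Measure.volume_eq_prod,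
    integral_prod _ (by rw [← Measure.volume_eq_prod]; exact integrable_comp_pt.2 h1),
    integral_prod _ (by rw [← Measure.volume_eq_prod]; exact integrable_comp_pt.2 h2),
    ← integral_neg]
  refine integral_congr_ae ?_
  filter_upwards [hsec] with s hs
  simp only [pt_zero, mul_assoc]
  rw [integral_const_mul, integral_const_mul]
  by_cases h0 : θ s = 0
  · simp [h0]
  · rw [← mul_neg]
    congr 1
    have hcs : HasCompactSupport fun y => perpGrad φ (pt (s, y)) 0 := by
      obtain ⟨r, hr⟩ := (show IsCompact (tsupport φ) from hφ.2.1).isBounded.exists_norm_le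
      refine HasCompactSupport.intro (isCompact_Icc (a := -r) (b := r)) fun y hy => ?_
      rw [perpGrad_eq_zero_of_notMem_tsupport]
      · rfl
      · intro h
        have := (PiLp.norm_apply_le (pt (s, y)) 1).trans (hr _ h)
        rw [pt_one, Real.norm_eq_abs, abs_le] at this
        exact hy this
    exact integral_primitive_mul hℓ hs ((hg.comp (continuous_pt s)).integrable_of_hasCompactSupport hcs)
      (integral_perpGrad_pt_snd hφ.1 s) (hz s (hθ.mem s h0))

end Primitive

/-! ### Replacing a field by a rotation beyond a column -/

/-- `η` is a smooth cutoff function equal to `1` near `(-∞, a]` and to `0` near `[b, ∞)`, and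
`-θ` is its derivative. -/
structure IsCutoff (η θ : ℝ → ℝ) (a b : ℝ) : Prop where
  contDiff : ContDiff ℝ ∞ η
  hasDerivAt : ∀ s, HasDerivAt η (-θ s) s
  eventually_one : ∀ s ≤ a, η =ᶠ[𝓝 s] fun _ => 1
  eventually_zero : ∀ s, b ≤ s → η =ᶠ[𝓝 s] fun _ => 0
  nonneg : ∀ s, 0 ≤ η s
  le_one : ∀ s, η s ≤ 1

theorem IsCutoff.isDensity {η θ : ℝ → ℝ} {a b : ℝ} (h : IsCutoff η θ a b) (hab : a ≤ b) :
    IsDensity θ a b := by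
  have hd : θ = fun s => -deriv η s := by
    ext s
    rw [(h.hasDerivAt s).deriv, neg_neg]
  have hc : Continuous θ := by
    rw [hd]
    exact (h.contDiff.continuous_deriv (by simp)).neg
  have hm : ∀ s, θ s ≠ 0 → s ∈ Ioo a b := by
    intro s hs
    constructor <;> by_contra! h'
    · exact hs (by simp [hd, (h.eventually_one s h').deriv_eq])
    · exact hs (by simp [hd, (h.eventually_zero s h').deriv_eq])
  refine ⟨hc, hm, ?_⟩
  have h1 : ∫ s in a..b, -θ s = η b - η a :=
    intervalIntegral.integral_eq_sub_of_hasDerivAt (fun s _ => h.hasDerivAt s)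
      (hc.neg.intervalIntegrable _ _)
  rw [(h.eventually_one a le_rfl).eq_of_nhds, (h.eventually_zero b le_rfl).eq_of_nhds,
    intervalIntegral.integral_neg, intervalIntegral.integral_of_le hab,
    setIntegral_eq_integral_of_forall_compl_eq_zero fun s hs => by
      by_contra h'
      exact hs (Ioo_subset_Ioc_self (hm s h'))] at h1
  linarith

theorem exists_isCutoff : ∃ C : ℝ, 0 < C ∧ ∀ a b : ℝ, a < b →
    ∃ η θ : ℝ → ℝ, IsCutoff η θ a b ∧ ∀ s, |θ s| ≤ C / (b - a) := by
  let η₀ : ℝ → ℝ := fun s => 1 - Real.smoothTransition (2 * s - 1 / 2)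
  have hc : ContDiff ℝ ∞ η₀ := contDiff_const.sub
    (Real.smoothTransition.contDiff.comp (by fun_prop))
  have h1 : ∀ s ≤ 1 / 4, η₀ s = 1 := fun s hs => by
    simp only [η₀]
    rw [Real.smoothTransition.zero_of_nonpos (by linarith), sub_zero]
  have h0 : ∀ s, 3 / 4 ≤ s → η₀ s = 0 := fun s hs => by
    simp only [η₀]
    rw [Real.smoothTransition.one_of_one_le (by linarith), sub_self]
  have hcs : HasCompactSupport (deriv η₀) := by
    refine HasCompactSupport.intro (isCompact_Icc (a := 0) (b := 1)) fun s hs => ?_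
    by_cases h : s < 1 / 4
    · have : η₀ =ᶠ[𝓝 s] fun _ => 1 := by
        filter_upwards [Iio_mem_nhds h] with x hx using h1 x (le_of_lt hx)
      rw [this.deriv_eq, deriv_const]
    · have h' : 3 / 4 < s := by
        by_contra h''
        exact hs ⟨by linarith, by linarith⟩
      have : η₀ =ᶠ[𝓝 s] fun _ => 0 := by
        filter_upwards [Ioi_mem_nhds h'] with x hx using h0 x (le_of_lt hx)
      rw [this.deriv_eq, deriv_const]
  obtain ⟨C, hC⟩ := (hc.continuous_deriv (by simp)).bounded_above_of_compact_support hcs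
  refine ⟨max C 1, by positivity, fun a b hab => ?_⟩
  have hw : 0 < b - a := sub_pos.2 hab
  have hconv : ∀ s, Tendsto (fun x => (x - a) / (b - a)) (𝓝 s) (𝓝 ((s - a) / (b - a))) := fun s =>
    (Continuous.tendsto (by fun_prop) s)
  refine ⟨fun s => η₀ ((s - a) / (b - a)), fun s => -(deriv η₀ ((s - a) / (b - a)) / (b - a)),
    ⟨hc.comp (by fun_prop), fun s => ?_, fun s hs => ?_, fun s hs => ?_, fun s => ?_, fun s => ?_⟩,
    fun s => ?_⟩
  · have h2 : HasDerivAt (fun x => (x - a) / (b - a)) (1 / (b - a)) s :=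
      ((hasDerivAt_id s).sub_const a).div_const _
    have h3 := ((hc.differentiable (by simp) ((s - a) / (b - a))).hasDerivAt).comp s h2
    rw [mul_one_div] at h3
    rw [neg_neg]
    exact h3
  · have : (s - a) / (b - a) < 1 / 4 :=
      (div_nonpos_of_nonpos_of_nonneg (by linarith) hw.le).trans_lt (by norm_num)
    filter_upwards [(hconv s).eventually (Iio_mem_nhds this)] with x hx using h1 _ (le_of_lt hx)
  · have : 3 / 4 < (s - a) / (b - a) :=
      lt_of_lt_of_le (by norm_num) ((one_le_div hw).2 (by linarith))
    filter_upwards [(hconv s).eventually (Ioi_mem_nhds this)] with x hx using h0 _ (le_of_lt hx)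
  · simp only [η₀]
    linarith [Real.smoothTransition.le_one (2 * ((s - a) / (b - a)) - 1 / 2)]
  · simp only [η₀]
    linarith [Real.smoothTransition.nonneg (2 * ((s - a) / (b - a)) - 1 / 2)]
  · rw [abs_neg, abs_div, abs_of_pos hw]
    gcongr
    exact (hC _).trans (le_max_left _ _)

/-- A test function on `Ω` also is locally an integer constant near the points outside of `Ω`. -/
theorem IsIntegerNear.union_compl {Ω S : Set Plane} {φ : Plane → ℝ} (h : IsIntegerNear S φ)
    (hφ : IsTest Ω φ) : IsIntegerNear (S ∪ Ωᶜ) φ := by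
  rintro s (hs | hs)
  · exact h s hs
  · exact ⟨0, (hφ.eventually_eq_zero hs).trans (by simp; rfl)⟩

theorem perpGrad_comp_coord {η θ : ℝ → ℝ} {a b : ℝ} (h : IsCutoff η θ a b) (x : Plane) :
    perpGrad (fun x : Plane => η (x 0)) x = ![0, θ (x 0)] := by
  have h1 : HasFDerivAt (fun x : Plane => x 0) (EuclideanSpace.proj (𝕜 := ℝ) (0 : Fin 2)) x :=
    (EuclideanSpace.proj (𝕜 := ℝ) (0 : Fin 2)).hasFDerivAt
  have h2 := ((h.hasDerivAt (x 0)).comp_hasFDerivAt x h1).fderiv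
  have h3 : (η ∘ fun x : Plane => x 0) = fun x : Plane => η (x 0) := rfl
  rw [h3] at h2
  ext i
  fin_cases i <;> simp [perpGrad, h2]

theorem contDiff_comp_coord {η : ℝ → ℝ} (h : ContDiff ℝ ∞ η) (i : Fin 2) :
    ContDiff ℝ ∞ fun x : Plane => η (x i) := by
  refine h.comp ?_
  exact (EuclideanSpace.proj (𝕜 := ℝ) i).contDiff

section Lateral

variable {τ ε ℓ a b : ℝ} {η θ : ℝ → ℝ} {A : Plane → Mat} {S : Set Plane} {R : Mat}
  {bad : Finset ℤ}

/-- The part of the column over `(a, b)` that lies in the strips with index outside `bad`. -/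
def goodColumn (ℓ a b : ℝ) (bad : Finset ℤ) : Set Plane :=
  {x | x ∈ square (1 / 2) ∧ a < x 0 ∧ x 0 < b ∧ strip ℓ (x 1) ∉ bad}

/-- The union of the horizontal segments at the levels and of the bad boxes, in the column over
`[a, b]`. -/
def columnSet (ℓ a b : ℝ) (bad : Finset ℤ) : Set Plane :=
  {x | x ∈ square (1 / 2) ∧ a ≤ x 0 ∧ x 0 ≤ b ∧
    ((∃ i : ℤ, x 1 = level ℓ i) ∨ ∃ i ∈ bad, x 1 ∈ Icc (level ℓ i) (level ℓ (i + 1)))}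

/-- The second column of `A - R` in the good boxes. -/
noncomputable def columnDefect (ℓ a b : ℝ) (bad : Finset ℤ) (A : Plane → Mat) (R : Mat)
    (k : Fin 2) : Plane → ℝ :=
  (goodColumn ℓ a b bad).indicator fun x => (A x - R) k 1

/-- The interpolation between `A` and the constant `R` in the column over `[a, b]`, corrected by a
shear. In each good box the shear compensates the curl that is produced by the interpolation; in
addition it may shift the phase of each strip by the vector `e`. -/
noncomputable def lateralField (ℓ a b : ℝ) (bad : Finset ℤ) (η θ : ℝ → ℝ) (A : Plane → Mat)
    (R : Mat) (e : ℤ → Fin 2 → ℝ) (x : Plane) : Mat :=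
  η (x 0) • A x + (1 - η (x 0)) • R - shearField θ
    (fun x k => primitive ℓ (columnDefect ℓ a b bad A R k) x + e (strip ℓ (x 1)) k) x

theorem measurableSet_goodColumn : MeasurableSet (goodColumn ℓ a b bad) :=
  (measurableSet_square _).inter ((measurableSet_lt measurable_const (measurable_coord 0)).inter
    ((measurableSet_lt (measurable_coord 0) measurable_const).inter
      (((measurable_strip ℓ).comp (measurable_coord 1)) (MeasurableSet.of_discrete (s := (bad : Set ℤ)ᶜ)))))

theorem measurable_columnDefect (hA : ∀ i j, Measurable fun x => A x i j) (k : Fin 2) :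
    Measurable (columnDefect ℓ a b bad A R k) :=
  ((hA k 1).sub_const (R k 1)).indicator measurableSet_goodColumn

theorem isL1_const {Ω : Set Plane} (hΩ : volume Ω < ⊤) (R : Mat) : IsL1 Ω fun _ => R :=
  fun _ _ => integrableOn_const hΩ.ne

theorem integrable_columnDefect (hA : IsL1 (square (1 / 2)) A) (k : Fin 2) :
    Integrable (columnDefect ℓ a b bad A R k) := by
  rw [columnDefect, integrable_indicator_iff measurableSet_goodColumn]
  exact ((hA.sub (isL1_const (volume_square_lt_top _) R)) k 1).mono_set fun x hx => hx.1

theorem exists_isClosed_columnSet (hℓ : 0 < ℓ) :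
    ∃ C : Set Plane, IsClosed C ∧ columnSet ℓ a b bad = square (1 / 2) ∩ C := by
  have h0 := continuous_coord 0
  have h1 := continuous_coord 1
  refine ⟨{x | a ≤ x 0 ∧ x 0 ≤ b} ∩ ({x | ∃ i : ℤ, x 1 = level ℓ i} ∪
    ⋃ i ∈ bad, {x | level ℓ i ≤ x 1 ∧ x 1 ≤ level ℓ (i + 1)}), ?_, ?_⟩
  · refine ((isClosed_le continuous_const h0).inter (isClosed_le h0 continuous_const)).inter
      (IsClosed.union ?_ ?_)
    · have h2 : {x : Plane | ∃ i : ℤ, x 1 = level ℓ i} =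
          (fun x : Plane => (x 1 + 1 / 2) / ℓ) ⁻¹' range ((↑) : ℤ → ℝ) := by
        ext x
        simp only [mem_ofPred_eq, mem_preimage, mem_range, level]
        refine exists_congr fun i => ?_
        rw [eq_div_iff hℓ.ne']
        constructor <;> intro h <;> linarith
      rw [h2]
      exact (Int.isClosedEmbedding_coe_real.isClosed_range).preimage
        ((h1.add continuous_const).div_const _)
    · exact isClosed_biUnion_finset fun i _ =>
        (isClosed_le continuous_const h1).inter (isClosed_le h1 continuous_const)
  · ext x
    simp only [columnSet, mem_ofPred_eq, mem_inter_iff, mem_union, mem_iUnion, mem_Icc, exists_prop,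
      and_assoc]

/-- A test function that is locally an integer constant near the segments and the bad boxes, and
that vanishes on the segments, vanishes near the bad boxes. -/
theorem eventuallyEq_zero_of_bad {φ : Plane → ℝ} (hℓ : 0 < ℓ) (hφ : IsTest (square (1 / 2)) φ)
    (hi : IsIntegerNear (columnSet ℓ a b bad) φ)
    (hz : ∀ s ∈ Icc a b, ∀ i : ℤ, φ (pt (s, level ℓ i)) = 0) {x : Plane}
    (h0 : x 0 ∈ Icc a b) (hx : strip ℓ (x 1) ∈ bad) : φ =ᶠ[𝓝 x] 0 := by
  obtain ⟨h2, h3⟩ := (strip_eq_iff hℓ).1 (rfl : strip ℓ (x 1) = _)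
  set T : Set Plane := (fun y => pt (x 0, y)) '' Icc (level ℓ (strip ℓ (x 1))) (x 1)
  have hT : IsPreconnected T := isPreconnected_Icc.image _ (continuous_pt _).continuousOn
  have hTi : IsIntegerNear T φ := (hi.union_compl hφ).mono <| by
    rintro _ ⟨y, hy, rfl⟩
    by_cases hQ : pt (x 0, y) ∈ square (1 / 2)
    · exact Or.inl ⟨hQ, h0.1, h0.2, Or.inr ⟨_, hx, hy.1, hy.2.trans h3.le⟩⟩
    · exact Or.inr hQ
  have hxT : x ∈ T := ⟨x 1, ⟨h2, le_rfl⟩, pt_coord x⟩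
  have h4 := hTi.eventuallyEq hxT
  rw [hTi.eq_of_isPreconnected hT hxT ⟨_, ⟨le_rfl, h2⟩, rfl⟩, hz _ h0] at h4
  exact h4

theorem isL1_smul {Ω : Set Plane} (hA : IsL1 Ω A) {g : Plane → ℝ} (hg : Continuous g) {C : ℝ}
    (hC : ∀ x, ‖g x‖ ≤ C) : IsL1 Ω fun x => g x • A x := fun i j =>
  (hA i j).bdd_mul (c := C) hg.aestronglyMeasurable (ae_of_all _ hC)

/-- The interpolated field satisfies the circulation condition for the test functions that vanish
on the segments. -/
theorem inLattice_lateral_of_eq_zero (hA : Admissible τ ε (square (1 / 2)) A S)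
    (hmeas : ∀ i j, Measurable fun x => A x i j) (hℓ : 0 < ℓ) (hab : a ≤ b)
    (hη : IsCutoff η θ a b)
    (hbad : ∀ s ∈ S, a ≤ s 0 → s 0 ≤ b → strip ℓ (s 1) ∈ bad) {φ : Plane → ℝ}
    (hφ : IsTest (square (1 / 2)) φ)
    (hi : IsIntegerNear ({x ∈ S | x 0 ≤ a} ∪ columnSet ℓ a b bad) φ)
    (hz : ∀ s ∈ Icc a b, ∀ i : ℤ, φ (pt (s, level ℓ i)) = 0) :
    InLattice (τ * ε) (curlPairing (square (1 / 2)) (lateralField ℓ a b bad η θ A R 0) φ) := by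
  set Q := square (1 / 2) with hQ
  have hθ := hη.isDensity hab
  have hηc := contDiff_comp_coord hη.contDiff 0
  set H : Plane → ℝ := fun x => η (x 0) with hH
  have hH' : ContDiff ℝ ∞ ((fun _ => 1) - H) := contDiff_const.sub hηc
  have hHφ : IsTest Q (H * φ) := hφ.mul_left hηc
  have hHφ' : IsTest Q (((fun _ => 1) - H) * φ) := hφ.mul_left hH'
  have hcol := hi.mono subset_union_right
  have hzero : ∀ x : Plane, x 0 ∈ Icc a b → strip ℓ (x 1) ∈ bad → φ =ᶠ[𝓝 x] 0 := fun x h0 hx =>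
    eventuallyEq_zero_of_bad hℓ hφ hcol hz h0 hx
  have hint : IsIntegerNear S (H * φ) := by
    intro s hs
    have ht : Tendsto (fun x : Plane => x 0) (𝓝 s) (𝓝 (s 0)) := (continuous_coord 0).tendsto s
    rcases le_or_gt (s 0) a with h1 | h1
    · obtain ⟨n, hn⟩ := hi s (Or.inl ⟨hs, h1⟩)
      refine ⟨n, ?_⟩
      filter_upwards [hn, ht.eventually (hη.eventually_one _ h1)] with x h2 h3
      simp [hH, h2, h3]
    · rcases le_or_gt b (s 0) with h2 | h2
      · refine ⟨0, ?_⟩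
        filter_upwards [ht.eventually (hη.eventually_zero _ h2)] with x h3
        simp [hH, h3]
      · refine ⟨0, ?_⟩
        filter_upwards [hzero s ⟨h1.le, h2.le⟩ (hbad s hs h1.le h2.le)] with x h3
        simp [h3]
  have hmain := hA.inLattice (isOpen_square _) (convex_square _) hHφ hint
  have hR := curlPairing_const hHφ' R
  convert hmain using 1
  ext k
  have hRk := congrFun hR k
  set f := columnDefect ℓ a b bad A R k with hf
  have hfm : Measurable f := measurable_columnDefect hmeas k
  have hfi : Integrable f := integrable_columnDefect hA.integrable k
  have hparts := integral_density_primitive hℓ hθ hfm hfi hφ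
    fun s hs i => hz s (Ioo_subset_Icc_self hs) i
  obtain ⟨C, hC⟩ := hθ.exists_bound
  obtain ⟨D, hD⟩ := exists_perpGrad_bound hφ
  obtain ⟨E, hE⟩ := hφ.1.continuous.bounded_above_of_compact_support hφ.2.1
  have hθm : AEStronglyMeasurable (fun x : Plane => θ (x 0)) volume :=
    (hθ.continuous.comp (continuous_coord 0)).aestronglyMeasurable
  have i1 : Integrable fun x : Plane => θ (x 0) * primitive ℓ f x * perpGrad φ x 0 :=
    ((integrable_primitive hℓ hfm hfi).bdd_mul hθm (ae_of_all _ fun x => hC _)).mul_bdd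
      ((continuous_apply 0).comp (continuous_perpGrad hφ.1)).aestronglyMeasurable
      (ae_of_all _ fun x => hD x 0)
  have i2 : Integrable fun x : Plane => θ (x 0) * f x * φ x :=
    (hfi.bdd_mul hθm (ae_of_all _ fun x => hC _)).mul_bdd
      hφ.1.continuous.aestronglyMeasurable (ae_of_all _ fun x => hE x)
  have s1 : ∫ x in Q, θ (x 0) * primitive ℓ f x * perpGrad φ x 0 =
      ∫ x : Plane, θ (x 0) * primitive ℓ f x * perpGrad φ x 0 := by
    apply setIntegral_eq_integral_of_forall_compl_eq_zero
    intro x hx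
    rw [perpGrad_eq_zero_of_notMem_tsupport fun h => hx (hφ.2.2 h)]
    simp
  have s2 : ∫ x in Q, θ (x 0) * f x * φ x = ∫ x : Plane, θ (x 0) * f x * φ x := by
    apply setIntegral_eq_integral_of_forall_compl_eq_zero
    intro x hx
    rw [hφ.eq_zero hx, mul_zero]
  have j1 := integrableOn_mulVec_perpGrad hA.integrable hHφ k
  have j2 := integrableOn_mulVec_perpGrad (isL1_const (volume_square_lt_top (1 / 2)) R) hHφ' k
  have hpt : ∀ x ∈ Q, (lateralField ℓ a b bad η θ A R 0 x *ᵥ perpGrad φ x) k =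
      (A x *ᵥ perpGrad (H * φ) x) k + (R *ᵥ perpGrad (((fun _ => 1) - H) * φ) x) k -
        (θ (x 0) * f x * φ x + θ (x 0) * primitive ℓ f x * perpGrad φ x 0) := by
    intro x hx
    have hH1 : Differentiable ℝ H := hηc.differentiable (by simp)
    have e1 : perpGrad H x = ![0, θ (x 0)] := perpGrad_comp_coord hη x
    have e2 : perpGrad ((fun _ => 1) - H) x = ![0, -θ (x 0)] := by
      have : perpGrad H x + perpGrad ((fun _ => 1) - H) x = 0 := by
        rw [← perpGrad_add hH1 (hH'.differentiable (by simp))]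
        simpa using perpGrad_const (x := x) 1
      rw [e1] at this
      have h0 := congrFun this 0
      have h1 := congrFun this 1
      simp only [Pi.add_apply, Matrix.cons_val_zero, Matrix.cons_val_one, Pi.zero_apply] at h0 h1
      ext i
      fin_cases i
      · simpa using h0
      · simp only [Fin.mk_one, Matrix.cons_val_one]
        simp only [Matrix.cons_val_fin_one] at h1 ⊢
        linarith
    have e3 : θ (x 0) * f x * φ x = θ (x 0) * (A x k 1 - R k 1) * φ x := by
      by_cases h0 : θ (x 0) = 0
      · simp [h0]
      · have hx0 := hθ.mem _ h0
        by_cases hb : strip ℓ (x 1) ∈ bad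
        · rw [(hzero x (Ioo_subset_Icc_self hx0) hb).eq_of_nhds]
          simp
        · have : x ∈ goodColumn ℓ a b bad := ⟨hx, hx0.1, hx0.2, hb⟩
          rw [hf, columnDefect, indicator_of_mem this]
          simp
    rw [perpGrad_mul hH1 hφ.differentiable, perpGrad_mul (hH'.differentiable (by simp))
      hφ.differentiable, e1, e2, e3]
    simp only [lateralField, Matrix.sub_mulVec, Pi.sub_apply, shearField_mulVec, Pi.zero_apply,
      add_zero, ← hf]
    simp only [Matrix.mulVec, dotProduct, Fin.sum_univ_two, Matrix.add_apply,
      Matrix.smul_apply, smul_eq_mul, Pi.add_apply, Pi.smul_apply, Matrix.cons_val_zero,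
      Matrix.cons_val_one, hH, Matrix.cons_val_fin_one]
    ring
  have hsum : curlPairing Q (lateralField ℓ a b bad η θ A R 0) φ k =
      curlPairing Q A (H * φ) k + curlPairing Q (fun _ => R) (((fun _ => 1) - H) * φ) k -
        ((∫ x in Q, θ (x 0) * f x * φ x) +
          ∫ x in Q, θ (x 0) * primitive ℓ f x * perpGrad φ x 0) := by
    refine (setIntegral_congr_fun (measurableSet_square _) hpt).trans ?_
    refine (integral_sub (j1.add j2) (i2.integrableOn.add i1.integrableOn)).trans ?_
    exact congrArg₂ (· - ·) (integral_add j1 j2) (integral_add i2.integrableOn i1.integrableOn)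
  rw [hsum, hRk, s1, s2, hparts, Pi.zero_apply, add_zero, add_neg_cancel, sub_zero]

/-- Beyond the column over `[a, b]` an admissible field may be replaced by a constant: the pair
remains admissible after a suitable choice of the phases in the column. -/
theorem exists_admissible_lateralField (hτε : 0 < τ * ε)
    (hA : Admissible τ ε (square (1 / 2)) A S)
    (hmeas : ∀ i j, Measurable fun x => A x i j) {N : ℕ} (hℓ : 0 < ℓ) (hN : 1 ≤ N * ℓ)
    (ha : -1 / 2 < a) (hab : a ≤ b) (hb : b < 1 / 2) (hη : IsCutoff η θ a b)
    (hbad : ∀ s ∈ S, a ≤ s 0 → s 0 ≤ b → strip ℓ (s 1) ∈ bad) :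
    ∃ e : ℤ → Fin 2 → ℝ, (∀ i k, 0 ≤ e i k ∧ e i k < τ * ε) ∧
      Admissible τ ε (square (1 / 2)) (lateralField ℓ a b bad η θ A R e)
        ({x ∈ S | x 0 ≤ a} ∪ columnSet ℓ a b bad) := by
  set Q := square (1 / 2) with hQ
  have hθ := hη.isDensity hab
  have hL0 : IsL1 Q (lateralField ℓ a b bad η θ A R 0) := by
    have hηc : Continuous fun x : Plane => η (x 0) :=
      (contDiff_comp_coord hη.contDiff 0).continuous
    refine ((isL1_smul hA.integrable hηc (C := 1) fun x => ?_).add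
      (isL1_smul (isL1_const (volume_square_lt_top (1 / 2)) R) (continuous_const.sub hηc) (C := 1)
        fun x => ?_)).sub (isL1_shearField hθ fun k => ?_)
    · rw [Real.norm_eq_abs, abs_of_nonneg (hη.nonneg _)]
      exact hη.le_one _
    · have h1 := hη.le_one (x 0)
      have h2 := hη.nonneg (x 0)
      rw [Real.norm_eq_abs]
      exact abs_le.2 ⟨by simp only [Pi.sub_apply]; linarith, by simp only [Pi.sub_apply]; linarith⟩
    · simpa using (integrable_primitive hℓ (measurable_columnDefect hmeas k)
        (integrable_columnDefect hA.integrable k)).integrableOn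
  obtain ⟨e, he, hlat⟩ := exists_shear_inLattice hτε hL0 hℓ hN hab hθ
    (S := {x ∈ S | x 0 ≤ a} ∪ columnSet ℓ a b bad)
    (fun s hs i hi => Or.inr ⟨⟨abs_lt.2 ⟨by simp only [pt_zero]; linarith [hs.1], by
      simp only [pt_zero]; linarith [hs.2]⟩, hi⟩, hs.1, hs.2, Or.inl ⟨i, rfl⟩⟩)
    fun φ hφ hi hz => inLattice_lateral_of_eq_zero hA hmeas hℓ hab hη hbad hφ hi fun s hs i => by
      rcases le_or_gt 0 i with h0 | h0
      · lift i to ℕ using h0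
        exact hz s hs i
      · refine hφ.eq_zero fun h => absurd h.2 (not_lt.2 ?_)
        have : level ℓ i ≤ level ℓ 0 := level_mono hℓ.le h0.le
        simp only [level, Int.cast_zero] at this
        simp only [pt_one, level]
        rw [abs_of_neg (by linarith)]
        linarith
  refine ⟨e, he, ?_⟩
  have heq : lateralField ℓ a b bad η θ A R e = lateralField ℓ a b bad η θ A R 0 -
      shearField θ fun x => e (strip ℓ (x 1)) := by
    ext x i j
    fin_cases j <;> simp [lateralField, shearField]
    ring
  refine Admissible.of_inLattice (isOpen_square _) ?_ ?_ fun φ hφ hi => ?_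
  · rw [heq]
    exact hL0.sub (isL1_shearField hθ (integrableOn_strip he (volume_square_lt_top _)))
  · obtain ⟨C, hC, hSC⟩ := hA.relClosed
    obtain ⟨D, hD, hSD⟩ := exists_isClosed_columnSet (a := a) (b := b) (bad := bad) hℓ
    refine ⟨(C ∩ {x | x 0 ≤ a}) ∪ D, (hC.inter (isClosed_le (continuous_coord 0)
      continuous_const)).union hD, ?_⟩
    rw [hSD, hSC, inter_union_distrib_left]
    congr 1
    ext x
    simp only [mem_ofPred_eq, mem_inter_iff, and_assoc]
  · rw [heq]
    exact hlat φ hφ hi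

end Lateral

/-! ### The Frobenius norm and the distance from the rotations -/

section Frobenius

variable {M M' R R' : Mat}

theorem frobNorm_nonneg (M : Mat) : 0 ≤ frobNorm M := Real.sqrt_nonneg _

theorem frobNorm_sq (M : Mat) : frobNorm M ^ 2 = ∑ i, ∑ j, M i j ^ 2 :=
  Real.sq_sqrt (by positivity)

theorem frobNorm_eq_norm (M : Mat) :
    frobNorm M = ‖WithLp.toLp 2 (fun p : Fin 2 × Fin 2 => M p.1 p.2)‖ := by
  rw [EuclideanSpace.norm_eq, frobNorm]
  simp [Fintype.sum_prod_type]

theorem frobNorm_add_le (M M' : Mat) : frobNorm (M + M') ≤ frobNorm M + frobNorm M' := by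
  simp only [frobNorm_eq_norm]
  exact norm_add_le (WithLp.toLp 2 (fun p : Fin 2 × Fin 2 => M p.1 p.2))
    (WithLp.toLp 2 (fun p : Fin 2 × Fin 2 => M' p.1 p.2))

theorem frobNorm_neg (M : Mat) : frobNorm (-M) = frobNorm M := by
  simp [frobNorm]

theorem frobNorm_zero : frobNorm 0 = 0 := by simp [frobNorm]

theorem frobNorm_sub_le (M M' M'' : Mat) :
    frobNorm (M - M'') ≤ frobNorm (M - M') + frobNorm (M' - M'') := by
  simpa using frobNorm_add_le (M - M') (M' - M'')

theorem frobNorm_le_sum (M : Mat) : frobNorm M ≤ ∑ i, ∑ j, |M i j| := by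
  rw [frobNorm]
  refine Real.sqrt_le_iff.2 ⟨by positivity, ?_⟩
  simp only [Fin.sum_univ_two, ← sq_abs (M _ _)]
  have h := fun i j => abs_nonneg (M i j)
  nlinarith [mul_nonneg (h 0 0) (h 0 1), mul_nonneg (h 0 0) (h 1 0), mul_nonneg (h 0 0) (h 1 1),
    mul_nonneg (h 0 1) (h 1 0), mul_nonneg (h 0 1) (h 1 1), mul_nonneg (h 1 0) (h 1 1)]

theorem frobNorm_of_mem (h : R ∈ SO2) : frobNorm R = √2 := by
  have h1 : R.transpose * R = 1 :=
    (Matrix.mem_orthogonalGroup_iff' (Fin 2) ℝ).1 (Matrix.mem_specialOrthogonalGroup_iff.1 h).1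
  have h0 := congrFun (congrFun h1 0) 0
  have h2 := congrFun (congrFun h1 1) 1
  simp only [Matrix.mul_apply, Fin.sum_univ_two, Matrix.transpose_apply, Matrix.one_apply_eq] at h0 h2
  rw [frobNorm]
  congr 1
  simp only [Fin.sum_univ_two]
  nlinarith

theorem distSO2_bddBelow (M : Mat) : BddBelow (range fun R : SO2 => frobNorm (M - R)) :=
  ⟨0, by rintro _ ⟨R, rfl⟩; exact frobNorm_nonneg _⟩

theorem distSO2_nonneg (M : Mat) : 0 ≤ distSO2 M := Real.iInf_nonneg fun _ => frobNorm_nonneg _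

theorem distSO2_le (hR : R ∈ SO2) : distSO2 M ≤ frobNorm (M - R) :=
  ciInf_le (distSO2_bddBelow M) (⟨R, hR⟩ : SO2)

theorem distSO2_of_mem (hR : R ∈ SO2) : distSO2 R = 0 :=
  le_antisymm (by simpa [frobNorm_zero] using distSO2_le (M := R) hR) (distSO2_nonneg R)

theorem frobNorm_sub_le_distSO2 (hR : R ∈ SO2) : frobNorm (M - R) ≤ distSO2 M + 2 * √2 := by
  have : Nonempty SO2 := ⟨⟨R, hR⟩⟩
  rw [← sub_le_iff_le_add]
  refine le_ciInf fun R' => ?_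
  have h1 := frobNorm_sub_le M R'.1 R
  have h2 := frobNorm_add_le R'.1 (-R)
  rw [frobNorm_neg, frobNorm_of_mem hR, frobNorm_of_mem R'.2, ← sub_eq_add_neg] at h2
  linarith

/-- Where `M` is far from the rotations the square of the distance from `R` is controlled by the
squared distance from `SO(2)`; elsewhere it is controlled by the distance from `R`. -/
theorem frobNorm_sub_sq_le (hR : R ∈ SO2) :
    frobNorm (M - R) ^ 2 ≤ 12 * distSO2 M ^ 2 + 4 * frobNorm (M - R) := by
  have h1 := frobNorm_sub_le_distSO2 (M := M) hR
  have h2 := frobNorm_nonneg (M - R)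
  have h3 := distSO2_nonneg M
  have h4 : √2 < 1.415 := by
    rw [Real.sqrt_lt' (by norm_num)]
    norm_num
  by_cases h : frobNorm (M - R) ≤ 4
  · nlinarith
  · push Not at h
    have h5 : 0.2925 * frobNorm (M - R) ≤ distSO2 M := by linarith
    nlinarith

theorem measurable_frobNorm {A : Plane → Mat} (hA : ∀ i j, Measurable fun x => A x i j) :
    Measurable fun x => frobNorm (A x) := by
  unfold frobNorm
  exact (Finset.measurable_sum _ fun i _ => Finset.measurable_sum _ fun j _ =>
    (hA i j).pow_const 2).sqrt

end Frobenius

/-! ### Areas -/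

/-- The open rectangle `(a, b) × (c, d)`. -/
def rect (a b c d : ℝ) : Set Plane := {x | x 0 ∈ Ioo a b ∧ x 1 ∈ Ioo c d}

theorem volume_rect (a b c d : ℝ) :
    volume (rect a b c d) = ENNReal.ofReal (b - a) * ENNReal.ofReal (d - c) := by
  have hm : MeasurableSet (rect a b c d) :=
    ((measurable_coord 0) measurableSet_Ioo).inter ((measurable_coord 1) measurableSet_Ioo)
  rw [← measurePreserving_pt.measure_preimage hm.nullMeasurableSet]
  have : pt ⁻¹' rect a b c d = Ioo a b ×ˢ Ioo c d := by
    ext p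
    simp [rect]
  rw [this, Measure.volume_eq_prod, Measure.prod_prod, Real.volume_Ioo, Real.volume_Ioo]

theorem isOpen_nbhd {Ω S : Set Plane} (hΩ : IsOpen Ω) (r : ℝ) : IsOpen (nbhd Ω r S) :=
  hΩ.inter Metric.isOpen_thickening

theorem nbhd_union (Ω S T : Set Plane) (r : ℝ) : nbhd Ω r (S ∪ T) = nbhd Ω r S ∪ nbhd Ω r T := by
  simp [nbhd, Metric.thickening_union, inter_union_distrib_left]

theorem mem_nbhd {Ω S : Set Plane} {r : ℝ} {x : Plane} :
    x ∈ nbhd Ω r S ↔ x ∈ Ω ∧ ∃ s ∈ S, dist x s < r := by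
  simp [nbhd, Metric.mem_thickening_iff]

theorem abs_coord_sub_lt {x y : Plane} {r : ℝ} (h : dist x y < r) (i : Fin 2) :
    |x i - y i| < r := (abs_coord_sub_le x y i).trans_lt h

theorem nbhd_columnSet_subset {ℓ a b r : ℝ} {bad : Finset ℤ} {N : ℕ} (hℓ : 0 < ℓ)
    (hN : 1 ≤ N * ℓ) : nbhd (square (1 / 2)) r (columnSet ℓ a b bad) ⊆
      (⋃ i ∈ Finset.range N, rect (a - r) (b + r) (level ℓ i - r) (level ℓ i + r)) ∪
        ⋃ i ∈ bad, rect (a - r) (b + r) (level ℓ i - r) (level ℓ (i + 1) + r) := by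
  intro x hx
  obtain ⟨-, s, ⟨hs, h0, h1, h2⟩, hd⟩ := mem_nbhd.1 hx
  have d0 := abs_lt.1 (abs_coord_sub_lt hd 0)
  have d1 := abs_lt.1 (abs_coord_sub_lt hd 1)
  have hx0 : x 0 ∈ Ioo (a - r) (b + r) := ⟨by linarith, by linarith⟩
  rcases h2 with ⟨i, hi⟩ | ⟨i, hi, h3⟩
  · have hs1 := abs_lt.1 hs.2
    have hi0 : 0 < (i : ℝ) := by
      rw [hi, level] at hs1
      by_contra! h
      have := mul_nonpos_of_nonpos_of_nonneg h hℓ.le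
      linarith
    have hiN : (i : ℝ) < N := by
      rw [hi, level] at hs1
      by_contra! h
      have := mul_le_mul_of_nonneg_right h hℓ.le
      linarith
    have hi0' : 0 < i := by exact_mod_cast hi0
    lift i to ℕ using hi0'.le
    refine Or.inl (mem_biUnion (x := i) ?_ ⟨hx0, ⟨by linarith, by linarith⟩⟩)
    simpa using (by exact_mod_cast hiN : i < N)
  · exact Or.inr (mem_biUnion (x := i) hi ⟨hx0, ⟨by linarith [h3.1], by linarith [h3.2]⟩⟩)

theorem volume_nbhd_columnSet_le {ℓ a b r : ℝ} {bad : Finset ℤ} {N : ℕ} (hℓ : 0 < ℓ)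
    (hN : 1 ≤ N * ℓ) (hab : a ≤ b) (hr : 0 ≤ r) :
    volume (nbhd (square (1 / 2)) r (columnSet ℓ a b bad)) ≤
      ENNReal.ofReal (N * ((b - a + 2 * r) * (2 * r)) +
        bad.card * ((b - a + 2 * r) * (ℓ + 2 * r))) := by
  have hw : 0 ≤ b - a + 2 * r := by linarith
  refine (measure_mono (nbhd_columnSet_subset hℓ hN)).trans ((measure_union_le _ _).trans ?_)
  rw [ENNReal.ofReal_add (by positivity) (by positivity)]
  gcongr
  · refine (measure_biUnion_finset_le _ _).trans ?_
    simp only [volume_rect]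
    have : ∀ i : ℕ, ENNReal.ofReal (b + r - (a - r)) *
        ENNReal.ofReal (level ℓ i + r - (level ℓ i - r)) =
        ENNReal.ofReal ((b - a + 2 * r) * (2 * r)) := fun i => by
      rw [← ENNReal.ofReal_mul (by linarith)]
      congr 1
      ring
    simp only [this, Finset.sum_const, Finset.card_range, nsmul_eq_mul]
    rw [ENNReal.ofReal_mul (p := (N : ℝ)) (by positivity), ENNReal.ofReal_natCast]
  · refine (measure_biUnion_finset_le _ _).trans ?_
    simp only [volume_rect]
    have : ∀ i : ℤ, ENNReal.ofReal (b + r - (a - r)) *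
        ENNReal.ofReal (level ℓ (i + 1) + r - (level ℓ i - r)) =
        ENNReal.ofReal ((b - a + 2 * r) * (ℓ + 2 * r)) := fun i => by
      rw [← ENNReal.ofReal_mul (by linarith), level_add_one]
      congr 1
      ring
    simp only [this, Finset.sum_const, nsmul_eq_mul]
    rw [ENNReal.ofReal_mul (p := (bad.card : ℝ)) (by positivity), ENNReal.ofReal_natCast]

/-! ### The energy of the interpolated field -/

section LateralEnergy

variable {lam τ ε ℓ a b : ℝ} {η θ : ℝ → ℝ} {A : Plane → Mat} {S : Set Plane} {R : Mat}
  {bad : Finset ℤ} {e : ℤ → Fin 2 → ℝ}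

theorem lateralField_of_le (hη : IsCutoff η θ a b) (hab : a ≤ b) {x : Plane} (hx : x 0 ≤ a) :
    lateralField ℓ a b bad η θ A R e x = A x := by
  have h0 : θ (x 0) = 0 := by
    by_contra h
    exact absurd ((hη.isDensity hab).mem _ h).1 (not_lt.2 hx)
  ext i j
  simp [lateralField, shearField, h0, (hη.eventually_one _ hx).eq_of_nhds]

theorem lateralField_of_ge (hη : IsCutoff η θ a b) (hab : a ≤ b) {x : Plane} (hx : b ≤ x 0) :
    lateralField ℓ a b bad η θ A R e x = R := by
  have h0 : θ (x 0) = 0 := by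
    by_contra h
    exact absurd ((hη.isDensity hab).mem _ h).2 (not_lt.2 hx)
  ext i j
  simp [lateralField, shearField, h0, (hη.eventually_zero _ hx).eq_of_nhds]

theorem mem_columnSet_of_bad (hℓ : 0 < ℓ) {x : Plane} (hx : x ∈ square (1 / 2)) (h0 : a ≤ x 0)
    (h1 : x 0 ≤ b) (h2 : strip ℓ (x 1) ∈ bad) : x ∈ columnSet ℓ a b bad :=
  ⟨hx, h0, h1, Or.inr ⟨_, h2, ((strip_eq_iff hℓ).1 rfl).1, ((strip_eq_iff hℓ).1 rfl).2.le⟩⟩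

/-- To the left of the column the core does not shrink, since a point of `S` that is closer than
`lam * ε` lies either to the left of the column or in one of its bad boxes. -/
theorem mem_nbhd_lateral (hr : 0 < lam * ε) (hℓ : 0 < ℓ) (hab : lam * ε ≤ b - a)
    (hSQ : S ⊆ square (1 / 2))
    (hbad : ∀ x ∈ nbhd (square (1 / 2)) (lam * ε) S, a ≤ x 0 → x 0 ≤ b → strip ℓ (x 1) ∈ bad)
    {x : Plane} (hx : x ∈ nbhd (square (1 / 2)) (lam * ε) S) (h0 : x 0 ≤ a) :
    x ∈ nbhd (square (1 / 2)) (lam * ε) ({x ∈ S | x 0 ≤ a} ∪ columnSet ℓ a b bad) := by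
  obtain ⟨hxQ, s, hs, hd⟩ := mem_nbhd.1 hx
  refine mem_nbhd.2 ⟨hxQ, s, ?_, hd⟩
  by_cases h1 : s 0 ≤ a
  · exact Or.inl ⟨hs, h1⟩
  · push Not at h1
    have h2 := abs_lt.1 (abs_coord_sub_lt hd 0)
    have h3 : s 0 ≤ b := by linarith
    exact Or.inr (mem_columnSet_of_bad hℓ (hSQ hs) h1.le h3
      (hbad s (mem_nbhd.2 ⟨hSQ hs, s, hs, by simpa using hr⟩) h1.le h3))

/-- The interpolation only costs energy in the good boxes and near the segments and bad boxes. -/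
theorem pairEnergy_lateralField_le (hr : 0 < lam * ε) (hR : R ∈ SO2) (hℓ : 0 < ℓ)
    (hab : lam * ε ≤ b - a) (hη : IsCutoff η θ a b) (hSQ : S ⊆ square (1 / 2))
    (hbad : ∀ x ∈ nbhd (square (1 / 2)) (lam * ε) S, a ≤ x 0 → x 0 ≤ b → strip ℓ (x 1) ∈ bad) :
    pairEnergy lam ε (square (1 / 2)) (lateralField ℓ a b bad η θ A R e)
        ({x ∈ S | x 0 ≤ a} ∪ columnSet ℓ a b bad) (square (1 / 2)) ≤
      pairEnergy lam ε (square (1 / 2)) A S (square (1 / 2)) +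
        (∫⁻ x in goodColumn ℓ a b bad,
          ENNReal.ofReal (frobNorm (lateralField ℓ a b bad η θ A R e x - R) ^ 2)) +
        volume (nbhd (square (1 / 2)) (lam * ε) (columnSet ℓ a b bad)) := by
  set Q := square (1 / 2) with hQ
  set A' := lateralField ℓ a b bad η θ A R e with hA'
  set T := columnSet ℓ a b bad with hT
  set S' : Set Plane := {x ∈ S | x 0 ≤ a} ∪ T with hS'
  have hab' : a ≤ b := by linarith
  have hbox : ∀ x ∈ Q, a ≤ x 0 → x 0 ≤ b → strip ℓ (x 1) ∈ bad → x ∈ T := fun x hx h0 h1 h2 =>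
    mem_columnSet_of_bad hℓ hx h0 h1 h2
  have hcore : ∀ x ∈ nbhd Q (lam * ε) S, x 0 ≤ a → x ∈ nbhd Q (lam * ε) S' := fun x hx h0 =>
    mem_nbhd_lateral hr hℓ hab hSQ hbad hx h0
  have hel : elasticEnergy lam ε Q A' S' Q ≤ elasticEnergy lam ε Q A S Q +
      ∫⁻ x in goodColumn ℓ a b bad, ENNReal.ofReal (frobNorm (A' x - R) ^ 2) := by
    have hsub : Q \ nbhd Q (lam * ε) S' ⊆
        ((Q \ nbhd Q (lam * ε) S) ∩ {x | x 0 ≤ a}) ∪ (goodColumn ℓ a b bad ∪ {x | b ≤ x 0}) := by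
      rintro x ⟨hx, hxS⟩
      by_cases h0 : x 0 ≤ a
      · exact Or.inl ⟨⟨hx, fun h => hxS (hcore x h h0)⟩, h0⟩
      · push Not at h0
        by_cases h1 : b ≤ x 0
        · exact Or.inr (Or.inr h1)
        · push Not at h1
          refine Or.inr (Or.inl ⟨hx, h0, h1, fun h2 => hxS ?_⟩)
          exact mem_nbhd.2 ⟨hx, x, Or.inr (hbox x hx h0.le h1.le h2), by simpa using hr⟩
    unfold elasticEnergy
    refine (lintegral_mono_set hsub).trans ((lintegral_union_le _ _ _).trans ?_)
    have hm0 : MeasurableSet {x : Plane | x 0 ≤ a} :=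
      measurableSet_le (measurable_coord 0) measurable_const
    have hm1 : MeasurableSet {x : Plane | b ≤ x 0} :=
      measurableSet_le measurable_const (measurable_coord 0)
    have hmQ : MeasurableSet ((Q \ nbhd Q (lam * ε) S) ∩ {x | x 0 ≤ a}) :=
      ((measurableSet_square _).diff (isOpen_nbhd (isOpen_square _) _).measurableSet).inter hm0
    refine add_le_add ?_ ?_
    · rw [setLIntegral_congr_fun hmQ (g := fun x => ENNReal.ofReal (distSO2 (A x) ^ 2))
        fun x hx => by simp only [hA', lateralField_of_le hη hab' hx.2]]
      exact lintegral_mono_set inter_subset_left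
    · refine (lintegral_union_le _ _ _).trans ?_
      have hz : ∫⁻ x in {x : Plane | b ≤ x 0}, ENNReal.ofReal (distSO2 (A' x) ^ 2) = 0 := by
        rw [setLIntegral_congr_fun hm1 (g := fun _ => 0) fun x hx => by
          simp [hA', lateralField_of_ge hη hab' hx, distSO2_of_mem hR]]
        simp
      rw [hz, add_zero]
      refine lintegral_mono fun x => ENNReal.ofReal_le_ofReal ?_
      exact pow_le_pow_left₀ (distSO2_nonneg _) (distSO2_le hR) 2
  have hco : coreEnergy lam ε Q S' Q ≤ coreEnergy lam ε Q S Q + volume (nbhd Q (lam * ε) T) := by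
    unfold coreEnergy
    rw [hS', nbhd_union, union_inter_distrib_right]
    refine (measure_union_le _ _).trans ?_
    gcongr
    · exact inter_subset_inter_right _ (Metric.thickening_subset_of_subset _ fun x hx => hx.1)
    · exact inter_subset_left
  unfold pairEnergy
  refine (add_le_add hel hco).trans_eq ?_
  ring

theorem frobNorm_lateralField_sub_sq_le {Θ c : ℝ} (hη : IsCutoff η θ a b) (hθ : ∀ s, |θ s| ≤ Θ)
    (he : ∀ i k, 0 ≤ e i k ∧ e i k < c) (x : Plane) :
    frobNorm (lateralField ℓ a b bad η θ A R e x - R) ^ 2 ≤ 3 * frobNorm (A x - R) ^ 2 +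
      3 * Θ ^ 2 * (primitive ℓ (columnDefect ℓ a b bad A R 0) x ^ 2 +
        primitive ℓ (columnDefect ℓ a b bad A R 1) x ^ 2) + 6 * Θ ^ 2 * c ^ 2 := by
  have h0 := hη.nonneg (x 0)
  have h1 := hη.le_one (x 0)
  have hη2 : ∀ u : ℝ, (η (x 0) * u) ^ 2 ≤ u ^ 2 := fun u => by
    rw [mul_pow]
    exact mul_le_of_le_one_left (sq_nonneg _) (by nlinarith)
  have hθ2 : ∀ u : ℝ, (θ (x 0) * u) ^ 2 ≤ Θ ^ 2 * u ^ 2 := fun u => by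
    rw [mul_pow]
    exact mul_le_mul_of_nonneg_right (sq_le_sq' (by linarith [neg_abs_le (θ (x 0)), hθ (x 0)])
      (by linarith [le_abs_self (θ (x 0)), hθ (x 0)])) (sq_nonneg _)
  have hec : ∀ k, e (strip ℓ (x 1)) k ^ 2 ≤ c ^ 2 := fun k =>
    pow_le_pow_left₀ (he _ k).1 (he _ k).2.le 2
  have h3 : ∀ u v w : ℝ, (u - (v + w)) ^ 2 ≤ 3 * u ^ 2 + 3 * v ^ 2 + 3 * w ^ 2 := fun u v w => by
    nlinarith [sq_nonneg (u + v), sq_nonneg (u + w), sq_nonneg (v - w)]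
  have hrow : ∀ k : Fin 2, ((lateralField ℓ a b bad η θ A R e x - R) k 0) ^ 2 +
      ((lateralField ℓ a b bad η θ A R e x - R) k 1) ^ 2 ≤
      3 * ((A x - R) k 0) ^ 2 + 3 * ((A x - R) k 1) ^ 2 +
        3 * Θ ^ 2 * primitive ℓ (columnDefect ℓ a b bad A R k) x ^ 2 + 3 * Θ ^ 2 * c ^ 2 := by
    intro k
    set p := primitive ℓ (columnDefect ℓ a b bad A R k) x
    have e0 : (lateralField ℓ a b bad η θ A R e x - R) k 0 = η (x 0) * (A x - R) k 0 -
        (θ (x 0) * p + θ (x 0) * e (strip ℓ (x 1)) k) := by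
      simp [lateralField, shearField, p]
      ring
    have e1 : (lateralField ℓ a b bad η θ A R e x - R) k 1 = η (x 0) * (A x - R) k 1 := by
      simp [lateralField, shearField]
      ring
    rw [e0, e1]
    have := h3 (η (x 0) * (A x - R) k 0) (θ (x 0) * p) (θ (x 0) * e (strip ℓ (x 1)) k)
    have := mul_le_mul_of_nonneg_left (hec k) (sq_nonneg Θ)
    linarith [hη2 ((A x - R) k 0), hη2 ((A x - R) k 1), hθ2 p, hθ2 (e (strip ℓ (x 1)) k),
      sq_nonneg ((A x - R) k 1)]
  rw [frobNorm_sq, frobNorm_sq]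
  simp only [Fin.sum_univ_two]
  linarith [hrow 0, hrow 1]

theorem lintegral_goodColumn_le {Θ c : ℝ} (hℓ : 0 < ℓ) (hη : IsCutoff η θ a b)
    (hθ : ∀ s, |θ s| ≤ Θ) (he : ∀ i k, 0 ≤ e i k ∧ e i k < c)
    (hmeas : ∀ i j, Measurable fun x => A x i j) :
    ∫⁻ x in goodColumn ℓ a b bad,
        ENNReal.ofReal (frobNorm (lateralField ℓ a b bad η θ A R e x - R) ^ 2) ≤
      ENNReal.ofReal (3 + 3 * Θ ^ 2 * ℓ ^ 2) * (∫⁻ x in goodColumn ℓ a b bad,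
        ENNReal.ofReal (frobNorm (A x - R) ^ 2)) +
        ENNReal.ofReal (6 * Θ ^ 2 * c ^ 2 * (b - a)) := by
  set G := goodColumn ℓ a b bad with hG
  have hGm : MeasurableSet G := measurableSet_goodColumn
  set f := columnDefect ℓ a b bad A R with hf
  have hfm : ∀ k, Measurable (f k) := measurable_columnDefect hmeas
  have hB : Measurable fun x => ENNReal.ofReal (frobNorm (A x - R) ^ 2) :=
    ((measurable_frobNorm (A := fun x => A x - R) fun i j =>
      (hmeas i j).sub_const _).pow_const 2).ennreal_ofReal
  have hP : ∀ k, Measurable fun x => ‖primitive ℓ (f k) x‖ₑ ^ 2 := fun k =>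
    (measurable_primitive (hfm k)).enorm.pow_const 2
  have henorm : ∀ u : ℝ, ‖u‖ₑ ^ 2 = ENNReal.ofReal (u ^ 2) := fun u => by
    rw [← ofReal_norm, ← ENNReal.ofReal_pow (norm_nonneg _), Real.norm_eq_abs, sq_abs]
  have hpt : ∀ x, ENNReal.ofReal (frobNorm (lateralField ℓ a b bad η θ A R e x - R) ^ 2) ≤
      3 * ENNReal.ofReal (frobNorm (A x - R) ^ 2) + ENNReal.ofReal (3 * Θ ^ 2) *
        (‖primitive ℓ (f 0) x‖ₑ ^ 2 + ‖primitive ℓ (f 1) x‖ₑ ^ 2) +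
          ENNReal.ofReal (6 * Θ ^ 2 * c ^ 2) := by
    intro x
    refine (ENNReal.ofReal_le_ofReal (frobNorm_lateralField_sub_sq_le hη hθ he x)).trans_eq ?_
    rw [ENNReal.ofReal_add (by positivity) (by positivity),
      ENNReal.ofReal_add (by positivity) (by positivity), ENNReal.ofReal_mul (by positivity),
      ENNReal.ofReal_mul (by positivity), ENNReal.ofReal_add (by positivity) (by positivity),
      henorm, henorm, ENNReal.ofReal_ofNat]
  have hdef : ∫⁻ x, ‖f 0 x‖ₑ ^ 2 + ‖f 1 x‖ₑ ^ 2 ≤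
      ∫⁻ x in G, ENNReal.ofReal (frobNorm (A x - R) ^ 2) := by
    rw [← lintegral_indicator hGm]
    refine lintegral_mono fun x => ?_
    by_cases hx : x ∈ G
    · simp only [hf, columnDefect, ← hG, indicator_of_mem hx, henorm]
      rw [← ENNReal.ofReal_add (by positivity) (by positivity), frobNorm_sq]
      apply ENNReal.ofReal_le_ofReal
      simp only [Fin.sum_univ_two]
      nlinarith [sq_nonneg ((A x - R) 0 0), sq_nonneg ((A x - R) 1 0)]
    · simp [hf, columnDefect, ← hG, indicator_of_notMem hx]
  have hprim : ∫⁻ x in G, (‖primitive ℓ (f 0) x‖ₑ ^ 2 + ‖primitive ℓ (f 1) x‖ₑ ^ 2) ≤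
      ENNReal.ofReal ℓ ^ 2 * ∫⁻ x in G, ENNReal.ofReal (frobNorm (A x - R) ^ 2) := by
    refine (setLIntegral_le_lintegral _ _).trans ?_
    rw [lintegral_add_left (hP 0)]
    refine (add_le_add (lintegral_primitive_sq_le hℓ (hfm 0))
      (lintegral_primitive_sq_le hℓ (hfm 1))).trans ?_
    rw [← mul_add, ← lintegral_add_left ((hfm 0).enorm.pow_const 2)]
    gcongr
  have hvol : volume G ≤ ENNReal.ofReal (b - a) := by
    have : G ⊆ rect a b (-(1 / 2)) (1 / 2) := fun x hx =>
      ⟨⟨hx.2.1, hx.2.2.1⟩, abs_lt.1 hx.1.2⟩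
    refine (measure_mono this).trans_eq ?_
    rw [volume_rect]
    norm_num
  refine (lintegral_mono hpt).trans ?_
  rw [lintegral_add_right _ measurable_const, lintegral_add_left (hB.const_mul 3),
    lintegral_const_mul _ hB, lintegral_const_mul' _ _ ENNReal.ofReal_ne_top, setLIntegral_const]
  have hlast : ENNReal.ofReal (6 * Θ ^ 2 * c ^ 2) * volume G ≤
      ENNReal.ofReal (6 * Θ ^ 2 * c ^ 2 * (b - a)) := by
    rw [ENNReal.ofReal_mul (p := 6 * Θ ^ 2 * c ^ 2) (by positivity)]
    gcongr
  refine add_le_add ?_ hlast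
  rw [ENNReal.ofReal_add (by positivity) (by positivity), add_mul,
    ENNReal.ofReal_mul (p := 3 * Θ ^ 2) (by positivity), ENNReal.ofReal_pow hℓ.le, mul_assoc (ENNReal.ofReal (3 * Θ ^ 2)),
    ENNReal.ofReal_ofNat]
  exact add_le_add le_rfl (by gcongr)

end LateralEnergy

/-! ### The choice of the column -/

theorem exists_mul_le_sum {m : ℕ} (hm : 0 < m) (f : ℕ → ℝ≥0∞) :
    ∃ j < m, m * f j ≤ ∑ i ∈ Finset.range m, f i := by
  obtain ⟨j, hj, hmin⟩ := Finset.exists_min_image (Finset.range m) f ⟨0, by simpa using hm⟩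
  refine ⟨j, by simpa using hj, ?_⟩
  have := Finset.card_nsmul_le_sum (Finset.range m) f (f j) hmin
  simpa using this

/-- Among `m` disjoint vertical slabs of width `p` one carries at most the `m`-th part of an
integral. -/
theorem exists_slab {F : Plane → ℝ≥0∞} {t p : ℝ} (hp : 0 ≤ p) {m : ℕ} (hm : 0 < m) :
    ∃ j < m, m * ∫⁻ x in {x : Plane | x 0 ∈ Ioo (t + j * p) (t + (j + 1) * p)}, F x ≤
      ∫⁻ x in {x : Plane | t < x 0}, F x := by
  obtain ⟨j, hj, h⟩ := exists_mul_le_sum hm fun j : ℕ =>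
    ∫⁻ x in {x : Plane | x 0 ∈ Ioo (t + j * p) (t + (j + 1) * p)}, F x
  refine ⟨j, hj, h.trans ?_⟩
  have hms : ∀ j : ℕ, MeasurableSet {x : Plane | x 0 ∈ Ioo (t + j * p) (t + (j + 1) * p)} :=
    fun j => (measurable_coord 0) measurableSet_Ioo
  rw [← lintegral_biUnion_finset (t := fun j : ℕ =>
    {x : Plane | x 0 ∈ Ioo (t + j * p) (t + (j + 1) * p)}) ?_ fun j _ => hms j]
  · refine lintegral_mono_set ?_
    intro x hx
    obtain ⟨i, -, hi⟩ := mem_iUnion₂.1 hx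
    have : 0 ≤ (i : ℝ) * p := by positivity
    have := hi.1
    simp only [mem_ofPred_eq]
    linarith
  · have key : ∀ i j : ℕ, i < j → Disjoint {x : Plane | x 0 ∈ Ioo (t + i * p) (t + (i + 1) * p)}
        {x : Plane | x 0 ∈ Ioo (t + j * p) (t + (j + 1) * p)} := by
      intro i j hij
      rw [Set.disjoint_left]
      intro x h1 h2
      have : ((i : ℝ) + 1) ≤ j := by exact_mod_cast hij
      have := mul_le_mul_of_nonneg_right this hp
      linarith [h1.2, h2.1]
    intro i _ j _ hij
    rcases lt_or_gt_of_ne hij with h | h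
    · exact key i j h
    · exact (key j i h).symm

/-- The core of a point of the square has a definite area. -/
theorem exists_rect_subset {r : ℝ} (hr : 0 < r) (hr1 : r ≤ 1) {s : Plane}
    (hs : s ∈ square (1 / 2)) : ∃ P : Set Plane, volume P = ENNReal.ofReal (r ^ 2 / 4) ∧
      ∀ z ∈ P, z ∈ square (1 / 2) ∧ dist z s < r := by
  have hI : ∀ u : ℝ, |u| < 1 / 2 → ∃ c : ℝ, ∀ v ∈ Ioo c (c + r / 2),
      |v| < 1 / 2 ∧ |v - u| < r / 2 := by
    intro u hu
    rw [abs_lt] at hu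
    by_cases h0 : 0 ≤ u
    · refine ⟨u - r / 2, fun v hv => ⟨abs_lt.2 ⟨by linarith [hv.1], by linarith [hv.2]⟩,
        abs_lt.2 ⟨by linarith [hv.1], by linarith [hv.2]⟩⟩⟩
    · refine ⟨u, fun v hv => ⟨abs_lt.2 ⟨by linarith [hv.1], by linarith [hv.2]⟩,
        abs_lt.2 ⟨by linarith [hv.1], by linarith [hv.2]⟩⟩⟩
  obtain ⟨c0, h0⟩ := hI _ hs.1
  obtain ⟨c1, h1⟩ := hI _ hs.2
  refine ⟨rect c0 (c0 + r / 2) c1 (c1 + r / 2), ?_, fun z hz => ?_⟩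
  · rw [volume_rect, ← ENNReal.ofReal_mul (by linarith)]
    congr 1
    ring
  · obtain ⟨a0, b0⟩ := h0 _ hz.1
    obtain ⟨a1, b1⟩ := h1 _ hz.2
    refine ⟨⟨a0, a1⟩, ?_⟩
    have := dist_le_of_coord (x := z) (y := s) le_rfl le_rfl
    linarith

/-- The number of the boxes of a column that meet the core is controlled by the area of the core
near the column, since every point of the core comes with a piece of core of area `r ^ 2 / 4` that
meets at most three consecutive strips. -/
theorem card_bad_mul_le {ℓ a b r : ℝ} {S : Set Plane} {bad : Finset ℤ} (hℓ : 0 < ℓ) (hr : 0 < r)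
    (hr1 : r ≤ 1) (hrℓ : 2 * r ≤ ℓ) (hS : S ⊆ square (1 / 2))
    (hbad : ∀ i ∈ bad, ∃ x ∈ nbhd (square (1 / 2)) r S, a ≤ x 0 ∧ x 0 ≤ b ∧ strip ℓ (x 1) = i) :
    bad.card * ENNReal.ofReal (r ^ 2 / 4) ≤
      3 * volume (nbhd (square (1 / 2)) r S ∩ {x | x 0 ∈ Ioo (a - 2 * r) (b + 2 * r)}) := by
  set E := nbhd (square (1 / 2)) r S ∩ {x : Plane | x 0 ∈ Ioo (a - 2 * r) (b + 2 * r)} with hE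
  set μ := volume.restrict E with hμ
  let F : ℤ → Set Plane := fun k => {x | strip ℓ (x 1) = k}
  have hFm : ∀ k, MeasurableSet (F k) := fun k =>
    ((measurable_strip ℓ).comp (measurable_coord 1)) (measurableSet_singleton k)
  have hone : ∀ i ∈ bad, ENNReal.ofReal (r ^ 2 / 4) ≤ μ (F (i - 1)) + μ (F i) + μ (F (i + 1)) := by
    intro i hi
    obtain ⟨x, hx, h0, h1, h2⟩ := hbad i hi
    obtain ⟨hxQ, s, hs, hd⟩ := mem_nbhd.1 hx
    obtain ⟨P, hP, hPs⟩ := exists_rect_subset hr hr1 (hS hs)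
    rw [← hP]
    have hsub : P ⊆ (F (i - 1) ∪ F i ∪ F (i + 1)) ∩ E := by
      intro z hz
      obtain ⟨hzQ, hzs⟩ := hPs z hz
      have d0 := abs_lt.1 (abs_coord_sub_lt hzs 0)
      have d1 := abs_lt.1 (abs_coord_sub_lt hzs 1)
      have e0 := abs_lt.1 (abs_coord_sub_lt hd 0)
      have e1 := abs_lt.1 (abs_coord_sub_lt hd 1)
      obtain ⟨l1, l2⟩ := (strip_eq_iff hℓ).1 h2
      have m1 := level_add_one ℓ (i - 1)
      have m2 := level_add_one ℓ i
      have m3 := level_add_one ℓ (i + 1)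
      rw [sub_add_cancel] at m1
      refine ⟨?_, mem_nbhd.2 ⟨hzQ, s, hs, hzs⟩, by linarith, by linarith⟩
      by_cases c1 : z 1 < level ℓ i
      · refine Or.inl (Or.inl ((strip_eq_iff hℓ).2 ⟨by linarith, ?_⟩))
        rwa [sub_add_cancel]
      · push Not at c1
        by_cases c2 : z 1 < level ℓ (i + 1)
        · exact Or.inl (Or.inr ((strip_eq_iff hℓ).2 ⟨c1, c2⟩))
        · push Not at c2
          exact Or.inr ((strip_eq_iff hℓ).2 ⟨c2, by linarith⟩)
    refine (measure_mono hsub).trans ?_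
    rw [← Measure.restrict_apply (((hFm _).union (hFm _)).union (hFm _))]
    exact (measure_union_le _ _).trans (add_le_add (measure_union_le _ _) le_rfl)
  have hsum : ∀ g : ℤ → ℤ, Function.Injective g → ∑ i ∈ bad, μ (F (g i)) ≤ volume E := by
    intro g hg
    have := sum_measure_le_measure_univ (μ := μ) (s := bad) (t := fun i => F (g i))
      (fun i _ => (hFm _).nullMeasurableSet) fun i _ j _ hij => Disjoint.aedisjoint <|
        Set.disjoint_left.2 fun x hx hx' => hij (hg (hx.symm.trans hx'))
    rwa [hμ, Measure.restrict_apply_univ] at this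
  have := Finset.sum_le_sum hone
  rw [Finset.sum_const, nsmul_eq_mul, Finset.sum_add_distrib, Finset.sum_add_distrib] at this
  refine this.trans ?_
  have h3 : (3 : ℝ≥0∞) * volume E = volume E + volume E + volume E := by ring
  rw [h3]
  exact add_le_add (add_le_add (hsum _ (sub_left_injective)) (hsum _ Function.injective_id))
    (hsum _ (add_left_injective 1))

/-! ### Modifying an admissible pair on one side of the interface -/

section OneSided

variable {lam τ : ℝ}

theorem measurable_lateralField {ℓ a b : ℝ} {bad : Finset ℤ} {η θ : ℝ → ℝ} {A : Plane → Mat}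
    {R : Mat} {e : ℤ → Fin 2 → ℝ} (hη : IsCutoff η θ a b) (hab : a ≤ b)
    (hA : ∀ i j, Measurable fun x => A x i j) (i j : Fin 2) :
    Measurable fun x => lateralField ℓ a b bad η θ A R e x i j := by
  have hη' : Measurable fun x : Plane => η (x 0) :=
    hη.contDiff.continuous.measurable.comp (measurable_coord 0)
  have hθ' : Measurable fun x : Plane => θ (x 0) :=
    (hη.isDensity hab).continuous.measurable.comp (measurable_coord 0)
  have he : Measurable fun x : Plane => e (strip ℓ (x 1)) i :=
    (measurable_from_top (f := fun k : ℤ => e k i)).comp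
      ((measurable_strip ℓ).comp (measurable_coord 1))
  have hp := measurable_primitive (ℓ := ℓ)
    (measurable_columnDefect (ℓ := ℓ) (a := a) (b := b) (bad := bad) (R := R) hA i)
  have h1 := (hη'.mul (hA i j)).add (((measurable_const (a := (1 : ℝ))).sub hη').mul (measurable_const (a := R i j)))
  by_cases hj : j = 0
  · subst hj
    exact h1.sub (hθ'.mul (hp.add he))
  · have h2 : (fun x => lateralField ℓ a b bad η θ A R e x i j) =
        fun x : Plane => η (x 0) * A x i j + (1 - η (x 0)) * R i j := by
      ext x
      simp [lateralField, shearField, hj]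
    rw [h2]
    exact h1

/-- The squared distance of a field of small energy from a rotation, to which it is close in `L¹`. -/
theorem lintegral_frobNorm_sq_le {A : Plane → Mat} {R : Mat} (hR : R ∈ SO2)
    (hA : ∀ i j, Measurable fun x => A x i j) (E : Set Plane) :
    ∫⁻ x in E, ENNReal.ofReal (frobNorm (A x - R) ^ 2) ≤
      12 * (∫⁻ x in E, ENNReal.ofReal (distSO2 (A x) ^ 2)) +
        4 * ∫⁻ x in E, ENNReal.ofReal (frobNorm (A x - R)) := by
  have hm : Measurable fun x => ENNReal.ofReal (frobNorm (A x - R)) :=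
    (measurable_frobNorm (A := fun x => A x - R) fun i j =>
      (hA i j).sub_const _).ennreal_ofReal
  rw [← lintegral_const_mul' _ _ (by simp), ← lintegral_const_mul _ hm,
    ← lintegral_add_right _ (hm.const_mul 4)]
  refine lintegral_mono fun x => (ENNReal.ofReal_le_ofReal (frobNorm_sub_sq_le hR)).trans_eq ?_
  rw [ENNReal.ofReal_add (by have := distSO2_nonneg (A x); positivity)
    (by have := frobNorm_nonneg (A x - R); positivity), ENNReal.ofReal_mul (by norm_num),
    ENNReal.ofReal_mul (by norm_num), ENNReal.ofReal_ofNat, ENNReal.ofReal_ofNat]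

theorem le_ofReal_div_of_natCast_mul_le {m : ℕ} (hm : 0 < m) {Z : ℝ≥0∞} {T : ℝ}
    (h : m * Z ≤ ENNReal.ofReal T) : Z ≤ ENNReal.ofReal (T / m) := by
  have hm' : (0 : ℝ) < m := by exact_mod_cast hm
  rw [ENNReal.ofReal_div_of_pos hm', ENNReal.ofReal_natCast,
    ENNReal.le_div_iff_mul_le (Or.inl (by exact_mod_cast hm.ne')) (Or.inl (by simp)), mul_comm]
  exact h

/-- The column, given by its left end `a`: it carries little energy of the squared distance from
`R`, and the core near the column has a small area. -/
theorem exists_column {C₀ δ θ₀ ε w : ℝ} (hlam : 0 < lam) (hC₀ : 0 < C₀) (hδ : 0 < δ) (hθ₀ : 0 < θ₀)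
    (hε : 0 < ε) (hw : 0 < w) (hεθ : 12 * C₀ * ε ≤ θ₀) (hεδ : (w + 4 * lam) * ε ≤ δ)
    {A : Plane → Mat} {S : Set Plane} {R : Mat} (hR : R ∈ SO2)
    (hA : ∀ i j, Measurable fun x => A x i j)
    (hE : pairEnergy lam ε (square (1 / 2)) A S (square (1 / 2)) ≤ ENNReal.ofReal (C₀ * ε))
    (hL : ∫⁻ x in (square (1 / 2) \ nbhd (square (1 / 2)) (lam * ε) S) ∩ {x | δ < x 0},
      ENNReal.ofReal (frobNorm (A x - R)) ≤ ENNReal.ofReal θ₀) :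
    ∃ a, δ ≤ a ∧ a + w * ε ≤ 2 * δ ∧
      ∫⁻ x in (square (1 / 2) \ nbhd (square (1 / 2)) (lam * ε) S) ∩ {x | x 0 ∈ Ioo a (a + w * ε)},
        ENNReal.ofReal (frobNorm (A x - R) ^ 2) ≤
          ENNReal.ofReal (12 * θ₀ * (w + 4 * lam) / δ * ε) ∧
      volume (nbhd (square (1 / 2)) (lam * ε) S ∩
        {x | x 0 ∈ Ioo (a - 2 * (lam * ε)) (a + w * ε + 2 * (lam * ε))}) ≤
          ENNReal.ofReal (12 * C₀ * (w + 4 * lam) / δ * ε ^ 2) := by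
  set Q := square (1 / 2) with hQ
  set B := nbhd Q (lam * ε) S with hB
  set p := (w + 4 * lam) * ε with hp
  have hp0 : 0 < p := by positivity
  have hBm : MeasurableSet B := (isOpen_nbhd (isOpen_square _) _).measurableSet
  have hQB : MeasurableSet (Q \ B) := (measurableSet_square _).diff hBm
  have hδm : MeasurableSet {x : Plane | δ < x 0} :=
    measurableSet_lt measurable_const (measurable_coord 0)
  set m := ⌊δ / p⌋₊ with hm
  have hm1 : 1 ≤ δ / p := (one_le_div hp0).2 hεδ
  have hm0 : 0 < m := Nat.floor_pos.2 hm1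
  have hmle : (m : ℝ) * p ≤ δ := by
    rw [← le_div_iff₀ hp0]
    exact Nat.floor_le (by positivity)
  have hmge : δ / (2 * p) ≤ m := by
    have h1 := Nat.lt_floor_add_one (δ / p)
    have h2 : (1 : ℝ) ≤ m := by exact_mod_cast hm0
    have h3 : δ / (2 * p) = δ / p / 2 := by field_simp
    rw [← hm] at h1
    linarith
  -- both quantities are bounded by the integral of a single function
  let F : Plane → ℝ≥0∞ := fun x =>
    (Q \ B).indicator (fun x => ENNReal.ofReal (frobNorm (A x - R) ^ 2)) x +
      B.indicator (fun _ => ENNReal.ofReal (θ₀ / (C₀ * ε))) x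
  have hBconst : Measurable (B.indicator fun _ : Plane => ENNReal.ofReal (θ₀ / (C₀ * ε))) :=
    measurable_const.indicator hBm
  have hF : ∫⁻ x in {x : Plane | δ < x 0}, F x ≤ ENNReal.ofReal (6 * θ₀) := by
    simp only [F]
    rw [lintegral_add_right _ hBconst, setLIntegral_indicator hQB, setLIntegral_indicator hBm,
      setLIntegral_const]
    have h1 : ∫⁻ x in (Q \ B) ∩ {x | δ < x 0}, ENNReal.ofReal (frobNorm (A x - R) ^ 2) ≤
        ENNReal.ofReal (12 * (C₀ * ε) + 4 * θ₀) := by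
      refine (lintegral_frobNorm_sq_le hR hA _).trans ?_
      rw [ENNReal.ofReal_add (by positivity) (by positivity),
        ENNReal.ofReal_mul (p := 12) (by norm_num), ENNReal.ofReal_mul (p := 4) (by norm_num),
        ENNReal.ofReal_ofNat, ENNReal.ofReal_ofNat]
      gcongr
      refine (lintegral_mono_set inter_subset_left).trans (le_trans ?_ hE)
      exact le_self_add
    have h2 : ENNReal.ofReal (θ₀ / (C₀ * ε)) * volume (B ∩ {x : Plane | δ < x 0}) ≤
        ENNReal.ofReal θ₀ := by
      have h3 : volume (B ∩ {x : Plane | δ < x 0}) ≤ ENNReal.ofReal (C₀ * ε) := by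
        refine (measure_mono (inter_subset_left)).trans (le_trans ?_ hE)
        have : B ⊆ B ∩ Q := fun x hx => ⟨hx, hx.1⟩
        exact (measure_mono this).trans le_add_self
      refine (mul_le_mul_right h3 _).trans ?_
      rw [← ENNReal.ofReal_mul (by positivity)]
      apply ENNReal.ofReal_le_ofReal
      rw [div_mul_cancel₀ _ (by positivity)]
    refine (add_le_add h1 h2).trans ?_
    rw [← ENNReal.ofReal_add (by positivity) (by positivity)]
    apply ENNReal.ofReal_le_ofReal
    linarith
  obtain ⟨j, hj, hjle⟩ := exists_slab (F := F) (t := δ) hp0.le hm0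
  have hZ := le_ofReal_div_of_natCast_mul_le hm0 (hjle.trans hF)
  have hj' : (j : ℝ) + 1 ≤ m := by exact_mod_cast hj
  have hjp : ((j : ℝ) + 1) * p ≤ δ := (mul_le_mul_of_nonneg_right hj' hp0.le).trans hmle
  have hj0 : 0 ≤ (j : ℝ) * p := by positivity
  have hr : 0 < lam * ε := by positivity
  have hT : 6 * θ₀ / m ≤ 12 * θ₀ * (w + 4 * lam) / δ * ε := by
    have hm' : (0 : ℝ) < m := by exact_mod_cast hm0
    rw [div_le_iff₀ (by positivity)] at hmge ⊢
    have h3 : 12 * θ₀ * (w + 4 * lam) / δ * ε * m = 6 * θ₀ / δ * (m * (2 * p)) := by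
      rw [hp]
      ring
    rw [h3]
    calc 6 * θ₀ = 6 * θ₀ / δ * δ := by field_simp
      _ ≤ _ := by gcongr
  have hZ' := hZ.trans (ENNReal.ofReal_le_ofReal hT)
  have hslab : {x : Plane | x 0 ∈ Ioo (δ + j * p + 2 * (lam * ε) - 2 * (lam * ε))
      (δ + j * p + 2 * (lam * ε) + w * ε + 2 * (lam * ε))} =
      {x : Plane | x 0 ∈ Ioo (δ + j * p) (δ + (j + 1) * p)} := by
    have h1 : δ + j * p + 2 * (lam * ε) - 2 * (lam * ε) = δ + j * p := by ring
    have h2 : δ + j * p + 2 * (lam * ε) + w * ε + 2 * (lam * ε) = δ + (j + 1) * p := by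
      rw [hp]
      ring
    rw [h1, h2]
  have hslabm : MeasurableSet {x : Plane | x 0 ∈ Ioo (δ + j * p) (δ + (j + 1) * p)} :=
    (measurable_coord 0) measurableSet_Ioo
  refine ⟨δ + j * p + 2 * (lam * ε), by linarith, ?_, ?_, ?_⟩
  · have : w * ε + 4 * (lam * ε) = p := by rw [hp]; ring
    linarith
  · refine le_trans ?_ hZ'
    have hsub : (Q \ B) ∩ {x : Plane | x 0 ∈ Ioo (δ + j * p + 2 * (lam * ε))
        (δ + j * p + 2 * (lam * ε) + w * ε)} ⊆
        (Q \ B) ∩ {x : Plane | x 0 ∈ Ioo (δ + j * p) (δ + (j + 1) * p)} := by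
      rw [← hslab]
      rintro x ⟨hx, h1, h2⟩
      exact ⟨hx, by linarith, by linarith⟩
    refine (lintegral_mono_set hsub).trans ?_
    rw [← setLIntegral_indicator hQB]
    exact lintegral_mono fun x => le_self_add
  · rw [hslab]
    have h1 : ENNReal.ofReal (θ₀ / (C₀ * ε)) *
        volume (B ∩ {x : Plane | x 0 ∈ Ioo (δ + j * p) (δ + (j + 1) * p)}) ≤
        ENNReal.ofReal (12 * θ₀ * (w + 4 * lam) / δ * ε) := by
      rw [← setLIntegral_const, ← setLIntegral_indicator hBm]
      exact (lintegral_mono fun x => le_add_self).trans hZ'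
    have h2 : 12 * θ₀ * (w + 4 * lam) / δ * ε =
        θ₀ / (C₀ * ε) * (12 * C₀ * (w + 4 * lam) / δ * ε ^ 2) := by
      field_simp
    rw [h2, ENNReal.ofReal_mul (by positivity)] at h1
    exact (ENNReal.mul_le_mul_iff_right (by simp; positivity) ENNReal.ofReal_ne_top).1 h1

/-- If an admissible pair has energy of order `ε` and is `L¹`-close to a rotation `R` on the right of
the interface, it can be replaced by `R` to the right of `2 δ`, at an arbitrarily small relative cost.

The modification takes place in a column of width `w ε`. A wide column makes the shears that adjust
the phases cheap, a large distance `ℓ ≥ M ε` between the segments makes the cores of the segments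
cheap, and the choice of the column takes care of all other terms. -/
theorem exists_admissible_eq_right (hlam : 0 < lam) (hτ : 0 < τ) {C₀ δ κ : ℝ} (hC₀ : 0 < C₀)
    (hδ : 0 < δ) (hδ' : δ < 1 / 4) (hκ : 0 < κ) :
    ∃ θ₀ : ℝ, 0 < θ₀ ∧ ∃ ε₀ : ℝ, 0 < ε₀ ∧ ∀ (ε : ℝ) (A : Plane → Mat) (S : Set Plane) (R : Mat),
      0 < ε → ε < ε₀ → R ∈ SO2 → Admissible τ ε (square (1 / 2)) A S →
      (∀ i j, Measurable fun x => A x i j) →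
      pairEnergy lam ε (square (1 / 2)) A S (square (1 / 2)) ≤ ENNReal.ofReal (C₀ * ε) →
      ∫⁻ x in (square (1 / 2) \ nbhd (square (1 / 2)) (lam * ε) S) ∩ {x | δ < x 0},
        ENNReal.ofReal (frobNorm (A x - R)) ≤ ENNReal.ofReal θ₀ →
      ∃ (A' : Plane → Mat) (S' : Set Plane), Admissible τ ε (square (1 / 2)) A' S' ∧
        (∀ i j, Measurable fun x => A' x i j) ∧ (∀ x : Plane, x 0 ≤ δ → A' x = A x) ∧
        (∀ x : Plane, 2 * δ ≤ x 0 → A' x = R) ∧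
        (∀ x ∈ S', x 0 ≤ 2 * δ ∧ (x ∈ S ∨ δ ≤ x 0)) ∧
        (∀ x ∈ nbhd (square (1 / 2)) (lam * ε) S, x 0 ≤ δ →
          x ∈ nbhd (square (1 / 2)) (lam * ε) S') ∧
        pairEnergy lam ε (square (1 / 2)) A' S' (square (1 / 2)) ≤
          pairEnergy lam ε (square (1 / 2)) A S (square (1 / 2)) + ENNReal.ofReal (κ * ε) := by
  obtain ⟨C, hC, hcut⟩ := exists_isCutoff
  obtain ⟨w, hw⟩ : ∃ x, x = max lam (24 * C ^ 2 * τ ^ 2 / κ) := ⟨_, rfl⟩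
  have hw0 : 0 < w := hw ▸ lt_max_of_lt_left hlam
  have hwlam : lam ≤ w := hw ▸ le_max_left _ _
  have hwκ : 24 * C ^ 2 * τ ^ 2 ≤ w * κ := by
    rw [← div_le_iff₀ hκ, hw]
    exact le_max_right _ _
  obtain ⟨M, hM⟩ : ∃ x, x = max (2 * lam) (8 * lam * (w + 2 * lam) / κ) := ⟨_, rfl⟩
  have hM0 : 0 < M := hM ▸ lt_max_of_lt_left (by positivity)
  have hMlam : 2 * lam ≤ M := hM ▸ le_max_left _ _
  have hMκ : 8 * lam * (w + 2 * lam) ≤ M * κ := by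
    rw [← div_le_iff₀ hκ, hM]
    exact le_max_right _ _
  obtain ⟨D, hD⟩ : ∃ x, x = 3 + 12 * C ^ 2 * M ^ 2 / w ^ 2 := ⟨_, rfl⟩
  have hD0 : 0 < D := by
    rw [hD]
    positivity
  obtain ⟨K, hK⟩ : ∃ x, x = 144 * C₀ * (w + 4 * lam) / (δ * lam ^ 2) := ⟨_, rfl⟩
  have hK0 : 0 < K := by
    rw [hK]
    positivity
  obtain ⟨θ₀, hθ₀⟩ : ∃ x, x = κ * δ / (48 * D * (w + 4 * lam)) := ⟨_, rfl⟩
  have hθ₀0 : 0 < θ₀ := by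
    rw [hθ₀]
    positivity
  refine ⟨θ₀, hθ₀0, min (min (θ₀ / (12 * C₀)) (δ / (w + 4 * lam))) (min (min (1 / (2 * M)) (1 / lam))
    (κ / (4 * (K * (w + 2 * lam) * (2 * M + 2 * lam))))), by positivity, ?_⟩
  intro ε A S R hε hε₀ hR hA hmeas hE hL
  rw [lt_min_iff, lt_min_iff, lt_min_iff, lt_min_iff, lt_div_iff₀ (by positivity),
    lt_div_iff₀ (by positivity), lt_div_iff₀ (by positivity), lt_div_iff₀ (by positivity),
    lt_div_iff₀ (by positivity)] at hε₀
  obtain ⟨⟨e1, e2⟩, ⟨e3, e4⟩, e5⟩ := hε₀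
  set Q := square (1 / 2) with hQ
  have hr : 0 < lam * ε := by positivity
  have hSQ : S ⊆ Q := by
    obtain ⟨C, -, rfl⟩ := hA.relClosed
    exact inter_subset_left
  obtain ⟨a, ha1, ha2, hX, hY⟩ := exists_column hlam hC₀ hδ hθ₀0 hε hw0 (by linarith)
    (by linarith) hR hmeas hE hL
  set b := a + w * ε with hb
  have hwε : 0 < w * ε := by positivity
  have hab : a < b := by linarith
  have hab' : lam * ε ≤ b - a := by
    have := mul_le_mul_of_nonneg_right hwlam hε.le
    linarith
  -- the strips
  set N := ⌊1 / (M * ε)⌋₊ with hN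
  have hMε : 0 < M * ε := by positivity
  have h1Mε : 2 ≤ 1 / (M * ε) := by
    rw [le_div_iff₀ hMε]
    linarith
  have hN0 : 0 < N := Nat.floor_pos.2 (by linarith)
  have hN0' : (0 : ℝ) < N := by exact_mod_cast hN0
  have hNle : (N : ℝ) * (M * ε) ≤ 1 := by
    rw [← le_div_iff₀ hMε]
    exact Nat.floor_le (by positivity)
  have hNge : 1 ≤ (N : ℝ) * (2 * M * ε) := by
    have h1 := Nat.lt_floor_add_one (1 / (M * ε))
    have h2 : 1 / (M * ε) / 2 ≤ N := by linarith
    rw [div_div, div_le_iff₀ (by positivity)] at h2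
    linarith
  set ℓ : ℝ := 1 / N with hℓ
  have hℓ0 : 0 < ℓ := by positivity
  have hNℓ : (N : ℝ) * ℓ = 1 := by
    rw [hℓ]
    field_simp
  have hℓge : M * ε ≤ ℓ := by
    rw [hℓ, le_div_iff₀ hN0']
    linarith
  have hℓle : ℓ ≤ 2 * M * ε := by
    rw [hℓ, div_le_iff₀ hN0']
    linarith
  classical
  let bad : Finset ℤ := (Finset.Ico (0 : ℤ) N).filter fun i =>
    ∃ x ∈ nbhd Q (lam * ε) S, a ≤ x 0 ∧ x 0 ≤ b ∧ strip ℓ (x 1) = i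
  have hbad : ∀ x ∈ nbhd Q (lam * ε) S, a ≤ x 0 → x 0 ≤ b → strip ℓ (x 1) ∈ bad := by
    intro x hx h0 h1
    have hx1 := abs_lt.1 hx.1.2
    refine Finset.mem_filter.2 ⟨Finset.mem_Ico.2 ⟨?_, ?_⟩, x, hx, h0, h1, rfl⟩
    · exact Int.floor_nonneg.2 (div_nonneg (by linarith) hℓ0.le)
    · refine Int.floor_lt.2 ?_
      rw [div_lt_iff₀ hℓ0, Int.cast_natCast, hNℓ]
      linarith
  have hbadS : ∀ s ∈ S, a ≤ s 0 → s 0 ≤ b → strip ℓ (s 1) ∈ bad := fun s hs =>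
    hbad s (mem_nbhd.2 ⟨hSQ hs, s, hs, by simpa using hr⟩)
  obtain ⟨η, θ, hη, hθ⟩ := hcut a b hab
  obtain ⟨e, he, hadm⟩ := exists_admissible_lateralField (R := R) (by positivity : 0 < τ * ε) hA
    hmeas hℓ0 hNℓ.ge (by linarith) hab.le (by linarith) hη hbadS
  refine ⟨_, _, hadm, measurable_lateralField hη hab.le hmeas,
    fun x hx => lateralField_of_le hη hab.le (by linarith),
    fun x hx => lateralField_of_ge hη hab.le (by linarith), ?_,
    fun x hx h0 => mem_nbhd_lateral hr hℓ0 hab' hSQ hbad hx (by linarith), ?_⟩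
  · rintro x (⟨hx, h0⟩ | ⟨-, h0, h1, -⟩)
    · exact ⟨by linarith, Or.inl hx⟩
    · exact ⟨by linarith, Or.inr (by linarith)⟩
  -- the number of bad boxes is bounded independently of `ε`
  have hcard : (bad.card : ℝ) ≤ K := by
    have h1 := card_bad_mul_le hℓ0 hr (by linarith)
      ((by nlinarith : 2 * (lam * ε) ≤ M * ε).trans hℓge) hSQ
      (a := a) (b := b) (bad := bad) fun i hi => (Finset.mem_filter.1 hi).2
    have h2 := h1.trans (mul_le_mul_right hY 3)
    rw [← ENNReal.ofReal_natCast, ← ENNReal.ofReal_mul (by positivity),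
      ← ENNReal.ofReal_ofNat 3, ← ENNReal.ofReal_mul (by norm_num),
      ENNReal.ofReal_le_ofReal_iff (by positivity)] at h2
    have h3 : 3 * (12 * C₀ * (w + 4 * lam) / δ * ε ^ 2) = K * ((lam * ε) ^ 2 / 4) := by
      rw [hK]
      field_simp
      ring
    rw [h3] at h2
    exact le_of_mul_le_mul_right h2 (by positivity)
  have hgood : goodColumn ℓ a b bad ⊆
      (Q \ nbhd Q (lam * ε) S) ∩ {x | x 0 ∈ Ioo a (a + w * ε)} := by
    rintro x ⟨hx, h0, h1, h2⟩
    exact ⟨⟨hx, fun h => h2 (hbad x h h0.le h1.le)⟩, h0, h1⟩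
  refine (pairEnergy_lateralField_le hr hR hℓ0 hab' hη hSQ hbad).trans ?_
  rw [add_assoc]
  gcongr
  refine (add_le_add (lintegral_goodColumn_le hℓ0 hη hθ he hmeas)
    (volume_nbhd_columnSet_le hℓ0 hNℓ.ge hab.le hr.le)).trans ?_
  have hba : b - a = w * ε := by rw [hb]; ring
  have hΘ : 3 + 3 * (C / (b - a)) ^ 2 * ℓ ^ 2 ≤ D := by
    have h1 : ℓ ^ 2 ≤ (2 * M * ε) ^ 2 := pow_le_pow_left₀ hℓ0.le hℓle 2
    have h2 : 3 * (C / (b - a)) ^ 2 * (2 * M * ε) ^ 2 = 12 * C ^ 2 * M ^ 2 / w ^ 2 := by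
      rw [hba]
      field_simp
      ring
    have h3 := mul_le_mul_of_nonneg_left h1 (by positivity : 0 ≤ 3 * (C / (b - a)) ^ 2)
    rw [hD]
    linarith
  have t1 : ENNReal.ofReal (3 + 3 * (C / (b - a)) ^ 2 * ℓ ^ 2) *
      ∫⁻ x in goodColumn ℓ a b bad, ENNReal.ofReal (frobNorm (A x - R) ^ 2) ≤
      ENNReal.ofReal (κ / 4 * ε) := by
    refine (mul_le_mul' (ENNReal.ofReal_le_ofReal hΘ) ((lintegral_mono_set hgood).trans hX)).trans ?_
    rw [← ENNReal.ofReal_mul hD0.le]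
    apply ENNReal.ofReal_le_ofReal
    rw [hθ₀]
    apply le_of_eq
    field_simp
    ring
  have t2 : 6 * (C / (b - a)) ^ 2 * (τ * ε) ^ 2 * (b - a) ≤ κ / 4 * ε := by
    have h1 : 6 * (C / (b - a)) ^ 2 * (τ * ε) ^ 2 * (b - a) =
        24 * C ^ 2 * τ ^ 2 / w * (ε / 4) := by
      rw [hba]
      field_simp
      ring
    have h2 : 24 * C ^ 2 * τ ^ 2 / w ≤ κ := by
      rw [div_le_iff₀ hw0]
      linarith
    have h3 := mul_le_mul_of_nonneg_right h2 (by positivity : 0 ≤ ε / 4)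
    rw [h1]
    linarith
  have t3 : N * ((b - a + 2 * (lam * ε)) * (2 * (lam * ε))) ≤ κ / 4 * ε := by
    have h1 : N * ((b - a + 2 * (lam * ε)) * (2 * (lam * ε))) =
        (N * (M * ε)) * (8 * lam * (w + 2 * lam) / M * (ε / 4)) := by
      rw [hba]
      field_simp
      ring
    have h2 : 8 * lam * (w + 2 * lam) / M ≤ κ := by
      rw [div_le_iff₀ hM0]
      linarith
    rw [h1]
    refine (mul_le_of_le_one_left (by positivity) hNle).trans ?_
    have h3 := mul_le_mul_of_nonneg_right h2 (by positivity : 0 ≤ ε / 4)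
    linarith
  have t4 : bad.card * ((b - a + 2 * (lam * ε)) * (ℓ + 2 * (lam * ε))) ≤ κ / 4 * ε := by
    have h1 : (b - a + 2 * (lam * ε)) * (ℓ + 2 * (lam * ε)) ≤
        (b - a + 2 * (lam * ε)) * (2 * M * ε + 2 * (lam * ε)) := by
      gcongr
    refine (mul_le_mul hcard h1 (by rw [hba]; positivity) hK0.le).trans ?_
    rw [hba]
    have h2 : K * ((w * ε + 2 * (lam * ε)) * (2 * M * ε + 2 * (lam * ε))) =
        ε * (4 * (K * (w + 2 * lam) * (2 * M + 2 * lam))) * (ε / 4) := by ring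
    have h3 := mul_le_mul_of_nonneg_right e5.le (by positivity : 0 ≤ ε / 4)
    rw [h2]
    linarith
  refine (add_le_add (add_le_add t1 (ENNReal.ofReal_le_ofReal t2))
    (ENNReal.ofReal_le_ofReal (add_le_add t3 t4))).trans_eq ?_
  rw [← ENNReal.ofReal_add (by positivity) (by positivity),
    ← ENNReal.ofReal_add (by positivity) (by positivity)]
  congr 1
  ring

end OneSided

/-! ### Point reflection, and the modification on both sides of the interface -/

section Reflection

variable {lam τ ε : ℝ} {A B : Plane → Mat} {S : Set Plane}

theorem homothety_zero_neg_one : homothety 0 (-1) = fun x : Plane => -x := by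
  ext1 x
  simp [homothety]

theorem neg_mem_square {r : ℝ} {x : Plane} : -x ∈ square r ↔ x ∈ square r := by
  simp [square]

theorem setLIntegral_neg {E : Set Plane} (hE : MeasurableSet E) (f : Plane → ℝ≥0∞) :
    ∫⁻ x in {x | -x ∈ E}, f (-x) = ∫⁻ x in E, f x := by
  have hE' : MeasurableSet {x : Plane | -x ∈ E} := measurable_neg hE
  have h := lintegral_homothety (c := 0) (r := -1) (by norm_num) (E.indicator f)
  rw [homothety_zero_neg_one] at h
  have h2 : ENNReal.ofReal (((-1 : ℝ) ^ 2)⁻¹) = 1 := by norm_num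
  rw [← lintegral_indicator hE, ← lintegral_indicator hE', ← one_mul (∫⁻ x, E.indicator f x), ← h2]
  exact h

theorem mem_nbhd_neg {r ρ : ℝ} {x : Plane} :
    x ∈ nbhd (square r) ρ {x | -x ∈ S} ↔ -x ∈ nbhd (square r) ρ S := by
  rw [mem_nbhd, mem_nbhd, neg_mem_square]
  refine and_congr_right fun _ => ⟨?_, ?_⟩
  · rintro ⟨s, hs, hd⟩
    exact ⟨-s, hs, by rwa [dist_neg_neg]⟩
  · rintro ⟨s, hs, hd⟩
    exact ⟨-s, by simpa using hs, by rwa [← dist_neg_neg, neg_neg]⟩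

theorem measurableSet_square_diff_nbhd (r ρ : ℝ) (S : Set Plane) :
    MeasurableSet (square r \ nbhd (square r) ρ S) :=
  (measurableSet_square _).diff (isOpen_nbhd (isOpen_square _) _).measurableSet

theorem pairEnergy_neg {r : ℝ} :
    pairEnergy lam ε (square r) (fun x => A (-x)) {x | -x ∈ S} (square r) =
      pairEnergy lam ε (square r) A S (square r) := by
  unfold pairEnergy elasticEnergy coreEnergy
  have h1 : square r \ nbhd (square r) (lam * ε) {x | -x ∈ S} =
      {x | -x ∈ square r \ nbhd (square r) (lam * ε) S} := by
    ext x
    simp only [Set.mem_sdiff, mem_nbhd_neg, mem_ofPred_eq, neg_mem_square]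
  have h2 : nbhd (square r) (lam * ε) {x | -x ∈ S} ∩ square r =
      {x | -x ∈ nbhd (square r) (lam * ε) S ∩ square r} := by
    ext x
    simp only [mem_inter_iff, mem_nbhd_neg, mem_ofPred_eq, neg_mem_square]
  have h3 := setLIntegral_neg ((isOpen_nbhd (isOpen_square r) (S := S) (lam * ε)).inter
    (isOpen_square r)).measurableSet fun _ => 1
  rw [setLIntegral_one, setLIntegral_one] at h3
  rw [h1, h2, h3, setLIntegral_neg (measurableSet_square_diff_nbhd _ _ _)
    fun x => ENNReal.ofReal (distSO2 (A x) ^ 2)]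

theorem Admissible.neg {r : ℝ} (h : Admissible τ ε (square r) A S) :
    Admissible τ ε (square r) (fun x => A (-x)) {x | -x ∈ S} := by
  have hQ : homothety 0 (-1) ⁻¹' square r = square r := by
    rw [homothety_zero_neg_one]
    ext x
    exact neg_mem_square
  refine Admissible.of_inLattice (isOpen_square r) (fun i j => ?_) ?_ fun φ hφ hi => ?_
  · have h1 := integrable_homothety (c := 0) (r := -1) (by norm_num)
      ((integrable_indicator_iff (measurableSet_square r)).2 (h.integrable i j))
    rw [← integrable_indicator_iff (measurableSet_square r)]
    have h2 : (square r).indicator (fun x => A (-x) i j) =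
        fun x => (square r).indicator (fun x => A x i j) (homothety 0 (-1) x) := by
      ext x
      rw [homothety_zero_neg_one]
      by_cases hx : x ∈ square r
      · rw [indicator_of_mem hx, indicator_of_mem (neg_mem_square.2 hx)]
      · rw [indicator_of_notMem hx, indicator_of_notMem fun h' => hx (neg_mem_square.1 h')]
    rw [h2]
    exact h1
  · obtain ⟨C, hC, rfl⟩ := h.relClosed
    refine ⟨{x | -x ∈ C}, hC.preimage continuous_neg, ?_⟩
    ext x
    simp only [mem_ofPred_eq, mem_inter_iff, neg_mem_square]
  · have hψ := hφ.homothety (c := 0) (r := -1) (by norm_num)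
    rw [hQ] at hψ
    have hψi := hi.homothety (c := 0) (r := -1)
    have h1 : homothety 0 (-1) ⁻¹' {x : Plane | -x ∈ S} = S := by
      rw [homothety_zero_neg_one]
      ext x
      simp
    rw [h1] at hψi
    have h2 := h.inLattice (isOpen_square r) (convex_square r) hψ hψi
    have h3 := curlPairing_homothety (A := A) (c := 0) (r := -1) (by norm_num) hψ
    rw [hQ] at h3
    simp only [homothety_zero_neg_one, neg_neg] at h3 h2
    rw [h3]
    convert h2.neg using 1
    ext i
    simp

theorem Admissible.congr_ae {Ω : Set Plane} (hΩ : IsOpen Ω) (hconv : Convex ℝ Ω)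
    (h : Admissible τ ε Ω A S) (hAB : ∀ i j, (fun x => A x i j) =ᵐ[volume.restrict Ω]
      fun x => B x i j) : Admissible τ ε Ω B S := by
  refine Admissible.of_inLattice hΩ (fun i j => (h.integrable i j).congr (hAB i j)) h.relClosed
    fun φ hφ hi => ?_
  convert h.inLattice hΩ hconv hφ hi using 1
  ext i
  refine integral_congr_ae ?_
  filter_upwards [hAB i 0, hAB i 1] with x h0 h1
  simp [Matrix.mulVec, dotProduct, h0, h1]

/-- An integrable field has a measurable representative. -/
theorem IsL1.exists_measurable {Ω : Set Plane} (h : IsL1 Ω A) :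
    ∃ B : Plane → Mat, (∀ i j, Measurable fun x => B x i j) ∧
      ∀ᵐ x ∂volume.restrict Ω, A x = B x := by
  refine ⟨fun x i j => (h i j).1.mk _ x, fun i j => (h i j).1.stronglyMeasurable_mk.measurable, ?_⟩
  have h1 := ae_all_iff.2 fun i => ae_all_iff.2 fun j => (h i j).1.ae_eq_mk
  filter_upwards [h1] with x hx
  ext i j
  exact hx i j

/-- If an admissible pair has energy of order `ε` and is `L¹`-close to the interface, it can be
modified to coincide with the interface where `|x₁| ≥ 2 δ`, at an arbitrarily small relative
cost. -/
theorem exists_admissible_eq_interface (hlam : 0 < lam) (hτ : 0 < τ) {C₀ δ κ : ℝ} (hC₀ : 0 < C₀)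
    (hδ : 0 < δ) (hδ' : δ < 1 / 4) (hκ : 0 < κ) :
    ∃ θ₀ : ℝ, 0 < θ₀ ∧ ∃ ε₀ : ℝ, 0 < ε₀ ∧ ∀ (ε : ℝ) (A : Plane → Mat) (S : Set Plane)
      (Rm Rp : Mat), 0 < ε → ε < ε₀ → Rm ∈ SO2 → Rp ∈ SO2 →
      Admissible τ ε (square (1 / 2)) A S →
      pairEnergy lam ε (square (1 / 2)) A S (square (1 / 2)) ≤ ENNReal.ofReal (C₀ * ε) →
      ∫⁻ x in square (1 / 2) \ nbhd (square (1 / 2)) (lam * ε) S,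
        ENNReal.ofReal (frobNorm (A x - interfaceField Rm Rp x)) ≤ ENNReal.ofReal θ₀ →
      ∃ (A' : Plane → Mat) (S' : Set Plane), Admissible τ ε (square (1 / 2)) A' S' ∧
        (∀ x : Plane, 2 * δ ≤ |x 0| → A' x = interfaceField Rm Rp x) ∧
        (∀ x ∈ S', |x 0| ≤ 2 * δ) ∧
        pairEnergy lam ε (square (1 / 2)) A' S' (square (1 / 2)) ≤
          pairEnergy lam ε (square (1 / 2)) A S (square (1 / 2)) + ENNReal.ofReal (κ * ε) := by
  obtain ⟨θ₁, hθ₁, ε₁, hε₁, H₁⟩ :=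
    exists_admissible_eq_right hlam hτ hC₀ hδ hδ' (by positivity : 0 < κ / 2)
  obtain ⟨θ₂, hθ₂, ε₂, hε₂, H₂⟩ := exists_admissible_eq_right hlam hτ
    (by positivity : 0 < C₀ + κ / 2) hδ hδ' (by positivity : 0 < κ / 2)
  refine ⟨min θ₁ θ₂, lt_min hθ₁ hθ₂, min ε₁ ε₂, lt_min hε₁ hε₂, ?_⟩
  intro ε A₀ S Rm Rp hε hεlt hRm hRp hA₀ hE₀ hL₀
  rw [lt_min_iff] at hεlt
  set Q := square (1 / 2) with hQ
  obtain ⟨A, hAm, hAae⟩ := hA₀.integrable.exists_measurable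
  have hA : Admissible τ ε Q A S := hA₀.congr_ae (isOpen_square _) (convex_square _) fun i j => by
    filter_upwards [hAae] with x hx
    rw [hx]
  have hres : ∀ᵐ x ∂volume.restrict (Q \ nbhd Q (lam * ε) S), A₀ x = A x :=
    ae_mono (Measure.restrict_mono sdiff_subset le_rfl) hAae
  have hEeq : pairEnergy lam ε Q A S Q = pairEnergy lam ε Q A₀ S Q := by
    unfold pairEnergy elasticEnergy
    congr 1
    refine lintegral_congr_ae ?_
    filter_upwards [hres] with x hx
    rw [hx]
  have hL : ∫⁻ x in Q \ nbhd Q (lam * ε) S,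
      ENNReal.ofReal (frobNorm (A x - interfaceField Rm Rp x)) ≤
      ENNReal.ofReal (min θ₁ θ₂) := by
    refine le_trans (le_of_eq (lintegral_congr_ae ?_)) hL₀
    filter_upwards [hres] with x hx
    rw [hx]
  have hpos : MeasurableSet {x : Plane | δ < x 0} :=
    measurableSet_lt measurable_const (measurable_coord 0)
  have hnegm : MeasurableSet {x : Plane | x 0 < -δ} :=
    measurableSet_lt (measurable_coord 0) measurable_const
  obtain ⟨A₁, S₁, hA₁, hA₁m, hA₁l, hA₁r, hS₁, hn₁, hE₁⟩ := H₁ ε A S Rp hε hεlt.1 hRp hA hAm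
    (by rw [hEeq]; exact hE₀) <| by
      refine le_trans ?_ (hL.trans (ENNReal.ofReal_le_ofReal (min_le_left _ _)))
      refine le_trans (le_of_eq ?_) (lintegral_mono_set (inter_subset_left (t := {x | δ < x 0})))
      refine setLIntegral_congr_fun ((measurableSet_square_diff_nbhd _ _ _).inter hpos) fun x hx => ?_
      have h : ¬ x 0 < 0 := by
        have := hx.2
        simp only [mem_ofPred_eq] at this
        linarith
      simp only [interfaceField, if_neg h]
  obtain ⟨A₂, S₂, hA₂, -, hA₂l, hA₂r, hS₂, -, hE₂⟩ := H₂ ε (fun x => A₁ (-x)) {x | -x ∈ S₁} Rm hε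
    hεlt.2 hRm hA₁.neg (fun i j => (hA₁m i j).comp measurable_neg) (by
      rw [pairEnergy_neg]
      refine hE₁.trans ?_
      rw [add_mul, ENNReal.ofReal_add (by positivity) (by positivity), hEeq]
      gcongr) <| by
      refine le_trans ?_ (hL.trans (ENNReal.ofReal_le_ofReal (min_le_right _ _)))
      have h1 : (square (1 / 2) \ nbhd (square (1 / 2)) (lam * ε) {x | -x ∈ S₁}) ∩ {x | δ < x 0} =
          {x | -x ∈ (Q \ nbhd Q (lam * ε) S₁) ∩ {x | x 0 < -δ}} := by
        ext x
        simp only [mem_inter_iff, Set.mem_sdiff, mem_nbhd_neg, mem_ofPred_eq, neg_mem_square,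
          PiLp.neg_apply, neg_lt_neg_iff, hQ]
      rw [h1, setLIntegral_neg ((measurableSet_square_diff_nbhd _ _ _).inter hnegm)
        fun x => ENNReal.ofReal (frobNorm (A₁ x - Rm))]
      have hsub : (Q \ nbhd Q (lam * ε) S₁) ∩ {x | x 0 < -δ} ⊆ Q \ nbhd Q (lam * ε) S := by
        rintro x ⟨⟨hx, hx'⟩, h0⟩
        simp only [mem_ofPred_eq] at h0
        exact ⟨hx, fun h => hx' (hn₁ x h (by linarith))⟩
      refine le_trans (le_of_eq ?_) (lintegral_mono_set hsub)
      refine setLIntegral_congr_fun ((measurableSet_square_diff_nbhd _ _ _).inter hnegm)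
        fun x hx => ?_
      have h0 := hx.2
      simp only [mem_ofPred_eq] at h0
      simp only [interfaceField, if_pos (by linarith : x 0 < 0), hA₁l x (by linarith)]
  refine ⟨fun x => A₂ (-x), {x | -x ∈ S₂}, hA₂.neg, fun x hx => ?_, fun x hx => ?_, ?_⟩
  · rcases le_abs.1 hx with h | h
    · have h1 : ¬ x 0 < 0 := by linarith
      have h2 := hA₂l (-x) (by simp only [PiLp.neg_apply]; linarith)
      simp only [neg_neg] at h2
      simp only [h2, hA₁r x h, interfaceField, if_neg h1]
    · have h1 : x 0 < 0 := by linarith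
      simp only [hA₂r (-x) (by simpa using h), interfaceField, if_pos h1]
  · obtain ⟨h1, h2⟩ := hS₂ _ hx
    simp only [mem_ofPred_eq, neg_neg, PiLp.neg_apply] at h1 h2
    rcases h2 with h2 | h2
    · exact abs_le.2 ⟨by linarith, (hS₁ x h2).1⟩
    · exact abs_le.2 ⟨by linarith, by linarith⟩
  · rw [pairEnergy_neg]
    refine hE₂.trans ?_
    rw [pairEnergy_neg]
    refine (add_le_add hE₁ le_rfl).trans_eq ?_
    rw [hEeq, add_assoc, ← ENNReal.ofReal_add (by positivity) (by positivity)]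
    congr 2
    ring

end Reflection

/-! ### Stacking rescaled copies of an admissible pair -/

section Stack

variable {lam τ ε δ h : ℝ} {A : Plane → Mat} {S : Set Plane} {Rm Rp : Mat} {N : ℕ}

/-- The inverse of the homothety of ratio `h` that maps the unit square onto the square of side `h`
which is centred on the axis `{x₁ = 0}` and lies between the levels `j` and `j + 1`. -/
noncomputable def toUnit (h : ℝ) (j : ℤ) : Plane → Plane :=
  homothety (-(h⁻¹ • pt (0, level h j + h / 2))) h⁻¹

/-- The homothety that maps the unit square onto the `j`-th square of side `h`. -/
noncomputable def ofUnit (h : ℝ) (j : ℤ) : Plane → Plane :=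
  homothety (pt (0, level h j + h / 2)) h

theorem toUnit_ofUnit (hh : 0 < h) (j : ℤ) (x : Plane) : toUnit h j (ofUnit h j x) = x :=
  homothety_homothety' hh.ne' x

theorem continuous_toUnit (j : ℤ) : Continuous (toUnit h j) := contDiff_homothety.continuous

@[simp] theorem toUnit_zero (j : ℤ) (x : Plane) : toUnit h j x 0 = x 0 / h := by
  simp [toUnit]
  ring

theorem toUnit_one (hh : 0 < h) (j : ℤ) (x : Plane) :
    toUnit h j x 1 = (x 1 - level h j) / h - 1 / 2 := by
  simp [toUnit]
  field_simp
  ring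

@[simp] theorem ofUnit_zero (j : ℤ) (x : Plane) : ofUnit h j x 0 = h * x 0 := by
  simp [ofUnit]

theorem toUnit_mem_square (hh : 0 < h) {j : ℤ} {x : Plane} :
    toUnit h j x ∈ square (1 / 2) ↔
      |x 0| < h / 2 ∧ level h j < x 1 ∧ x 1 < level h (j + 1) := by
  have h0 : |x 0 / h| < 1 / 2 ↔ |x 0| < h / 2 := by
    rw [abs_div, abs_of_pos hh, div_lt_iff₀ hh, one_div_mul_eq_div]
  have h1 : |(x 1 - level h j) / h - 1 / 2| < 1 / 2 ↔ level h j < x 1 ∧ x 1 < level h j + h := by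
    rw [abs_lt, lt_sub_iff_add_lt, sub_lt_iff_lt_add, lt_div_iff₀ hh, div_lt_iff₀ hh]
    constructor <;> rintro ⟨h2, h3⟩ <;> constructor <;> linarith
  rw [level_add_one, square, mem_ofPred_eq, toUnit_zero, toUnit_one hh, h0, h1]

theorem lintegral_toUnit (hh : 0 < h) (j : ℤ) {E : Set Plane} (hE : MeasurableSet E)
    (f : Plane → ℝ≥0∞) : ∫⁻ x in {x | toUnit h j x ∈ E}, f (toUnit h j x) =
      ENNReal.ofReal (h ^ 2) * ∫⁻ x in E, f x := by
  have hE' : MeasurableSet {x : Plane | toUnit h j x ∈ E} := measurable_homothety hE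
  have h1 := lintegral_homothety (c := -(h⁻¹ • pt (0, level h j + h / 2)))
    (inv_ne_zero hh.ne') (E.indicator f)
  rw [inv_pow, inv_inv] at h1
  rw [← lintegral_indicator hE, ← lintegral_indicator hE', ← h1]
  rfl

theorem interfaceField_toUnit (hh : 0 < h) (j : ℤ) (x : Plane) :
    interfaceField Rm Rp (toUnit h j x) = interfaceField Rm Rp x := by
  simp only [interfaceField, toUnit_zero, div_neg_iff, hh, hh.not_gt, and_false, false_or, and_true]

/-- The interface, with the field `A` inserted at scale `h` in the squares with index `j < N`. -/
noncomputable def stackField (h : ℝ) (N : ℕ) (Rm Rp : Mat) (A : Plane → Mat) (x : Plane) : Mat :=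
  interfaceField Rm Rp x + ∑ j ∈ Finset.range N,
    (A (toUnit h j x) - interfaceField Rm Rp (toUnit h j x))

/-- The closed set generated by the rescaled copies of `S`, by the horizontal segments of half
length `3 δ h` between them and by the remaining rectangle above the last copy. -/
def stackClosed (h : ℝ) (N : ℕ) (δ : ℝ) (S : Set Plane) : Set Plane :=
  (⋃ j ∈ Finset.range N, {x | toUnit h j x ∈ closure S}) ∪
    ({x | |x 0| ≤ 3 * δ * h} ∩ ((⋃ j ∈ Finset.range N, {x | x 1 = level h j}) ∪
      {x | level h N ≤ x 1}))

theorem isClosed_stackClosed : IsClosed (stackClosed h N δ S) := by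
  have h0 := continuous_coord 0
  have h1 := continuous_coord 1
  refine IsClosed.union (isClosed_biUnion_finset fun j _ =>
    isClosed_closure.preimage (continuous_toUnit _)) ((isClosed_le h0.abs continuous_const).inter
    (IsClosed.union (isClosed_biUnion_finset fun j _ => isClosed_eq h1 continuous_const)
      (isClosed_le continuous_const h1)))

theorem mem_stackClosed_of_segment {i : ℤ} (hh : 0 < h) (hi : 0 ≤ i) {x : Plane}
    (h0 : |x 0| ≤ 3 * δ * h) (h1 : x 1 = level h i) : x ∈ stackClosed h N δ S := by
  refine Or.inr ⟨h0, ?_⟩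
  lift i to ℕ using hi
  by_cases hiN : i < N
  · exact Or.inl (mem_biUnion (x := i) (by simpa using hiN) h1)
  · refine Or.inr ?_
    rw [mem_ofPred_eq, h1]
    exact level_mono hh.le (by exact_mod_cast not_lt.1 hiN)

theorem stackField_of_toUnit_mem (hh : 0 < h)
    (hAQ : ∀ x ∉ square (1 / 2), A x = interfaceField Rm Rp x) {j : ℕ} (hj : j < N) {x : Plane}
    (hx : toUnit h j x ∈ square (1 / 2)) : stackField h N Rm Rp A x = A (toUnit h j x) := by
  rw [stackField, Finset.sum_eq_single j, interfaceField_toUnit hh]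
  · abel
  · intro k _ hk
    rw [hAQ, sub_self]
    intro hx'
    rw [toUnit_mem_square hh] at hx hx'
    have e1 := (strip_eq_iff hh).2 ⟨hx.2.1.le, hx.2.2⟩
    have e2 := (strip_eq_iff hh).2 ⟨hx'.2.1.le, hx'.2.2⟩
    exact hk (by exact_mod_cast e2.symm.trans e1)
  · intro h'
    exact absurd (Finset.mem_range.2 hj) h'

theorem stackField_of_le (hh : 0 < h)
    (hA : ∀ x : Plane, 2 * δ ≤ |x 0| → A x = interfaceField Rm Rp x) {x : Plane}
    (hx : 2 * δ * h ≤ |x 0|) : stackField h N Rm Rp A x = interfaceField Rm Rp x := by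
  rw [stackField, Finset.sum_eq_zero, add_zero]
  intro j _
  rw [hA, sub_self]
  rwa [toUnit_zero, abs_div, abs_of_pos hh, le_div_iff₀ hh]

theorem isL1_interfaceField {Ω : Set Plane} (hΩ : volume Ω < ⊤) : IsL1 Ω (interfaceField Rm Rp) := by
  intro i j
  have hm : Measurable fun x => interfaceField Rm Rp x i j := by
    have h1 : (fun x => interfaceField Rm Rp x i j) =
        fun x : Plane => if x 0 < 0 then Rm i j else Rp i j := by
      ext x
      unfold interfaceField
      split_ifs <;> rfl
    rw [h1]
    exact Measurable.ite (measurableSet_lt (measurable_coord 0) measurable_const)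
      measurable_const measurable_const
  refine Measure.integrableOn_of_bounded (M := max |Rm i j| |Rp i j|) hΩ.ne hm.aestronglyMeasurable
    (ae_of_all _ fun x => ?_)
  rw [Real.norm_eq_abs, interfaceField]
  split_ifs
  · exact le_max_left _ _
  · exact le_max_right _ _

theorem isL1_stackField (hh : 0 < h) (hAQ : ∀ x ∉ square (1 / 2), A x = interfaceField Rm Rp x)
    (hA : IsL1 (square (1 / 2)) A) : IsL1 (square (1 / 2)) (stackField h N Rm Rp A) := by
  intro i j
  have hD : Integrable fun x => (A x - interfaceField Rm Rp x) i j := by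
    refine (integrableOn_iff_integrable_of_support_subset (s := square (1 / 2)) ?_).1
      ((hA.sub (isL1_interfaceField (volume_square_lt_top _))) i j)
    intro x hx
    by_contra h'
    exact hx (by simp [hAQ x h'])
  have h1 : ∀ k : ℕ, Integrable fun x =>
      (A (toUnit h k x) - interfaceField Rm Rp (toUnit h k x)) i j := fun k =>
    integrable_homothety (inv_ne_zero hh.ne') hD
  have h2 : (fun x => stackField h N Rm Rp A x i j) = fun x => interfaceField Rm Rp x i j +
      ∑ k ∈ Finset.range N, (A (toUnit h k x) - interfaceField Rm Rp (toUnit h k x)) i j := by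
    ext x
    simp [stackField, Matrix.sum_apply]
  rw [h2]
  exact (isL1_interfaceField (volume_square_lt_top _) i j).add
    (integrable_finsetSum _ fun k _ => h1 k).integrableOn

/-- The pairing of the rescaled copies with a test function supported in one of the squares. -/
theorem inLattice_stack_of_cell (hh : 0 < h)
    (hAQ : ∀ x ∉ square (1 / 2), A x = interfaceField Rm Rp x)
    (hA : Admissible τ ε (square (1 / 2)) A S) {j : ℕ} (hj : j < N) {Ω : Set Plane} {φ : Plane → ℝ}
    (hφ : IsTest {x | toUnit h j x ∈ square (1 / 2)} φ) (hφΩ : IsTest Ω φ)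
    (hi : IsIntegerNear {x | toUnit h j x ∈ S} φ) :
    InLattice (τ * (h * ε)) (curlPairing Ω (stackField h N Rm Rp A) φ) := by
  set U : Set Plane := {x | toUnit h j x ∈ square (1 / 2)} with hU
  have hpre : ofUnit h j ⁻¹' U = square (1 / 2) := by
    ext x
    simp only [hU, mem_preimage, mem_ofPred_eq, toUnit_ofUnit hh]
  have hpreS : ofUnit h j ⁻¹' {x | toUnit h j x ∈ S} = S := by
    ext x
    simp only [mem_preimage, mem_ofPred_eq, toUnit_ofUnit hh]
  have hψ : IsTest (ofUnit h j ⁻¹' U) (fun x => φ (ofUnit h j x)) := hφ.homothety hh.ne'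
  have hψi : IsIntegerNear (ofUnit h j ⁻¹' {x | toUnit h j x ∈ S}) (fun x => φ (ofUnit h j x)) :=
    hi.homothety
  have hpair : curlPairing (ofUnit h j ⁻¹' U) (fun x => stackField h N Rm Rp A (ofUnit h j x))
      (fun x => φ (ofUnit h j x)) = h⁻¹ • curlPairing U (stackField h N Rm Rp A) φ :=
    curlPairing_homothety hh.ne' hφ
  rw [hpre] at hψ hpair
  rw [hpreS] at hψi
  have hlat := hA.inLattice (isOpen_square _) (convex_square _) hψ hψi
  rw [curlPairing_congr (B := A) fun x hx => ?_] at hpair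
  · obtain ⟨k, hk⟩ := hlat
    refine ⟨k, fun i => ?_⟩
    have h1 : curlPairing Ω (stackField h N Rm Rp A) φ i =
        curlPairing U (stackField h N Rm Rp A) φ i := by
      rw [curlPairing_eq_integral hφ, curlPairing_eq_integral hφΩ]
    have h2 := congrFun hpair i
    rw [hk, Pi.smul_apply, smul_eq_mul, inv_mul_eq_div, eq_div_iff hh.ne'] at h2
    rw [h1, ← h2]
    ring
  · have hxQ : x ∈ square (1 / 2) := by
      by_contra h'
      exact hx (perpGrad_eq_zero_of_notMem_tsupport fun h'' => h' (hψ.2.2 h''))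
    rw [stackField_of_toUnit_mem hh hAQ hj (by rwa [toUnit_ofUnit hh]), toUnit_ofUnit hh]

/-- The field of stacked copies satisfies the circulation condition for the test functions that
vanish on the segments between the copies. -/
theorem inLattice_stack_of_eq_zero (hh : 0 < h) (hδ : 0 < δ) (hδ' : δ < 1 / 8)
    (hAQ : ∀ x ∉ square (1 / 2), A x = interfaceField Rm Rp x)
    (hAδ : ∀ x : Plane, 2 * δ ≤ |x 0| → A x = interfaceField Rm Rp x)
    (hS : ∀ x ∈ S, |x 0| ≤ 2 * δ)
    (hA : Admissible τ ε (square (1 / 2)) A S) {g θ : ℝ → ℝ}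
    (hg : IsCutoff g θ (2 * δ * h) (3 * δ * h)) {φ : Plane → ℝ}
    (hφ : IsTest (square (1 / 2)) φ)
    (hi : IsIntegerNear (square (1 / 2) ∩ stackClosed h N δ S) φ)
    (hz : ∀ s, |s| ≤ 3 * δ * h → ∀ i : ℕ, φ (pt (s, level h i)) = 0) :
    InLattice (τ * (h * ε)) (curlPairing (square (1 / 2)) (stackField h N Rm Rp A) φ) := by
  set Q := square (1 / 2) with hQ
  have hL1 : IsL1 Q (stackField h N Rm Rp A) := isL1_stackField hh hAQ hA.integrable
  have hδh : 0 < δ * h := by positivity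
  -- `φ` vanishes near the segments and near the rectangle above of the last copy
  have hseg : ∀ x : Plane, |x 0| ≤ 3 * δ * h → ∀ i : ℕ, x 1 = level h i → φ =ᶠ[𝓝 x] 0 := by
    intro x h0 i h1
    by_cases hx : x ∈ Q
    · have h2 := hi.eventuallyEq ⟨hx, mem_stackClosed_of_segment hh (Int.natCast_nonneg i) h0 h1⟩
      have h3 : φ x = 0 := by
        rw [← pt_coord x, h1]
        exact hz _ h0 i
      rw [h3] at h2
      exact h2
    · exact hφ.eventually_eq_zero hx
  have htop : ∀ x : Plane, |x 0| ≤ 3 * δ * h → level h N ≤ x 1 → φ =ᶠ[𝓝 x] 0 := by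
    intro x h0 h1
    set T : Set Plane := (fun y => pt (x 0, y)) '' Icc (level h N) (x 1)
    have hT : IsPreconnected T := isPreconnected_Icc.image _ (continuous_pt _).continuousOn
    have hTi : IsIntegerNear T φ := (hi.union_compl hφ).mono <| by
      rintro _ ⟨y, hy, rfl⟩
      by_cases hyQ : pt (x 0, y) ∈ Q
      · exact Or.inl ⟨hyQ, Or.inr ⟨h0, Or.inr hy.1⟩⟩
      · exact Or.inr hyQ
    have hxT : x ∈ T := ⟨x 1, ⟨h1, le_rfl⟩, pt_coord x⟩
    have h4 := hTi.eventuallyEq hxT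
    rw [hTi.eq_of_isPreconnected hT hxT ⟨_, ⟨le_rfl, h1⟩, rfl⟩, hz _ h0 N] at h4
    exact h4
  have hg0 := contDiff_comp_coord hg.contDiff 0
  have hgneg : ContDiff ℝ ∞ fun x : Plane => g (-x 0) :=
    contDiff_comp_coord (η := fun s => g (-s)) (hg.contDiff.comp contDiff_neg) 0
  have hc0 := (continuous_coord 0).tendsto
  -- the parts of `φ` to the right and to the left of the stack do not contribute
  set φp : Plane → ℝ := (fun x => 1 - g (x 0)) * φ with hφp
  set φm : Plane → ℝ := (fun x => 1 - g (-x 0)) * φ with hφm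
  set ψ : Plane → ℝ := (fun x => g (x 0) + g (-x 0) - 1) * φ with hψ
  have tp : IsTest Q φp := hφ.mul_left (contDiff_const.sub hg0)
  have tm : IsTest Q φm := hφ.mul_left (contDiff_const.sub hgneg)
  have tψ : IsTest Q ψ := hφ.mul_left ((hg0.add hgneg).sub contDiff_const)
  have hsum : φ = φp + φm + ψ := by
    ext x
    simp only [hφp, hφm, hψ, Pi.add_apply, Pi.mul_apply]
    ring
  have hp : curlPairing Q (stackField h N Rm Rp A) φp = 0 := by
    rw [curlPairing_congr (B := fun _ => Rp) fun x hx => ?_, curlPairing_const tp]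
    have hx0 : 2 * δ * h < x 0 := by
      by_contra! h'
      refine hx (perpGrad_eq_zero_of_eventuallyEq (c := 0) ?_)
      filter_upwards [(hc0 x).eventually (hg.eventually_one _ h')] with y hy
      simp [hφp, hy]
    have hx0' : ¬ x 0 < 0 := by nlinarith
    rw [stackField_of_le hh hAδ (hx0.le.trans (le_abs_self _)), interfaceField, if_neg hx0']
  have hm : curlPairing Q (stackField h N Rm Rp A) φm = 0 := by
    rw [curlPairing_congr (B := fun _ => Rm) fun x hx => ?_, curlPairing_const tm]
    have hx0 : 2 * δ * h < -x 0 := by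
      by_contra! h'
      refine hx (perpGrad_eq_zero_of_eventuallyEq (c := 0) ?_)
      filter_upwards [(hc0 x).neg.eventually (hg.eventually_one _ h')] with y hy
      simp [hφm, hy]
    have hx0' : x 0 < 0 := by nlinarith
    rw [stackField_of_le hh hAδ (hx0.le.trans (neg_le_abs _)), interfaceField, if_pos hx0']
  have hψout : ∀ x : Plane, 3 * δ * h ≤ |x 0| → ψ =ᶠ[𝓝 x] 0 := by
    intro x hx
    rcases le_abs.1 hx with h' | h'
    · filter_upwards [(hc0 x).eventually (hg.eventually_zero _ h'),
        (hc0 x).neg.eventually (hg.eventually_one (-x 0) (by nlinarith))] with y h1 h2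
      simp [hψ, h1, h2]
    · filter_upwards [(hc0 x).neg.eventually (hg.eventually_zero _ h'),
        (hc0 x).eventually (hg.eventually_one (x 0) (by nlinarith))] with y h1 h2
      simp [hψ, h1, h2]
  have hψφ : ∀ x, φ =ᶠ[𝓝 x] 0 → ψ =ᶠ[𝓝 x] 0 := by
    intro x hx
    filter_upwards [hx] with y hy
    simp [hψ, hy]
  have hψseg : ∀ x : Plane, ∀ i : ℕ, x 1 = level h i → ψ =ᶠ[𝓝 x] 0 := by
    intro x i h1
    rcases le_total (|x 0|) (3 * δ * h) with h0 | h0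
    · exact hψφ x (hseg x h0 i h1)
    · exact hψout x h0
  have hψtop : ∀ x : Plane, level h N ≤ x 1 → ψ =ᶠ[𝓝 x] 0 := by
    intro x h1
    rcases le_total (|x 0|) (3 * δ * h) with h0 | h0
    · exact hψφ x (htop x h0 h1)
    · exact hψout x h0
  -- the remaining part vanishes near the segments, so that it splits into the squares
  let E : ℕ → Set Plane := fun j => {x | strip h (x 1) = j}
  have hEint : ∀ (j : ℕ) (x : Plane), x ∉ {x : Plane | x 1 = level h j ∨ x 1 = level h (j + 1 : ℕ)} →
      ∀ᶠ y in 𝓝 x, (y ∈ E j ↔ x ∈ E j) := by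
    intro j x hx
    simp only [mem_ofPred_eq, not_or] at hx
    have hc1 := (continuous_coord 1).tendsto x
    push_cast at hx
    rcases lt_or_gt_of_ne hx.1 with h1 | h1
    · filter_upwards [hc1.eventually (Iio_mem_nhds h1)] with y hy
      simp only [E, mem_ofPred_eq, strip_eq_iff hh]
      have hy : y 1 < _ := hy
      exact ⟨fun h => absurd h.1 (not_le.2 hy), fun h => absurd h.1 (not_le.2 h1)⟩
    · rcases lt_or_gt_of_ne hx.2 with h2 | h2
      · filter_upwards [hc1.eventually (Ioo_mem_nhds h1 h2)] with y hy
        simp only [E, mem_ofPred_eq, strip_eq_iff hh]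
        exact ⟨fun _ => ⟨h1.le, h2⟩, fun _ => ⟨hy.1.le, hy.2⟩⟩
      · filter_upwards [hc1.eventually (Ioi_mem_nhds h2)] with y hy
        simp only [E, mem_ofPred_eq, strip_eq_iff hh]
        have hy : _ < y 1 := hy
        exact ⟨fun h => absurd h.2 (not_lt.2 hy.le), fun h => absurd h.2 (not_lt.2 h2.le)⟩
  have hfr : ∀ j : ℕ, ∀ x ∈ frontier (E j), ψ =ᶠ[𝓝 x] 0 := by
    intro j x hx
    by_cases hx' : x ∈ {x : Plane | x 1 = level h j ∨ x 1 = level h (j + 1 : ℕ)}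
    · rcases hx' with h1 | h1
      · exact hψseg x j h1
      · exact hψseg x (j + 1) h1
    · exfalso
      have h1 := hEint j x hx'
      rw [frontier_eq_closure_inter_closure] at hx
      obtain ⟨y, hy, hy'⟩ := (mem_closure_iff_frequently.1 hx.1).and_eventually h1 |>.exists
      obtain ⟨z, hz, hz'⟩ := (mem_closure_iff_frequently.1 hx.2).and_eventually h1 |>.exists
      exact hz (hz'.2 (hy'.1 hy))
  have tE : ∀ j : ℕ, IsTest Q ((E j).indicator ψ) := fun j => tψ.indicator (hfr j)
  have hsplit : ψ = ∑ j ∈ Finset.range N, (E j).indicator ψ := by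
    ext x
    rw [Finset.sum_apply]
    by_cases hx : ψ x = 0
    · rw [hx, Finset.sum_eq_zero]
      intro j _
      simp [indicator, hx]
    · have hxQ : x ∈ Q := by
        by_contra h'
        exact hx (tψ.eq_zero h')
      have hx1 := abs_lt.1 hxQ.2
      have h0 : 0 ≤ strip h (x 1) := Int.floor_nonneg.2 (div_nonneg (by linarith) hh.le)
      have hN' : strip h (x 1) < N := by
        by_contra! h'
        refine hx (hψtop x ?_).eq_of_nhds
        exact (level_mono hh.le h').trans ((strip_eq_iff hh).1 rfl).1
      obtain ⟨k, hk⟩ := Int.eq_ofNat_of_zero_le h0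
      rw [Finset.sum_eq_single k]
      · rw [indicator_of_mem (show x ∈ E k from hk)]
      · intro j _ hj
        refine indicator_of_notMem (fun h' => hj ?_) _
        have : strip h (x 1) = j := h'
        rw [hk] at this
        exact_mod_cast this.symm
      · intro h'
        exact absurd (Finset.mem_range.2 (by omega)) h'
  have hcell : ∀ j < N, InLattice (τ * (h * ε))
      (curlPairing Q (stackField h N Rm Rp A) ((E j).indicator ψ)) := by
    intro j hj
    refine inLattice_stack_of_cell hh hAQ hA hj ((tE j).of_tsupport_subset fun x hx => ?_) (tE j) ?_
    · by_contra h'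
      refine (notMem_tsupport_iff_eventuallyEq.2 ?_) hx
      have hψ0 : ψ =ᶠ[𝓝 x] 0 → (E j).indicator ψ =ᶠ[𝓝 x] 0 := by
        intro h1
        filter_upwards [h1] with y hy
        simp [indicator, hy]
      rw [mem_ofPred_eq, toUnit_mem_square hh] at h'
      by_cases h0 : 3 * δ * h ≤ |x 0|
      · exact hψ0 (hψout x h0)
      by_cases hx' : x ∈ {x : Plane | x 1 = level h j ∨ x 1 = level h (j + 1 : ℕ)}
      · rcases hx' with h1 | h1
        · exact hψ0 (hψseg x j h1)
        · exact hψ0 (hψseg x (j + 1) h1)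
      · filter_upwards [hEint j x hx'] with y hy
        refine indicator_of_notMem (fun hy' => h' ?_) _
        obtain ⟨h1, h2⟩ := (strip_eq_iff hh).1 (hy.1 hy')
        simp only [mem_ofPred_eq, not_or] at hx'
        exact ⟨by nlinarith, lt_of_le_of_ne h1 (Ne.symm hx'.1), h2⟩
    · intro x hx
      have hxQ : toUnit h j x ∈ square (1 / 2) := by
        obtain ⟨C, -, rfl⟩ := hA.relClosed
        exact hx.1
      rw [toUnit_mem_square hh] at hxQ
      have hxS := hS _ hx
      rw [toUnit_zero, abs_div, abs_of_pos hh, div_le_iff₀ hh] at hxS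
      have hx2 := abs_le.1 hxS
      have hE : x ∈ E j := (strip_eq_iff hh).2 ⟨hxQ.2.1.le, hxQ.2.2⟩
      have hx' : x ∉ {x : Plane | x 1 = level h j ∨ x 1 = level h (j + 1 : ℕ)} := by
        rintro (h1 | h1)
        · exact hxQ.2.1.ne' h1
        · push_cast at h1
          exact hxQ.2.2.ne h1
      have hint : ∃ n : ℤ, φ =ᶠ[𝓝 x] fun _ => (n : ℝ) := by
        by_cases hxq : x ∈ Q
        · exact hi x ⟨hxq, Or.inl (mem_biUnion (x := j) (by simpa using hj) (subset_closure hx))⟩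
        · exact ⟨0, (hφ.eventually_eq_zero hxq).trans (by simp; rfl)⟩
      obtain ⟨n, hn⟩ := hint
      refine ⟨n, ?_⟩
      filter_upwards [hn, hEint j x hx', (hc0 x).eventually (hg.eventually_one _ hx2.2),
        (hc0 x).neg.eventually (hg.eventually_one (-x 0) (by linarith))] with y h1 h2 h3 h4
      rw [indicator_of_mem (h2.2 hE)]
      simp [hψ, h1, h3, h4]
  rw [hsum, curlPairing_add hL1 (tp.add tm) tψ, curlPairing_add hL1 tp tm, hp, hm, add_zero,
    zero_add, hsplit, curlPairing_sum hL1 _ fun j _ => tE j]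
  exact InLattice.sum _ fun j hj => hcell j (Finset.mem_range.1 hj)

/-- The stacked field becomes admissible after a suitable choice of the phases, which are adjusted
by a shear to the right of the stack. -/
theorem exists_admissible_stack (hh : 0 < h) (hh1 : h ≤ 1) (hδ : 0 < δ) (hδ' : δ < 1 / 8)
    (hτε : 0 < τ * (h * ε)) (hN : 1 < ((N + 1 : ℕ) : ℝ) * h)
    (hAQ : ∀ x ∉ square (1 / 2), A x = interfaceField Rm Rp x)
    (hAδ : ∀ x : Plane, 2 * δ ≤ |x 0| → A x = interfaceField Rm Rp x)
    (hS : ∀ x ∈ S, |x 0| ≤ 2 * δ)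
    (hA : Admissible τ ε (square (1 / 2)) A S) {g θ : ℝ → ℝ}
    (hg : IsCutoff g θ (2 * δ * h) (3 * δ * h)) :
    ∃ e : ℤ → Fin 2 → ℝ, (∀ i k, 0 ≤ e i k ∧ e i k < τ * (h * ε)) ∧
      Admissible τ (h * ε) (square (1 / 2))
        (stackField h N Rm Rp A - shearField θ fun x => e (strip h (x 1)))
        (square (1 / 2) ∩ stackClosed h N δ S) := by
  have hδh : 0 < δ * h := by positivity
  have hδh1 : δ * h ≤ δ := mul_le_of_le_one_right hδ.le hh1
  have hab : 2 * δ * h ≤ 3 * δ * h := by nlinarith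
  have hL1 := isL1_stackField (N := N) hh hAQ hA.integrable
  have hmem : ∀ s, |s| ≤ 3 * δ * h → ∀ i : ℕ, |level h i| < 1 / 2 →
      pt (s, level h i) ∈ square (1 / 2) ∩ stackClosed h N δ S := fun s hs i hl =>
    ⟨⟨by simp only [pt_zero]; nlinarith, hl⟩,
      mem_stackClosed_of_segment hh (Int.natCast_nonneg i) hs rfl⟩
  obtain ⟨e, he, hlat⟩ := exists_shear_inLattice hτε hL1 hh hN.le hab (hg.isDensity hab)
    (S := square (1 / 2) ∩ stackClosed h N δ S)
    (fun s hs i hl => hmem s (abs_le.2 ⟨by nlinarith [hs.1], hs.2⟩) i hl)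
    fun φ hφ hi hz => inLattice_stack_of_eq_zero hh hδ hδ' hAQ hAδ hS hA hg hφ hi
      fun s hs i => by
        by_cases hl : |level h i| < 1 / 2
        · have hpt : Continuous fun s : ℝ => pt (s, level h i) := by
            unfold pt
            fun_prop
          have hpre : IsPreconnected ((fun s => pt (s, level h i)) '' Icc (-(3 * δ * h)) (3 * δ * h)) :=
            isPreconnected_Icc.image _ hpt.continuousOn
          have hb : 3 * δ * h ∈ Icc (-(3 * δ * h)) (3 * δ * h) := ⟨by nlinarith, le_rfl⟩
          rw [← hz (3 * δ * h) ⟨hab, le_rfl⟩ i]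
          refine (hi.mono ?_).eq_of_isPreconnected hpre ⟨s, abs_le.1 hs, rfl⟩ ⟨_, hb, rfl⟩
          rintro _ ⟨u, hu, rfl⟩
          exact hmem u (abs_le.2 hu) i hl
        · exact hφ.eq_zero fun h' => hl h'.2
  exact ⟨e, he, Admissible.of_inLattice (isOpen_square _) (hL1.sub
    (isL1_shearField (hg.isDensity hab) (integrableOn_strip he (volume_square_lt_top _))))
    ⟨_, isClosed_stackClosed, rfl⟩ hlat⟩

end Stack

/-! ### The energy of the stack -/

section StackEnergy

variable {lam τ ε δ h : ℝ} {A : Plane → Mat} {S : Set Plane} {Rm Rp : Mat} {N : ℕ}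

theorem measurableSet_rect (a b c d : ℝ) : MeasurableSet (rect a b c d) :=
  ((measurable_coord 0) measurableSet_Ioo).inter ((measurable_coord 1) measurableSet_Ioo)

theorem interfaceField_mem (hRm : Rm ∈ SO2) (hRp : Rp ∈ SO2) (x : Plane) :
    interfaceField Rm Rp x ∈ SO2 := by
  unfold interfaceField
  split_ifs
  exacts [hRm, hRp]

theorem dist_toUnit (hh : 0 < h) (j : ℤ) (x y : Plane) :
    dist (toUnit h j x) (toUnit h j y) = h⁻¹ * dist x y := by
  rw [toUnit, dist_homothety, abs_of_pos (inv_pos.2 hh)]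

theorem shearField_eq_zero {θ : ℝ → ℝ} {v : Plane → Fin 2 → ℝ} {x : Plane} (hx : θ (x 0) = 0) :
    shearField θ v x = 0 := by
  ext i j
  simp [shearField, hx]

theorem frobNorm_shearField_sq_le {θ : ℝ → ℝ} {v : Plane → Fin 2 → ℝ} {Θ c : ℝ}
    (hθ : ∀ s, |θ s| ≤ Θ) (hv : ∀ x k, 0 ≤ v x k ∧ v x k < c) (x : Plane) :
    frobNorm (shearField θ v x) ^ 2 ≤ 2 * Θ ^ 2 * c ^ 2 := by
  have h1 : ∀ k, (θ (x 0) * v x k) ^ 2 ≤ Θ ^ 2 * c ^ 2 := fun k => by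
    rw [mul_pow]
    exact mul_le_mul (sq_le_sq' (abs_le.1 (hθ _)).1 (abs_le.1 (hθ _)).2)
      (pow_le_pow_left₀ (hv x k).1 (hv x k).2.le 2) (sq_nonneg _) (sq_nonneg _)
  rw [frobNorm_sq]
  simp only [Fin.sum_univ_two, shearField, if_true, one_ne_zero, if_false]
  linarith [h1 0, h1 1]

/-- Integrals of functions that are controlled in the cells of the stack by a rescaled function and
in the column of the shear by a constant. -/
theorem lintegral_stack_le (hh : 0 < h) {Φ ψ : Plane → ℝ≥0∞} {E Z : Set Plane} {c : ℝ≥0∞}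
    (hE : MeasurableSet E) (hZ : MeasurableSet Z)
    (h1 : ∀ x ∈ rect (2 * δ * h) (3 * δ * h) (-1 / 2) (1 / 2), Φ x ≤ c)
    (h2 : ∀ j < N, ∀ x : Plane, |x 0| < 2 * δ * h → toUnit h j x ∈ E → Φ x ≤ ψ (toUnit h j x))
    (h3 : ∀ x ∈ Z, Φ x ≠ 0 → x ∈ rect (2 * δ * h) (3 * δ * h) (-1 / 2) (1 / 2) ∨
      (|x 0| < 2 * δ * h ∧ ∃ j < N, toUnit h j x ∈ E)) :
    ∫⁻ x in Z, Φ x ≤ ENNReal.ofReal (N * h ^ 2) * (∫⁻ x in E, ψ x) +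
      c * ENNReal.ofReal (δ * h) := by
  set C := rect (2 * δ * h) (3 * δ * h) (-1 / 2) (1 / 2) with hC
  set M : ℕ → Set Plane := fun j => {x | toUnit h j x ∈ E} ∩ {x | |x 0| < 2 * δ * h} with hM
  have hm0 : MeasurableSet {x : Plane | |x 0| < 2 * δ * h} :=
    measurableSet_lt (measurable_coord 0).abs measurable_const
  have hmE : ∀ j : ℕ, MeasurableSet {x : Plane | toUnit h j x ∈ E} := fun j =>
    measurable_homothety hE
  have hM1 : ∀ j < N, ∫⁻ x in M j, Φ x ≤ ENNReal.ofReal (h ^ 2) * ∫⁻ x in E, ψ x := fun j hj => by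
    rw [← lintegral_toUnit hh j hE]
    refine (setLIntegral_mono' ((hmE j).inter hm0) (g := fun x => ψ (toUnit h j x))
      fun x hx => h2 j hj x hx.2 hx.1).trans (lintegral_mono_set inter_subset_left)
  have hC1 : ∫⁻ x in C, Φ x ≤ c * ENNReal.ofReal (δ * h) := by
    refine (setLIntegral_mono' (measurableSet_rect _ _ _ _) h1).trans_eq ?_
    rw [setLIntegral_const, volume_rect]
    congr 1
    rw [show (1 : ℝ) / 2 - -1 / 2 = 1 by norm_num, ENNReal.ofReal_one, mul_one]
    congr 1
    ring
  have hind : ∀ x, Z.indicator Φ x ≤ (C ∪ ⋃ j ∈ Finset.range N, M j).indicator Φ x := by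
    intro x
    by_cases hx : x ∈ Z ∧ Φ x ≠ 0
    · rw [indicator_of_mem hx.1, indicator_of_mem]
      rcases h3 x hx.1 hx.2 with h' | ⟨h0, j, hj, h'⟩
      · exact Or.inl h'
      · exact Or.inr (mem_biUnion (x := j) (by simpa using hj) ⟨h', h0⟩)
    · rw [not_and_or, not_not] at hx
      rcases hx with hx | hx
      · simp [hx]
      · simp [indicator, hx]
  calc ∫⁻ x in Z, Φ x = ∫⁻ x, Z.indicator Φ x := (lintegral_indicator hZ _).symm
    _ ≤ ∫⁻ x, (C ∪ ⋃ j ∈ Finset.range N, M j).indicator Φ x := lintegral_mono hind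
    _ ≤ ∫⁻ x in C ∪ ⋃ j ∈ Finset.range N, M j, Φ x := lintegral_indicator_le _ _
    _ ≤ (∫⁻ x in C, Φ x) + ∫⁻ x in ⋃ j ∈ Finset.range N, M j, Φ x := lintegral_union_le _ _ _
    _ ≤ c * ENNReal.ofReal (δ * h) + ∑ j ∈ Finset.range N, ∫⁻ x in M j, Φ x := by
      refine add_le_add hC1 ?_
      rw [← Finset.sum_coe_sort]
      refine (lintegral_mono' (Measure.restrict_mono (iUnion₂_subset fun j hj =>
        subset_iUnion (fun i : Finset.range N => M i) ⟨j, hj⟩) le_rfl) le_rfl).trans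
          ((lintegral_iUnion_le (fun j : Finset.range N => M j) Φ).trans ?_)
      rw [tsum_fintype]
    _ ≤ c * ENNReal.ofReal (δ * h) +
        ∑ j ∈ Finset.range N, ENNReal.ofReal (h ^ 2) * ∫⁻ x in E, ψ x :=
      add_le_add le_rfl (Finset.sum_le_sum fun j hj => hM1 j (Finset.mem_range.1 hj))
    _ = _ := by
      rw [Finset.sum_const, Finset.card_range, nsmul_eq_mul, ENNReal.ofReal_mul N.cast_nonneg,
        ENNReal.ofReal_natCast, mul_assoc, add_comm]

theorem level_zero : level h 0 = -1 / 2 := by simp [level]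

theorem level_natCast_le (hN : N * h ≤ 1) : level h N ≤ 1 / 2 := by
  simp only [level, Int.cast_natCast]
  linarith

/-- The cells of the stack lie in the unit square. -/
theorem mem_square_of_toUnit_mem (hh : 0 < h) (hh1 : h ≤ 1) (hN : N * h ≤ 1) {j : ℕ} (hj : j < N)
    {x : Plane} (hx : toUnit h j x ∈ square (1 / 2)) : x ∈ square (1 / 2) := by
  rw [toUnit_mem_square hh] at hx
  have h0 : level h 0 ≤ level h j := level_mono hh.le (Int.natCast_nonneg j)
  have h1 : level h (j + 1) ≤ level h N := level_mono hh.le (by exact_mod_cast hj)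
  have h2 := level_natCast_le hN
  rw [level_zero] at h0
  exact ⟨by linarith [hx.1], abs_lt.2 ⟨by linarith [hx.2.1], by linarith [hx.2.2]⟩⟩

/-- A point of the central column outside of the core of the stack lies in a cell, and it is
mapped outside of the original core. -/
theorem exists_toUnit_mem_diff (hh : 0 < h) (hh1 : h ≤ 1) (hδ : 0 < δ) (hδ' : δ < 1 / 8)
    (hr : 0 < lam * ε) (hN : N * h ≤ 1) (hSQ : S ⊆ square (1 / 2)) {x : Plane}
    (hx : x ∈ square (1 / 2) \ nbhd (square (1 / 2)) (lam * (h * ε))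
      (square (1 / 2) ∩ stackClosed h N δ S)) (h0 : |x 0| < 2 * δ * h) :
    ∃ j < N, toUnit h j x ∈ square (1 / 2) \ nbhd (square (1 / 2)) (lam * ε) S := by
  obtain ⟨hxQ, hxn⟩ := hx
  have hρ : 0 < lam * (h * ε) := by
    rw [mul_left_comm]
    positivity
  have hxS : x ∉ stackClosed h N δ S := fun h' =>
    hxn (mem_nbhd.2 ⟨hxQ, x, ⟨hxQ, h'⟩, by simpa using hρ⟩)
  have hδh : 0 < δ * h := by positivity
  have hx1 := abs_lt.1 hxQ.2
  have hs0 : 0 ≤ strip h (x 1) := Int.floor_nonneg.2 (div_nonneg (by linarith) hh.le)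
  obtain ⟨k, hk⟩ := Int.eq_ofNat_of_zero_le hs0
  have hk' := (strip_eq_iff hh).1 hk
  have h3 : |x 0| ≤ 3 * δ * h := by nlinarith
  have hkN : k < N := by
    by_contra! h'
    exact hxS (Or.inr ⟨h3, Or.inr ((level_mono hh.le (by exact_mod_cast h')).trans hk'.1)⟩)
  have hne : level h k ≠ x 1 := fun h' =>
    hxS (mem_stackClosed_of_segment hh (Int.natCast_nonneg k) h3 h'.symm)
  refine ⟨k, hkN, (toUnit_mem_square hh).2 ⟨by nlinarith, lt_of_le_of_ne hk'.1 hne, hk'.2⟩, ?_⟩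
  intro h'
  obtain ⟨-, s, hs, hd⟩ := mem_nbhd.1 h'
  refine hxn (mem_nbhd.2 ⟨hxQ, ofUnit h k s, ⟨?_, Or.inl (mem_biUnion (x := k) (by simpa using hkN) ?_)⟩,
    ?_⟩)
  · exact mem_square_of_toUnit_mem hh hh1 hN hkN (by rw [toUnit_ofUnit hh]; exact hSQ hs)
  · rw [mem_ofPred_eq, toUnit_ofUnit hh]
    exact subset_closure hs
  · rw [← toUnit_ofUnit hh k s, dist_toUnit hh, inv_mul_lt_iff₀ hh] at hd
    exact hd.trans_eq (by ring)

/-- The core of the stack consists of rescaled copies of the original core and of neighbourhoods of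
the segments and of the remaining rectangle. -/
theorem nbhd_stackClosed_subset (hh : 0 < h) (hδ : 0 < δ) (hδ' : δ < 1 / 8)
    (hr' : lam * ε ≤ δ) (hSQ : S ⊆ square (1 / 2)) (hS : ∀ x ∈ S, |x 0| ≤ 2 * δ) :
    nbhd (square (1 / 2)) (lam * (h * ε)) (square (1 / 2) ∩ stackClosed h N δ S) ⊆
      (⋃ j ∈ Finset.range N, {x | toUnit h j x ∈ nbhd (square (1 / 2)) (lam * ε) S}) ∪
      ((⋃ j ∈ Finset.range (N + 1), rect (-(4 * δ * h)) (4 * δ * h) (level h j - lam * (h * ε))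
        (level h j + lam * (h * ε))) ∪
        rect (-(4 * δ * h)) (4 * δ * h) (level h N - lam * (h * ε)) (1 / 2)) := by
  intro x hx
  obtain ⟨hxQ, s, ⟨-, hs⟩, hd⟩ := mem_nbhd.1 hx
  have hδh : 0 < δ * h := by positivity
  have hρ : lam * (h * ε) ≤ δ * h := by
    rw [mul_left_comm, mul_comm]
    exact mul_le_mul_of_nonneg_right hr' hh.le
  have hx1 := abs_lt.1 hxQ.2
  rcases hs with hs | ⟨h0, hs⟩
  · simp only [mem_iUnion, mem_ofPred_eq, Finset.mem_range] at hs
    obtain ⟨j, hj, hs⟩ := hs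
    have hd' : dist (toUnit h j x) (toUnit h j s) < lam * ε := by
      rw [dist_toUnit hh, inv_mul_lt_iff₀ hh]
      exact hd.trans_eq (by ring)
    obtain ⟨t, ht, hts⟩ := Metric.mem_closure_iff.1 hs _ (sub_pos.2 hd')
    have hxt : dist (toUnit h j x) t < lam * ε := by
      linarith [dist_triangle (toUnit h j x) (toUnit h j s) t]
    by_cases hxc : toUnit h j x ∈ square (1 / 2)
    · exact Or.inl (mem_biUnion (x := j) (by simpa using hj) (mem_nbhd.2 ⟨hxc, t, ht, hxt⟩))
    have hxt' : dist x (ofUnit h j t) < lam * (h * ε) := by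
      rw [← toUnit_ofUnit hh j t, dist_toUnit hh, inv_mul_lt_iff₀ hh] at hxt
      exact hxt.trans_eq (by ring)
    have e0 := abs_lt.1 (abs_coord_sub_lt hxt' 0)
    have e1 := abs_lt.1 (abs_coord_sub_lt hxt' 1)
    have ht0 := abs_le.1 (hS t ht)
    have htc : toUnit h j (ofUnit h j t) ∈ square (1 / 2) := by
      rw [toUnit_ofUnit hh]
      exact hSQ ht
    rw [toUnit_mem_square hh] at hxc htc
    rw [ofUnit_zero] at e0
    have b1 : h * t 0 ≤ h * (2 * δ) := mul_le_mul_of_nonneg_left ht0.2 hh.le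
    have b2 : h * -(2 * δ) ≤ h * t 0 := mul_le_mul_of_nonneg_left ht0.1 hh.le
    have hx0 : |x 0| < 3 * δ * h := abs_lt.2 ⟨by nlinarith, by nlinarith⟩
    have hx0' := abs_lt.1 hx0
    have hx0h : |x 0| < h / 2 := by nlinarith
    refine Or.inr (Or.inl ?_)
    by_cases hlow : level h j < x 1
    · have hup : level h (j + 1) ≤ x 1 := by
        by_contra! h'
        exact hxc ⟨hx0h, hlow, h'⟩
      refine mem_biUnion (x := j + 1) (by simpa using hj)
        ⟨⟨by linarith, by linarith⟩, ⟨?_, ?_⟩⟩ <;> push_cast <;> linarith [htc.2.1, htc.2.2]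
    · push Not at hlow
      exact mem_biUnion (x := j) (by simp; omega)
        ⟨⟨by linarith, by linarith⟩, ⟨by linarith [htc.2.1], by linarith [htc.2.1]⟩⟩
  · have e0 := abs_lt.1 (abs_coord_sub_lt hd 0)
    have e1 := abs_lt.1 (abs_coord_sub_lt hd 1)
    have h0' : -(3 * δ * h) ≤ s 0 ∧ s 0 ≤ 3 * δ * h := abs_le.1 h0
    have hx0 : x 0 ∈ Ioo (-(4 * δ * h)) (4 * δ * h) := ⟨by linarith, by linarith⟩
    rcases hs with hs | hs
    · simp only [mem_iUnion, mem_ofPred_eq, Finset.mem_range] at hs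
      obtain ⟨j, hj, hs⟩ := hs
      exact Or.inr (Or.inl (mem_biUnion (x := j) (by simp; omega)
        ⟨hx0, ⟨by linarith, by linarith⟩⟩))
    · have hs' : level h N ≤ s 1 := hs
      exact Or.inr (Or.inr ⟨hx0, ⟨by linarith, hx1.2⟩⟩)

end StackEnergy

section StackEnergy

variable {lam τ ε δ h : ℝ} {A : Plane → Mat} {S : Set Plane} {Rm Rp : Mat} {N : ℕ}

theorem volume_nbhd_stackClosed_le (hh : 0 < h) (hδ : 0 < δ) (hδ' : δ < 1 / 8) (hε : 0 ≤ lam * ε)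
    (hr' : lam * ε ≤ δ) (hSQ : S ⊆ square (1 / 2)) (hS : ∀ x ∈ S, |x 0| ≤ 2 * δ)
    (hN : 1 < ((N + 1 : ℕ) : ℝ) * h) (hN1 : N * h ≤ 1) (hh1 : h ≤ 1) :
    volume (nbhd (square (1 / 2)) (lam * (h * ε)) (square (1 / 2) ∩ stackClosed h N δ S)) ≤
      ENNReal.ofReal (N * h ^ 2) * volume (nbhd (square (1 / 2)) (lam * ε) S) +
        ENNReal.ofReal (h * (32 * lam * δ * ε + 16 * δ * h)) := by
  have hδh : 0 < δ * h := by positivity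
  have hρ : lam * (h * ε) ≤ δ * h := by
    rw [mul_left_comm, mul_comm]
    exact mul_le_mul_of_nonneg_right hr' hh.le
  have hρ0 : 0 ≤ lam * (h * ε) := by
    rw [mul_left_comm]
    positivity
  refine (measure_mono (nbhd_stackClosed_subset hh hδ hδ' hr' hSQ hS)).trans
    ((measure_union_le _ _).trans (add_le_add ?_ ((measure_union_le _ _).trans ?_)))
  · refine (measure_biUnion_finset_le _ _).trans_eq ?_
    have h1 : ∀ j : ℕ, volume {x | toUnit h j x ∈ nbhd (square (1 / 2)) (lam * ε) S} =
        ENNReal.ofReal (h ^ 2) * volume (nbhd (square (1 / 2)) (lam * ε) S) := fun j => by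
      have := lintegral_toUnit hh j (isOpen_nbhd (isOpen_square (1 / 2)) (S := S)
        (lam * ε)).measurableSet fun _ => 1
      rwa [setLIntegral_one, setLIntegral_one] at this
    simp_rw [h1]
    rw [Finset.sum_const, Finset.card_range, nsmul_eq_mul, ENNReal.ofReal_mul N.cast_nonneg,
      ENNReal.ofReal_natCast, mul_assoc]
  · have h1 : ∀ c d : ℝ, volume (rect (-(4 * δ * h)) (4 * δ * h) c d) =
        ENNReal.ofReal (8 * δ * h * (d - c)) := fun c d => by
      rw [volume_rect, ← ENNReal.ofReal_mul (by linarith)]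
      congr 1
      ring
    have h2 : ((N + 1 : ℕ) : ℝ) * h ≤ 2 := by
      push_cast
      linarith
    calc volume (⋃ j ∈ Finset.range (N + 1), rect (-(4 * δ * h)) (4 * δ * h)
          (level h j - lam * (h * ε)) (level h j + lam * (h * ε))) +
          volume (rect (-(4 * δ * h)) (4 * δ * h) (level h N - lam * (h * ε)) (1 / 2))
        ≤ ENNReal.ofReal ((N + 1 : ℕ) * (8 * δ * h * (2 * (lam * (h * ε))))) +
          ENNReal.ofReal (8 * δ * h * (h + δ * h)) := by
          refine add_le_add ?_ ?_
          · refine (measure_biUnion_finset_le _ _).trans_eq ?_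
            rw [ENNReal.ofReal_mul (Nat.cast_nonneg _), ENNReal.ofReal_natCast,
              Finset.sum_congr rfl (g := fun _ =>
                ENNReal.ofReal (8 * δ * h * (2 * (lam * (h * ε))))), Finset.sum_const,
              Finset.card_range, nsmul_eq_mul]
            intro j _
            rw [h1]
            congr 1
            ring
          · rw [h1]
            refine ENNReal.ofReal_le_ofReal (mul_le_mul_of_nonneg_left ?_ (by positivity))
            simp only [level, Int.cast_natCast]
            push_cast at hN
            linarith
      _ ≤ _ := by
          rw [← ENNReal.ofReal_add (by positivity) (by positivity)]
          refine ENNReal.ofReal_le_ofReal ?_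
          have h3 : ((N + 1 : ℕ) : ℝ) * (8 * δ * h * (2 * (lam * (h * ε)))) ≤
              h * (32 * lam * δ * ε) := by
            have := mul_le_mul_of_nonneg_right h2
              (by positivity : 0 ≤ 16 * δ * (lam * (h * ε)))
            linarith
          have h4 : 8 * δ * h * (h + δ * h) ≤ h * (16 * δ * h) := by
            have : δ * h ≤ h := by nlinarith
            have := mul_le_mul_of_nonneg_left this (by positivity : 0 ≤ 8 * δ * h)
            linarith
          linarith

/-- An admissible pair that coincides with the interface away from the central column produces, by
stacking copies of size `h`, a pair that is admissible at the scale `h ε`, coincides with the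
interface outside of a column of width of order `h`, and has almost the same energy relative to its
scale. -/
theorem exists_stack (hlam : 0 < lam) (hτ : 0 < τ) : ∃ C : ℝ, 0 < C ∧
    ∀ (ε δ h : ℝ) (A : Plane → Mat) (S : Set Plane) (Rm Rp : Mat), 0 < ε → 0 < δ → δ < 1 / 8 →
      lam * ε ≤ δ → 0 < h → h ≤ 1 → Rm ∈ SO2 → Rp ∈ SO2 →
      Admissible τ ε (square (1 / 2)) A S →
      (∀ x ∉ square (1 / 2), A x = interfaceField Rm Rp x) →
      (∀ x : Plane, 2 * δ ≤ |x 0| → A x = interfaceField Rm Rp x) →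
      (∀ x ∈ S, |x 0| ≤ 2 * δ) →
      ∃ (A' : Plane → Mat) (S' : Set Plane), Admissible τ (h * ε) (square (1 / 2)) A' S' ∧
        (∀ x : Plane, 3 * δ * h ≤ |x 0| → A' x = interfaceField Rm Rp x) ∧
        pairEnergy lam (h * ε) (square (1 / 2)) A' S' (square (1 / 2)) ≤
          ENNReal.ofReal h * pairEnergy lam ε (square (1 / 2)) A S (square (1 / 2)) +
            ENNReal.ofReal (h * (C * ε ^ 2 / δ + C * δ * ε + 16 * δ * h)) ∧
        ∫⁻ x in square (1 / 2), ENNReal.ofReal (frobNorm (A' x - interfaceField Rm Rp x)) ≤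
          ENNReal.ofReal h * (∫⁻ x in square (1 / 2),
            ENNReal.ofReal (frobNorm (A x - interfaceField Rm Rp x))) +
            ENNReal.ofReal (h * (C * ε)) := by
  obtain ⟨C, hC, hcut⟩ := exists_isCutoff
  refine ⟨2 * C ^ 2 * τ ^ 2 + 32 * lam + 2 * C * τ, by positivity, ?_⟩
  intro ε δ h A S Rm Rp hε hδ hδ' hr' hh hh1 hRm hRp hA hAQ hAδ hS
  have hr : 0 < lam * ε := by positivity
  have hδh : 0 < δ * h := by positivity
  have hSQ : S ⊆ square (1 / 2) := by
    obtain ⟨K, -, rfl⟩ := hA.relClosed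
    exact inter_subset_left
  obtain ⟨N, hN, hN1⟩ : ∃ N : ℕ, 1 < ((N + 1 : ℕ) : ℝ) * h ∧ N * h ≤ 1 := by
    refine ⟨⌊1 / h⌋₊, ?_, ?_⟩
    · have := Nat.lt_floor_add_one (1 / h)
      rw [div_lt_iff₀ hh] at this
      exact_mod_cast this
    · exact (le_div_iff₀ hh).1 (Nat.floor_le (by positivity))
  have hNh : ENNReal.ofReal (N * h ^ 2) ≤ ENNReal.ofReal h :=
    ENNReal.ofReal_le_ofReal (by nlinarith)
  obtain ⟨g, θ, hg, hθ⟩ := hcut (2 * δ * h) (3 * δ * h) (by nlinarith)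
  rw [show 3 * δ * h - 2 * δ * h = δ * h by ring] at hθ
  have hab : 2 * δ * h ≤ 3 * δ * h := by nlinarith
  have hθ0 : ∀ s, s ∉ Ioo (2 * δ * h) (3 * δ * h) → θ s = 0 := fun s hs => by
    by_contra h'
    exact hs ((hg.isDensity hab).mem s h')
  obtain ⟨e, he, hadm⟩ := exists_admissible_stack hh hh1 hδ hδ' (by positivity) hN hAQ hAδ hS hA hg
  set v : Plane → Fin 2 → ℝ := fun x => e (strip h (x 1)) with hv
  have hsh := frobNorm_shearField_sq_le (v := v) hθ fun x k => he (strip h (x 1)) k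
  set Q := square (1 / 2) with hQ
  set F := stackField h N Rm Rp A - shearField θ v with hF
  set S' := Q ∩ stackClosed h N δ S with hS'
  have hF0 : ∀ x : Plane, 2 * δ * h ≤ |x 0| →
      F x = interfaceField Rm Rp x - shearField θ v x := fun x hx => by
    rw [hF, Pi.sub_apply, stackField_of_le hh hAδ hx]
  have hF1 : ∀ x : Plane, |x 0| < 2 * δ * h → F x = stackField h N Rm Rp A x := fun x hx => by
    rw [hF, Pi.sub_apply, shearField_eq_zero (hθ0 _ fun h' => ?_), sub_zero]
    exact (h'.1.trans_le (le_abs_self _)).not_gt hx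
  have hFI : ∀ x ∈ Q, 2 * δ * h ≤ |x 0| → x ∉ rect (2 * δ * h) (3 * δ * h) (-1 / 2) (1 / 2) →
      F x = interfaceField Rm Rp x := fun x hx h0 h1 => by
    rw [hF0 x h0, shearField_eq_zero (hθ0 _ fun h' => h1 ⟨h', ?_⟩), sub_zero]
    have := abs_lt.1 hx.2
    exact ⟨by linarith, this.2⟩
  have hFc : ∀ j < N, ∀ x : Plane, |x 0| < 2 * δ * h → toUnit h j x ∈ Q →
      F x = A (toUnit h j x) := fun j hj x h0 hx => by
    rw [hF1 x h0, stackField_of_toUnit_mem hh hAQ hj hx]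
  have hrect : ∀ x ∈ rect (2 * δ * h) (3 * δ * h) (-1 / 2) (1 / 2), 2 * δ * h ≤ |x 0| :=
    fun x hx => hx.1.1.le.trans (le_abs_self _)
  have hEm := measurableSet_square_diff_nbhd (1 / 2) (lam * ε) S
  have hEm' := measurableSet_square_diff_nbhd (1 / 2) (lam * (h * ε)) S'
  refine ⟨F, S', hadm, ?_, ?_, ?_⟩
  · intro x hx
    rw [hF0 x (by linarith), shearField_eq_zero (hθ0 _ fun h' => ?_), sub_zero]
    have h2 : 0 < x 0 := lt_trans (by positivity) h'.1
    rw [abs_of_pos h2] at hx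
    exact h'.2.not_ge hx
  · have hel : elasticEnergy lam (h * ε) Q F S' Q ≤
        ENNReal.ofReal (N * h ^ 2) * elasticEnergy lam ε Q A S Q +
        ENNReal.ofReal (2 * (C / (δ * h)) ^ 2 * (τ * (h * ε)) ^ 2) * ENNReal.ofReal (δ * h) := by
      refine lintegral_stack_le hh (ψ := fun x => ENNReal.ofReal (distSO2 (A x) ^ 2)) hEm hEm'
        ?_ ?_ ?_
      · intro x hx
        refine ENNReal.ofReal_le_ofReal (le_trans (pow_le_pow_left₀ (distSO2_nonneg _)
          (distSO2_le (interfaceField_mem hRm hRp x)) 2) ?_)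
        rw [hF0 x (hrect x hx), sub_sub_cancel_left, frobNorm_neg]
        exact hsh x
      · intro j hj x h0 hx
        rw [hFc j hj x h0 hx.1]
      · intro x hx hne
        by_cases h0 : |x 0| < 2 * δ * h
        · exact Or.inr ⟨h0, exists_toUnit_mem_diff hh hh1 hδ hδ' hr hN1 hSQ hx h0⟩
        · refine Or.inl ?_
          by_contra h1
          refine hne ?_
          rw [hFI x hx.1 (not_lt.1 h0) h1, distSO2_of_mem (interfaceField_mem hRm hRp x)]
          simp
    have hco : coreEnergy lam (h * ε) Q S' Q ≤ ENNReal.ofReal (N * h ^ 2) *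
        coreEnergy lam ε Q S Q + ENNReal.ofReal (h * (32 * lam * δ * ε + 16 * δ * h)) := by
      unfold coreEnergy
      have hI : ∀ (ρ : ℝ) (T : Set Plane), nbhd Q ρ T ∩ Q = nbhd Q ρ T := fun ρ T =>
        inter_eq_left.2 fun x hx => hx.1
      rw [hI, hI]
      exact volume_nbhd_stackClosed_le hh hδ hδ' hr.le hr' hSQ hS hN hN1 hh1
    unfold pairEnergy
    refine (add_le_add hel hco).trans ?_
    rw [add_add_add_comm, ← mul_add, ← ENNReal.ofReal_mul (by positivity),
      ← ENNReal.ofReal_add (by positivity) (by positivity)]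
    refine add_le_add (mul_le_mul_left hNh _) (ENNReal.ofReal_le_ofReal ?_)
    have e1 : 2 * (C / (δ * h)) ^ 2 * (τ * (h * ε)) ^ 2 * (δ * h) =
        h * (2 * C ^ 2 * τ ^ 2 * ε ^ 2 / δ) := by
      field_simp
    have e2 : (2 * C ^ 2 * τ ^ 2 + 32 * lam + 2 * C * τ) * ε ^ 2 / δ ≥
        2 * C ^ 2 * τ ^ 2 * ε ^ 2 / δ := by
      gcongr
      linarith [(by positivity : 0 ≤ 32 * lam + 2 * C * τ)]
    have e3 : (2 * C ^ 2 * τ ^ 2 + 32 * lam + 2 * C * τ) * δ * ε ≥ 32 * lam * δ * ε := by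
      gcongr
      linarith [(by positivity : 0 ≤ 2 * C ^ 2 * τ ^ 2 + 2 * C * τ)]
    rw [e1, ← mul_add]
    exact mul_le_mul_of_nonneg_left (by linarith) hh.le
  · refine (lintegral_stack_le hh (N := N) (δ := δ)
      (ψ := fun x => ENNReal.ofReal (frobNorm (A x - interfaceField Rm Rp x)))
      (c := ENNReal.ofReal (2 * (C / (δ * h)) * (τ * (h * ε))))
      (measurableSet_square (1 / 2)) (measurableSet_square (1 / 2)) ?_ ?_ ?_).trans ?_
    · intro x hx
      refine ENNReal.ofReal_le_ofReal ?_
      rw [hF0 x (hrect x hx), sub_sub_cancel_left, frobNorm_neg]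
      refine abs_le_of_sq_le_sq' ((hsh x).trans ?_) (by positivity) |>.2
      rw [mul_pow, mul_pow]
      have : 0 ≤ (C / (δ * h)) ^ 2 * (τ * (h * ε)) ^ 2 := by positivity
      linarith
    · intro j hj x h0 hx
      rw [hFc j hj x h0 hx, interfaceField_toUnit hh]
    · intro x hx hne
      by_cases h0 : |x 0| < 2 * δ * h
      · refine Or.inr ⟨h0, ?_⟩
        by_contra! h'
        refine hne ?_
        have h2 : stackField h N Rm Rp A x = interfaceField Rm Rp x := by
          rw [stackField, Finset.sum_eq_zero, add_zero]
          intro j hj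
          rw [hAQ _ (h' j (Finset.mem_range.1 hj)), sub_self]
        rw [hF1 x h0, h2, sub_self, frobNorm_zero, ENNReal.ofReal_zero]
      · refine Or.inl ?_
        by_contra h1
        refine hne ?_
        rw [hFI x hx (not_lt.1 h0) h1, sub_self, frobNorm_zero, ENNReal.ofReal_zero]
    · rw [← ENNReal.ofReal_mul (by positivity)]
      refine add_le_add (mul_le_mul_left hNh _) (ENNReal.ofReal_le_ofReal ?_)
      have e1 : 2 * (C / (δ * h)) * (τ * (h * ε)) * (δ * h) = h * (2 * C * τ * ε) := by
        field_simp
      rw [e1]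
      gcongr
      linarith [(by positivity : 0 ≤ 2 * C ^ 2 * τ ^ 2 + 32 * lam)]

end StackEnergy

/-! ### The flat interface as a competitor -/

section Competitors

variable {lam τ ε : ℝ} {A : Plane → Mat} {S : Set Plane} {Rm Rp : Mat}

/-- The whole domain is an admissible core for every integrable field. -/
theorem admissible_self {Ω : Set Plane} (hΩ : IsOpen Ω) (hA : IsL1 Ω A) : Admissible τ ε Ω A Ω := by
  refine Admissible.of_inLattice hΩ hA ⟨univ, isClosed_univ, by simp⟩ fun φ hφ hi => ?_
  rw [curlPairing_congr (B := fun _ => 0) fun x hx => ?_, curlPairing_const hφ]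
  · exact InLattice.zero _
  · exfalso
    by_cases hxΩ : x ∈ Ω
    · exact hx (perpGrad_eq_zero_of_eventuallyEq (hi.eventuallyEq hxΩ))
    · exact hx (perpGrad_eq_zero_of_eventuallyEq (c := 0) (hφ.eventually_eq_zero hxΩ))

theorem curlPairing_interfaceField {φ : Plane → ℝ} (hφ : IsTest (square (1 / 2)) φ)
    (hz : ∀ x : Plane, x 0 = 0 → φ =ᶠ[𝓝 x] 0) :
    curlPairing (square (1 / 2)) (interfaceField Rm Rp) φ = 0 := by
  have hc := continuous_coord 0
  set E : Set Plane := {x | x 0 < 0} with hE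
  have hEo : IsOpen E := isOpen_lt hc continuous_const
  have hfr : ∀ x ∈ frontier E, φ =ᶠ[𝓝 x] 0 := fun x hx =>
    hz x (frontier_lt_subset_eq hc continuous_const hx)
  have t1 : IsTest (square (1 / 2)) (E.indicator φ) := hφ.indicator hfr
  have t2 : IsTest (square (1 / 2)) (Eᶜ.indicator φ) := hφ.indicator (by rwa [frontier_compl])
  have hsum : φ = E.indicator φ + Eᶜ.indicator φ := (indicator_self_add_compl E φ).symm
  have h1 : curlPairing (square (1 / 2)) (interfaceField Rm Rp) (E.indicator φ) = 0 := by
    rw [curlPairing_congr (B := fun _ => Rm) fun x hx => ?_, curlPairing_const t1]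
    refine if_pos ?_
    by_contra! h'
    refine hx (perpGrad_eq_zero_of_eventuallyEq (c := 0) ?_)
    rcases h'.eq_or_lt with h0 | h0
    · filter_upwards [hz x h0.symm] with y hy
      simp [indicator, hy]
    · filter_upwards [(isOpen_lt continuous_const hc).mem_nhds h0] with y hy
      have hyE : y ∉ E := fun h'' => lt_asymm (show y 0 < 0 from h'') hy
      simp [hyE]
  have h2 : curlPairing (square (1 / 2)) (interfaceField Rm Rp) (Eᶜ.indicator φ) = 0 := by
    rw [curlPairing_congr (B := fun _ => Rp) fun x hx => ?_, curlPairing_const t2]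
    refine if_neg fun h' => hx (perpGrad_eq_zero_of_eventuallyEq (c := 0) ?_)
    filter_upwards [hEo.mem_nhds h'] with y hy
    have hyE : y ∉ Eᶜ := fun h'' => h'' hy
    simp only [indicator_of_notMem hyE]
  rw [hsum, curlPairing_add (isL1_interfaceField (volume_square_lt_top _)) t1 t2, h1, h2, add_zero]

/-- The interface is admissible with the line `{x₁ = 0}` as core: a test function that is locally
constant near this line vanishes there, since the line leaves the domain. -/
theorem admissible_interfaceField : Admissible τ ε (square (1 / 2)) (interfaceField Rm Rp)
    (square (1 / 2) ∩ {x | x 0 = 0}) := by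
  have hc := continuous_coord 0
  refine Admissible.of_inLattice (isOpen_square _)
    (isL1_interfaceField (volume_square_lt_top _)) ⟨_, isClosed_eq hc continuous_const, rfl⟩
    fun φ hφ hi => ?_
  rw [curlPairing_interfaceField hφ fun x hx => ?_]
  · exact InLattice.zero _
  have hT : IsPreconnected (range fun y : ℝ => pt (0, y)) :=
    isPreconnected_range (continuous_pt 0)
  have hTi : IsIntegerNear (range fun y : ℝ => pt (0, y)) φ := (hi.union_compl hφ).mono <| by
    rintro _ ⟨y, rfl⟩
    by_cases hyQ : pt (0, y) ∈ square (1 / 2)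
    · exact Or.inl ⟨hyQ, rfl⟩
    · exact Or.inr hyQ
  have hxT : x ∈ range fun y : ℝ => pt (0, y) := ⟨x 1, by rw [← hx]; exact pt_coord x⟩
  have h0 : φ (pt (0, 1)) = 0 := hφ.eq_zero fun h' => by
    have := h'.2
    rw [pt_one] at this
    norm_num at this
  have h1 := hTi.eventuallyEq hxT
  rwa [hTi.eq_of_isPreconnected hT hxT ⟨1, rfl⟩, h0] at h1

theorem volume_nbhd_line_le (hr : 0 ≤ lam * ε) :
    volume (nbhd (square (1 / 2)) (lam * ε) (square (1 / 2) ∩ {x | x 0 = 0})) ≤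
      ENNReal.ofReal (2 * lam * ε) := by
  have hsub : nbhd (square (1 / 2)) (lam * ε) (square (1 / 2) ∩ {x | x 0 = 0}) ⊆
      rect (-(lam * ε)) (lam * ε) (-1 / 2) (1 / 2) := by
    intro x hx
    obtain ⟨hxQ, s, ⟨-, hs⟩, hd⟩ := mem_nbhd.1 hx
    have h0 := abs_lt.1 (abs_coord_sub_lt hd 0)
    rw [show s 0 = 0 from hs, sub_zero] at h0
    have h1 := abs_lt.1 hxQ.2
    exact ⟨h0, ⟨by linarith, h1.2⟩⟩
  refine (measure_mono hsub).trans_eq ?_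
  rw [volume_rect, ← ENNReal.ofReal_mul (by linarith)]
  congr 1
  ring

theorem pairEnergy_interfaceField_le (hr : 0 ≤ lam * ε) (hRm : Rm ∈ SO2) (hRp : Rp ∈ SO2) :
    pairEnergy lam ε (square (1 / 2)) (interfaceField Rm Rp)
      (square (1 / 2) ∩ {x | x 0 = 0}) (square (1 / 2)) ≤ ENNReal.ofReal (2 * lam * ε) := by
  unfold pairEnergy elasticEnergy coreEnergy
  simp only [distSO2_of_mem (interfaceField_mem hRm hRp _), ne_eq, OfNat.ofNat_ne_zero,
    not_false_eq_true, zero_pow, ENNReal.ofReal_zero, lintegral_zero, zero_add]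
  exact (measure_mono inter_subset_left).trans (volume_nbhd_line_le hr)

/-- Cutting off the field in cores of vanishing area does not change its limit. -/
theorem TendstoL1.indicator_diff_nbhd {A : ℝ → Plane → Mat} {S : ℝ → Set Plane} (hRm : Rm ∈ SO2)
    (hRp : Rp ∈ SO2) (hA : TendstoL1 (square (1 / 2)) A (interfaceField Rm Rp))
    (hS : Tendsto (fun ε => volume (nbhd (square (1 / 2)) (lam * ε) (S ε))) (𝓝[>] 0) (𝓝 0)) :
    TendstoL1 (square (1 / 2))
      (fun ε => (square (1 / 2) \ nbhd (square (1 / 2)) (lam * ε) (S ε)).indicator (A ε))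
      (interfaceField Rm Rp) := by
  have hlim := hA.add (ENNReal.Tendsto.const_mul (a := 2) hS (Or.inr ENNReal.ofNat_ne_top))
  rw [mul_zero, add_zero] at hlim
  refine tendsto_of_tendsto_of_tendsto_of_le_of_le tendsto_const_nhds hlim (fun _ => zero_le)
    fun ε => ?_
  obtain ⟨Q, hQ⟩ : ∃ Q, Q = square (1 / 2) := ⟨_, rfl⟩
  have hm := measurableSet_square_diff_nbhd (1 / 2) (lam * ε) (S ε)
  rw [← hQ] at hm ⊢
  have hmn := (isOpen_nbhd (hQ ▸ isOpen_square (1 / 2) : IsOpen Q) (S := S ε) (lam * ε)).measurableSet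
  have hsub : Q ⊆ (Q \ nbhd Q (lam * ε) (S ε)) ∪ nbhd Q (lam * ε) (S ε) := fun x hx => by
    by_cases h : x ∈ nbhd Q (lam * ε) (S ε)
    exacts [Or.inr h, Or.inl ⟨hx, h⟩]
  refine (lintegral_mono_set hsub).trans ((lintegral_union_le _ _ _).trans (add_le_add ?_ ?_))
  · rw [setLIntegral_congr_fun hm (g := fun x =>
      ENNReal.ofReal (frobNorm (A ε x - interfaceField Rm Rp x))) fun x hx => by
        simp only [indicator_of_mem hx]]
    exact lintegral_mono_set Set.sdiff_subset
  · refine (setLIntegral_mono' hmn (g := fun _ => 2) fun x hx => ?_).trans_eq (setLIntegral_const _ _)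
    have hx' : x ∉ Q \ nbhd Q (lam * ε) (S ε) := fun h => h.2 hx
    simp only [indicator_of_notMem hx']
    rw [zero_sub, frobNorm_neg,
      frobNorm_of_mem (interfaceField_mem hRm hRp x), ← ENNReal.ofReal_ofNat]
    exact ENNReal.ofReal_le_ofReal (Real.sqrt_le_iff.2 (by norm_num))

theorem psiZero_lt_top (hlam : 0 < lam) (hRm : Rm ∈ SO2) (hRp : Rp ∈ SO2) :
    psiZero lam τ Rm Rp < ⊤ := by
  refine lt_of_le_of_lt ?_ (ENNReal.ofReal_lt_top (r := 2 * lam))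
  unfold psiZero psiZeroOn
  refine (iInf₂_le (fun _ => interfaceField Rm Rp)
    (fun _ => square (1 / 2) ∩ {x | x 0 = 0})).trans (iInf₂_le_of_le
      (fun ε _ => admissible_interfaceField) ?_ ?_)
  · refine TendstoL1.indicator_diff_nbhd hRm hRp ?_ ?_
    · simp [TendstoL1, frobNorm_zero]
    · have hlim : Tendsto (fun ε : ℝ => ENNReal.ofReal (2 * lam * ε)) (𝓝[>] 0) (𝓝 0) := by
        have : Tendsto (fun ε : ℝ => 2 * lam * ε) (𝓝[>] 0) (𝓝 (2 * lam * 0)) :=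
          (tendsto_id.const_mul _).mono_left nhdsWithin_le_nhds
        rw [mul_zero] at this
        simpa using ENNReal.tendsto_ofReal this
      refine tendsto_of_tendsto_of_tendsto_of_le_of_le' tendsto_const_nhds hlim
        (Eventually.of_forall fun _ => zero_le) ?_
      filter_upwards [self_mem_nhdsWithin] with ε hε
      exact volume_nbhd_line_le (mul_pos hlam hε).le
  · refine (liminf_le_liminf (v := fun _ => ENNReal.ofReal (2 * lam)) ?_).trans_eq (liminf_const _)
    filter_upwards [self_mem_nhdsWithin] with ε hε
    have hε : 0 < ε := hε
    refine (mul_le_mul_right (pairEnergy_interfaceField_le (mul_pos hlam hε).le hRm hRp) _).trans_eq ?_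
    rw [← ENNReal.ofReal_mul (by positivity)]
    congr 1
    field_simp

theorem lintegral_frobNorm_lt_top {Ω : Set Plane} (hA : IsL1 Ω A) :
    ∫⁻ x in Ω, ENNReal.ofReal (frobNorm (A x)) < ⊤ := by
  have h1 : IntegrableOn (fun x => ∑ i, ∑ j, |A x i j|) Ω :=
    integrable_finsetSum _ fun i _ => integrable_finsetSum _ fun j _ => (hA i j).abs
  refine lt_of_le_of_lt (lintegral_mono fun x => ?_) h1.lintegral_lt_top
  exact ENNReal.ofReal_le_ofReal (frobNorm_le_sum _)

end Competitors

/-! ### Lower bound, recovery fields and diagonal argument -/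

section Conclusion

variable {lam τ : ℝ} {Rm Rp : Mat}

theorem ofReal_mul_ofReal_inv_mul {ε : ℝ} (hε : 0 < ε) (P : ℝ≥0∞) :
    ENNReal.ofReal ε * (ENNReal.ofReal ε⁻¹ * P) = P := by
  rw [← mul_assoc, ← ENNReal.ofReal_mul hε.le, mul_inv_cancel₀ hε.ne', ENNReal.ofReal_one, one_mul]

theorem ofReal_inv_mul_ofReal_mul {ε : ℝ} (hε : 0 < ε) (P : ℝ≥0∞) :
    ENNReal.ofReal ε⁻¹ * (ENNReal.ofReal ε * P) = P := by
  simpa using ofReal_mul_ofReal_inv_mul (inv_pos.2 hε) P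

theorem tendsto_ofReal_nhdsGT : Tendsto (fun ε : ℝ => ENNReal.ofReal ε) (𝓝[>] 0) (𝓝 0) := by
  simpa using ENNReal.tendsto_ofReal
    ((tendsto_id (α := ℝ) (x := 𝓝 0)).mono_left nhdsWithin_le_nhds : Tendsto id (𝓝[>] (0 : ℝ)) _)

/-- The infimum in the definition of the energy of a field is attained up to an error `ε`. -/
theorem exists_admissible_le_fieldEnergy {ε : ℝ} (hε : 0 < ε) {Ω : Set Plane} (hΩ : IsOpen Ω)
    {A : Plane → Mat} (hA : IsL1 Ω A) : ∃ S, Admissible τ ε Ω A S ∧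
      ENNReal.ofReal ε⁻¹ * pairEnergy lam ε Ω A S Ω ≤
        fieldEnergy lam τ ε Ω A Ω + ENNReal.ofReal ε := by
  unfold fieldEnergy
  obtain ⟨m, hm⟩ : ∃ m, m = ⨅ (S : Set Plane) (_ : Admissible τ ε Ω A S),
    pairEnergy lam ε Ω A S Ω := ⟨_, rfl⟩
  rw [← hm]
  by_cases hmt : m = ⊤
  · refine ⟨Ω, admissible_self hΩ hA, ?_⟩
    rw [hmt, ENNReal.mul_top (by simpa using hε)]
    simp
  · have hlt : m < m + ENNReal.ofReal ε * ENNReal.ofReal ε :=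
      ENNReal.lt_add_right hmt (mul_ne_zero (by simpa using hε) (by simpa using hε))
    nth_rw 1 [hm] at hlt
    simp only [iInf_lt_iff] at hlt
    obtain ⟨S, hS, hlt⟩ := hlt
    refine ⟨S, hS, (mul_le_mul_right hlt.le _).trans_eq ?_⟩
    rw [mul_add, ofReal_inv_mul_ofReal_mul hε]

/-- For fields that converge to the interface, the upper bound of the energies by `ψ₀` implies their
convergence: almost optimal cores have vanishing area, so that the fields, cut off in these cores,
compete in the definition of `ψ₀`. -/
theorem tendsto_fieldEnergy (hlam : 0 < lam) (hRm : Rm ∈ SO2) (hRp : Rp ∈ SO2)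
    {A : ℝ → Plane → Mat} (hA : ∀ ε : ℝ, 0 < ε → IsL1 (square (1 / 2)) (A ε))
    (hlim : TendstoL1 (square (1 / 2)) A (interfaceField Rm Rp))
    (hup : ∀ κ : ℝ, 0 < κ → ∀ᶠ ε in 𝓝[>] 0,
      fieldEnergy lam τ ε (square (1 / 2)) (A ε) (square (1 / 2)) ≤
        psiZero lam τ Rm Rp + ENNReal.ofReal κ) :
    Tendsto (fun ε : ℝ => fieldEnergy lam τ ε (square (1 / 2)) (A ε) (square (1 / 2)))
      (𝓝[>] 0) (𝓝 (psiZero lam τ Rm Rp)) := by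
  have hfin : psiZero lam τ Rm Rp ≠ ⊤ := (psiZero_lt_top hlam hRm hRp).ne
  have hpos : ∀ᶠ ε : ℝ in 𝓝[>] 0, 0 < ε := self_mem_nhdsWithin
  have hS : ∀ ε : ℝ, ∃ S : Set Plane, 0 < ε → Admissible τ ε (square (1 / 2)) (A ε) S ∧
      ENNReal.ofReal ε⁻¹ * pairEnergy lam ε (square (1 / 2)) (A ε) S (square (1 / 2)) ≤
        fieldEnergy lam τ ε (square (1 / 2)) (A ε) (square (1 / 2)) + ENNReal.ofReal ε := fun ε => by
    by_cases hε : 0 < ε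
    · obtain ⟨S, hS⟩ := exists_admissible_le_fieldEnergy (lam := lam) (τ := τ) hε
        (isOpen_square _) (hA ε hε)
      exact ⟨S, fun _ => hS⟩
    · exact ⟨∅, fun h => absurd h hε⟩
  choose S hS using hS
  obtain ⟨G, hG⟩ : ∃ G : ℝ → ℝ≥0∞, G = fun ε => ENNReal.ofReal ε⁻¹ *
    pairEnergy lam ε (square (1 / 2)) (A ε) (S ε) (square (1 / 2)) := ⟨_, rfl⟩
  obtain ⟨F, hF⟩ : ∃ F : ℝ → ℝ≥0∞, F = fun ε =>
    fieldEnergy lam τ ε (square (1 / 2)) (A ε) (square (1 / 2)) := ⟨_, rfl⟩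
  obtain ⟨ψ, hψ⟩ : ∃ ψ, ψ = psiZero lam τ Rm Rp := ⟨_, rfl⟩
  have hFG : ∀ ε, 0 < ε → F ε ≤ G ε := fun ε hε => by
    rw [hF, hG]
    exact mul_le_mul_right (iInf₂_le _ (hS ε hε).1) _
  have hGF : ∀ ε, 0 < ε → G ε ≤ F ε + ENNReal.ofReal ε := fun ε hε => by
    rw [hF, hG]
    exact (hS ε hε).2
  have hupF : ∀ κ : ℝ, 0 < κ → ∀ᶠ ε in 𝓝[>] 0, F ε ≤ ψ + ENNReal.ofReal κ := by
    rw [hF, hψ]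
    exact hup
  rw [← hψ] at hfin
  rw [← hF, ← hψ]
  have hupG : ∀ κ : ℝ, 0 < κ → ∀ᶠ ε in 𝓝[>] 0, G ε ≤ ψ + ENNReal.ofReal κ := fun κ hκ => by
    have hκ2 : 0 < κ / 2 := by positivity
    filter_upwards [hupF (κ / 2) hκ2, hpos,
      tendsto_ofReal_nhdsGT.eventually
        (Iic_mem_nhds (show 0 < ENNReal.ofReal (κ / 2) by simpa using hκ))] with ε h1 h2 h3
    refine (hGF ε h2).trans ((add_le_add h1 h3).trans_eq ?_)
    rw [add_assoc, ← ENNReal.ofReal_add hκ2.le hκ2.le, add_halves]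
  have hvol : Tendsto (fun ε => volume (nbhd (square (1 / 2)) (lam * ε) (S ε))) (𝓝[>] 0) (𝓝 0) := by
    have h1 : Tendsto (fun ε : ℝ => ENNReal.ofReal ε * (ψ + ENNReal.ofReal 1)) (𝓝[>] 0) (𝓝 0) := by
      simpa using ENNReal.Tendsto.mul_const (b := ψ + ENNReal.ofReal 1) tendsto_ofReal_nhdsGT
        (Or.inr (by simp [hfin]))
    refine tendsto_of_tendsto_of_tendsto_of_le_of_le' tendsto_const_nhds h1
      (Eventually.of_forall fun _ => zero_le) ?_
    filter_upwards [hupG 1 one_pos, hpos] with ε h2 h3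
    refine le_trans ?_ (mul_le_mul_right h2 _)
    rw [hG]
    simp only
    rw [ofReal_mul_ofReal_inv_mul h3]
    refine le_trans (measure_mono fun x hx => ?_) le_add_self
    exact ⟨hx, hx.1⟩
  have hlow : ψ ≤ liminf G (𝓝[>] 0) := by
    rw [hψ, hG]
    unfold psiZero psiZeroOn
    exact iInf₂_le_of_le A S (iInf₂_le_of_le (fun ε hε => (hS ε hε).1)
      (hlim.indicator_diff_nbhd hRm hRp hvol) le_rfl)
  have hGlim : Tendsto G (𝓝[>] 0) (𝓝 ψ) := by
    refine tendsto_of_le_liminf_of_limsup_le hlow ?_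
    refine ENNReal.le_of_forall_pos_le_add fun κ hκ _ => ?_
    refine limsup_le_of_le (h := ?_)
    have := hupG κ hκ
    rwa [ENNReal.ofReal_coe_nnreal] at this
  have hsub : Tendsto (fun ε => G ε - ENNReal.ofReal ε) (𝓝[>] 0) (𝓝 ψ) := by
    simpa using ENNReal.Tendsto.sub hGlim tendsto_ofReal_nhdsGT (Or.inl hfin)
  refine tendsto_of_tendsto_of_tendsto_of_le_of_le' hsub hGlim ?_ ?_
  · filter_upwards [hpos] with ε hε
    exact tsub_le_iff_right.2 (hGF ε hε)
  · filter_upwards [hpos] with ε hε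
    exact hFG ε hε

/-- Diagonal selection: if for each tolerance there are good objects for all small `ε`, then some
choice of objects is good for every tolerance as `ε → 0⁺`. -/
theorem exists_diagonal {α : Type*} {P : ℝ → ℝ → α → Prop}
    (hmono : ∀ κ κ' ε a, κ ≤ κ' → P κ ε a → P κ' ε a)
    (h : ∀ κ : ℝ, 0 < κ → ∀ᶠ ε in 𝓝[>] 0, ∃ a, P κ ε a) (a₀ : α) :
    ∃ f : ℝ → α, (∀ ε, f ε = a₀ ∨ ∃ κ, P κ ε (f ε)) ∧
      ∀ κ : ℝ, 0 < κ → ∀ᶠ ε in 𝓝[>] 0, P κ ε (f ε) := by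
  classical
  let n : ℝ → ℕ := fun ε => Nat.findGreatest (fun n => ∃ a, P (1 / ((n : ℝ) + 1)) ε a) ⌊ε⁻¹⌋₊
  let f : ℝ → α := fun ε => if h : ∃ a, P (1 / ((n ε : ℝ) + 1)) ε a then h.choose else a₀
  have hf : ∀ ε, (∃ a, P (1 / ((n ε : ℝ) + 1)) ε a) → P (1 / ((n ε : ℝ) + 1)) ε (f ε) := by
    intro ε hε
    simp only [f, dif_pos hε]
    exact hε.choose_spec
  refine ⟨f, fun ε => ?_, fun κ hκ => ?_⟩
  · by_cases hε : ∃ a, P (1 / ((n ε : ℝ) + 1)) ε a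
    · exact Or.inr ⟨_, hf ε hε⟩
    · exact Or.inl (dif_neg hε)
  · obtain ⟨m, hm⟩ := exists_nat_one_div_lt hκ
    have hinv : ∀ᶠ ε : ℝ in 𝓝[>] 0, (m : ℝ) ≤ ε⁻¹ :=
      tendsto_inv_nhdsGT_zero.eventually_ge_atTop _
    filter_upwards [h _ (Nat.one_div_pos_of_nat (α := ℝ) (n := m)), hinv] with ε h1 h2
    have hle : m ≤ ⌊ε⁻¹⌋₊ := Nat.le_floor h2
    refine hmono _ _ _ _ (le_trans ?_ hm.le)
      (hf ε (Nat.findGreatest_spec (P := fun n => ∃ a, P (1 / ((n : ℝ) + 1)) ε a) hle h1))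
    exact Nat.one_div_le_one_div
      (Nat.le_findGreatest (P := fun n => ∃ a, P (1 / ((n : ℝ) + 1)) ε a) hle h1)

theorem tendsto_zero_of_eventually_le_ofReal {F : ℝ → ℝ≥0∞}
    (h : ∀ κ : ℝ, 0 < κ → ∀ᶠ ε in 𝓝[>] 0, F ε ≤ ENNReal.ofReal κ) :
    Tendsto F (𝓝[>] 0) (𝓝 0) := by
  refine ENNReal.tendsto_nhds_zero.2 fun c hc => ?_
  by_cases hct : c = ⊤
  · exact Eventually.of_forall fun _ => hct ▸ le_top
  · have := h c.toReal (ENNReal.toReal_pos hc.ne' hct)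
    rwa [ENNReal.ofReal_toReal hct] at this

/-- There is an admissible pair at some scale `ε₀ < r`, with almost optimal energy, that coincides
with the interface outside of the column `|x₁| < 2 δ` and outside of the square. -/
theorem exists_admissible_almost_optimal (hlam : 0 < lam) (hτ : 0 < τ) (hRm : Rm ∈ SO2)
    (hRp : Rp ∈ SO2) {κ δ r : ℝ} (hκ : 0 < κ) (hδ : 0 < δ) (hδ' : δ < 1 / 4) (hr : 0 < r) :
    ∃ (ε : ℝ) (A : Plane → Mat) (S : Set Plane), 0 < ε ∧ ε < r ∧
      Admissible τ ε (square (1 / 2)) A S ∧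
      (∀ x ∉ square (1 / 2), A x = interfaceField Rm Rp x) ∧
      (∀ x : Plane, 2 * δ ≤ |x 0| → A x = interfaceField Rm Rp x) ∧
      (∀ x ∈ S, |x 0| ≤ 2 * δ) ∧
      pairEnergy lam ε (square (1 / 2)) A S (square (1 / 2)) ≤
        ENNReal.ofReal (ε * ((psiZero lam τ Rm Rp).toReal + κ)) := by
  classical
  have hfin : psiZero lam τ Rm Rp ≠ ⊤ := (psiZero_lt_top hlam hRm hRp).ne
  obtain ⟨p, hp⟩ : ∃ p, p = (psiZero lam τ Rm Rp).toReal := ⟨_, rfl⟩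
  have hp0 : 0 ≤ p := hp ▸ ENNReal.toReal_nonneg
  have hψ : psiZero lam τ Rm Rp = ENNReal.ofReal p := by rw [hp, ENNReal.ofReal_toReal hfin]
  have hκ2 : 0 < κ / 2 := by positivity
  obtain ⟨θ₀, hθ₀, ε₁, hε₁, H⟩ := exists_admissible_eq_interface hlam hτ
    (by positivity : 0 < p + κ / 2) hδ hδ' hκ2
  have hlt : psiZero lam τ Rm Rp < ENNReal.ofReal (p + κ / 2) := by
    rw [hψ]
    exact (ENNReal.ofReal_lt_ofReal_iff (by positivity)).2 (by linarith)
  unfold psiZero psiZeroOn at hlt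
  simp only [iInf_lt_iff] at hlt
  obtain ⟨A, S, hA, hL, hlt⟩ := hlt
  have hclose : ∀ᶠ ε in 𝓝[>] 0, ∫⁻ x in square (1 / 2), ENNReal.ofReal (frobNorm
      ((square (1 / 2) \ nbhd (square (1 / 2)) (lam * ε) (S ε)).indicator (A ε) x -
        interfaceField Rm Rp x)) ≤ ENNReal.ofReal θ₀ :=
    hL.eventually (Iic_mem_nhds (by simpa using hθ₀))
  have hfreq := frequently_lt_of_liminf_lt (by isBoundedDefault) hlt
  have hpos : ∀ᶠ ε : ℝ in 𝓝[>] 0, 0 < ε := self_mem_nhdsWithin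
  have hsm : ∀ᶠ ε : ℝ in 𝓝[>] 0, ε < min ε₁ r :=
    nhdsWithin_le_nhds (Iio_mem_nhds (lt_min hε₁ hr))
  obtain ⟨ε, ⟨⟨hE, hcl⟩, hε⟩, hεlt⟩ := (((hfreq.and_eventually hclose).and_eventually
    hpos).and_eventually hsm).exists
  rw [lt_min_iff] at hεlt
  have hE' : pairEnergy lam ε (square (1 / 2)) (A ε) (S ε) (square (1 / 2)) ≤
      ENNReal.ofReal ((p + κ / 2) * ε) := by
    rw [← ofReal_mul_ofReal_inv_mul hε (pairEnergy _ _ _ _ _ _), mul_comm (p + κ / 2),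
      ENNReal.ofReal_mul hε.le]
    exact mul_le_mul_right hE.le _
  have hm := measurableSet_square_diff_nbhd (1 / 2) (lam * ε) (S ε)
  have hcl' : ∫⁻ x in square (1 / 2) \ nbhd (square (1 / 2)) (lam * ε) (S ε),
      ENNReal.ofReal (frobNorm (A ε x - interfaceField Rm Rp x)) ≤ ENNReal.ofReal θ₀ := by
    refine le_trans ?_ ((lintegral_mono_set (Set.sdiff_subset
      (t := nbhd (square (1 / 2)) (lam * ε) (S ε)))).trans hcl)
    refine (setLIntegral_congr_fun hm fun x hx => ?_).le
    simp only [indicator_of_mem hx]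
  obtain ⟨A', S', hA', hAδ, hS', hE''⟩ := H ε (A ε) (S ε) Rm Rp hε hεlt.1 hRm hRp (hA ε hε) hE' hcl'
  let A'' : Plane → Mat := fun x => if x ∈ square (1 / 2) then A' x else interfaceField Rm Rp x
  have hA'' : ∀ x ∈ square (1 / 2), A'' x = A' x := fun x hx => if_pos hx
  refine ⟨ε, A'', S', hε, hεlt.2, hA'.congr_ae (isOpen_square _) (convex_square _) fun i j => ?_,
    fun x hx => if_neg hx, fun x hx => ?_, hS', ?_⟩
  · filter_upwards [ae_restrict_mem (measurableSet_square (1 / 2))] with x hx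
    rw [hA'' x hx]
  · by_cases h : x ∈ square (1 / 2)
    · rw [hA'' x h, hAδ x hx]
    · exact if_neg h
  · have hpe : pairEnergy lam ε (square (1 / 2)) A'' S' (square (1 / 2)) =
        pairEnergy lam ε (square (1 / 2)) A' S' (square (1 / 2)) := by
      unfold pairEnergy elasticEnergy
      rw [setLIntegral_congr_fun (measurableSet_square_diff_nbhd (1 / 2) (lam * ε) S')
        (g := fun x => ENNReal.ofReal (distSO2 (A' x) ^ 2))
        fun x hx => by simp only [hA'' x hx.1]]
    rw [hpe]
    refine (hE''.trans (add_le_add hE' le_rfl)).trans_eq ?_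
    rw [← ENNReal.ofReal_add (by positivity) (by positivity)]
    congr 1
    rw [← hp]
    ring

/-- For all small `ε` there is a field with energy close to `ψ₀`, which is close to the interface
in `L¹` and coincides with it away from the axis. -/
theorem eventually_exists_recovery (hlam : 0 < lam) (hτ : 0 < τ) (hRm : Rm ∈ SO2)
    (hRp : Rp ∈ SO2) {κ : ℝ} (hκ : 0 < κ) : ∀ᶠ ε in 𝓝[>] 0, ∃ A : Plane → Mat,
      IsL1 (square (1 / 2)) A ∧
      fieldEnergy lam τ ε (square (1 / 2)) A (square (1 / 2)) ≤
        psiZero lam τ Rm Rp + ENNReal.ofReal κ ∧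
      ∫⁻ x in square (1 / 2), ENNReal.ofReal (frobNorm (A x - interfaceField Rm Rp x)) ≤
        ENNReal.ofReal κ ∧
      ∀ x : Plane, κ < |x 0| → A x = interfaceField Rm Rp x := by
  obtain ⟨C, hC, H⟩ := exists_stack hlam hτ
  -- the width `δ` makes the segments between the copies cheap, the scale `ε₀` of the original pair
  -- makes the shear cheap, and the ratio of the scales makes the remaining rectangle cheap
  obtain ⟨δ, hδ, hδ8, hδC⟩ : ∃ δ : ℝ, 0 < δ ∧ δ < 1 / 8 ∧ C * δ ≤ κ / 4 := by
    refine ⟨min (1 / 16) (κ / (4 * C)), by positivity, ?_, ?_⟩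
    · exact (min_le_left _ _).trans_lt (by norm_num)
    · calc C * min (1 / 16) (κ / (4 * C)) ≤ C * (κ / (4 * C)) :=
            mul_le_mul_of_nonneg_left (min_le_right _ _) hC.le
        _ = κ / 4 := by field_simp
  obtain ⟨ε₀, A, S, hε₀, hlt, hA, hAQ, hAδ, hS, hE⟩ := exists_admissible_almost_optimal hlam hτ hRm
    hRp (by positivity : 0 < κ / 4) hδ (by linarith : δ < 1 / 4)
    (by positivity : 0 < min (δ / lam) (κ * δ / (4 * C)))
  rw [lt_min_iff, lt_div_iff₀ hlam, lt_div_iff₀ (by positivity)] at hlt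
  obtain ⟨D, hD⟩ : ∃ D, D = ∫⁻ x in square (1 / 2),
    ENNReal.ofReal (frobNorm (A x - interfaceField Rm Rp x)) := ⟨_, rfl⟩
  have hDt : D < ⊤ := by
    rw [hD]
    exact lintegral_frobNorm_lt_top
      (hA.integrable.sub (isL1_interfaceField (Rm := Rm) (Rp := Rp) (volume_square_lt_top _)))
  obtain ⟨p, hp⟩ : ∃ p, p = (psiZero lam τ Rm Rp).toReal := ⟨_, rfl⟩
  have hp0 : 0 ≤ p := hp ▸ ENNReal.toReal_nonneg
  have hψ : psiZero lam τ Rm Rp = ENNReal.ofReal p := by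
    rw [hp, ENNReal.ofReal_toReal (psiZero_lt_top hlam hRm hRp).ne]
  rw [← hp] at hE
  have hpos : ∀ᶠ ε : ℝ in 𝓝[>] 0, 0 < ε := self_mem_nhdsWithin
  have hsm : ∀ s : ℝ, 0 < s → ∀ᶠ ε : ℝ in 𝓝[>] 0, ε < s := fun s hs =>
    nhdsWithin_le_nhds (Iio_mem_nhds hs)
  filter_upwards [hpos, hsm ε₀ hε₀, hsm (κ * ε₀) (by positivity),
    hsm (κ * ε₀ ^ 2 / (64 * δ)) (by positivity),
    hsm (κ * ε₀ / (D.toReal + C * ε₀)) (by positivity)] with ε hε h1 h2 h3 h4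
  obtain ⟨h, hh⟩ : ∃ h, h = ε / ε₀ := ⟨_, rfl⟩
  have hεh : h * ε₀ = ε := by rw [hh, div_mul_cancel₀ _ hε₀.ne']
  have hh0 : 0 < h := by rw [hh]; positivity
  have b1 : h ≤ 1 := by
    rw [hh, div_le_one hε₀]
    exact h1.le
  have b2 : h < κ := by rwa [hh, div_lt_iff₀ hε₀]
  have b3 : 16 * δ * h ≤ κ / 4 * ε₀ := by
    rw [lt_div_iff₀ (by positivity), ← hεh] at h3
    have : h * (64 * δ) < κ * ε₀ := by nlinarith
    linarith
  have b4 : h * (D.toReal + C * ε₀) ≤ κ := by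
    rw [lt_div_iff₀ (by positivity), ← hεh] at h4
    have : h * (D.toReal + C * ε₀) < κ := by nlinarith
    exact this.le
  obtain ⟨A', S', hA', hAh, hE', hL'⟩ := H ε₀ δ h A S Rm Rp hε₀ hδ hδ8
    (by linarith [mul_comm lam ε₀]) hh0 b1 hRm hRp hA hAQ hAδ hS
  rw [hεh] at hA' hE'
  refine ⟨A', hA'.integrable, ?_, ?_, fun x hx => hAh x ?_⟩
  · have hE2 : pairEnergy lam ε (square (1 / 2)) A' S' (square (1 / 2)) ≤
        ENNReal.ofReal ε * ENNReal.ofReal (p + κ) := by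
      refine (hE'.trans (add_le_add (mul_le_mul_right hE _) le_rfl)).trans ?_
      rw [← ENNReal.ofReal_mul hh0.le, ← ENNReal.ofReal_mul hε.le,
        ← ENNReal.ofReal_add (by positivity) (by positivity), ← hεh]
      refine ENNReal.ofReal_le_ofReal ?_
      have c1 : C * ε₀ ^ 2 / δ ≤ κ / 4 * ε₀ := by
        rw [div_le_iff₀ hδ]
        nlinarith [hlt.2]
      have c2 : C * δ * ε₀ ≤ κ / 4 * ε₀ := mul_le_mul_of_nonneg_right hδC hε₀.le
      have := mul_le_mul_of_nonneg_left (add_le_add (add_le_add c1 c2) b3) hh0.le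
      linarith
    refine (mul_le_mul_right ((iInf₂_le S' hA').trans hE2) _).trans_eq ?_
    rw [ofReal_inv_mul_ofReal_mul hε, hψ, ENNReal.ofReal_add hp0 hκ.le]
  · refine hL'.trans ?_
    rw [← hD, ← ENNReal.ofReal_toReal hDt.ne, ← ENNReal.ofReal_mul hh0.le,
      ← ENNReal.ofReal_add (by positivity) (by positivity), ← mul_add]
    exact ENNReal.ofReal_le_ofReal b4
  · nlinarith

end Conclusion

end GrainBoundary

theorem theorem5p4 (lam τ : ℝ) (hlam : 0 < lam) (hτ : 0 < τ)
    (Rm Rp : GrainBoundary.Mat) (hRm : Rm ∈ GrainBoundary.SO2) (hRp : Rp ∈ GrainBoundary.SO2) :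
    ∃ A : ℝ → GrainBoundary.Plane → GrainBoundary.Mat,
      (∀ ε : ℝ, 0 < ε → GrainBoundary.IsL1 (GrainBoundary.square (1 / 2)) (A ε)) ∧
      GrainBoundary.TendstoL1 (GrainBoundary.square (1 / 2)) A
        (GrainBoundary.interfaceField Rm Rp) ∧
      Tendsto (fun ε : ℝ => GrainBoundary.fieldEnergy lam τ ε (GrainBoundary.square (1 / 2)) (A ε)
          (GrainBoundary.square (1 / 2)))
        (𝓝[>] 0) (𝓝 (GrainBoundary.psiZero lam τ Rm Rp)) ∧
      ∀ δ : ℝ, 0 < δ → δ < 1 / 4 →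
        ∀ᶠ ε : ℝ in 𝓝[>] 0, ∀ x : GrainBoundary.Plane, δ < |x 0| →
          A ε x = GrainBoundary.interfaceField Rm Rp x := by
  open GrainBoundary in
  obtain ⟨A, hA, hP⟩ := exists_diagonal (P := fun κ ε A => IsL1 (square (1 / 2)) A ∧
      fieldEnergy lam τ ε (square (1 / 2)) A (square (1 / 2)) ≤
        psiZero lam τ Rm Rp + ENNReal.ofReal κ ∧
      ∫⁻ x in square (1 / 2), ENNReal.ofReal (frobNorm (A x - interfaceField Rm Rp x)) ≤
        ENNReal.ofReal κ ∧
      ∀ x : Plane, κ < |x 0| → A x = interfaceField Rm Rp x)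
    (fun κ κ' ε A hκ hA => ⟨hA.1, hA.2.1.trans (add_le_add le_rfl (ENNReal.ofReal_le_ofReal hκ)),
      hA.2.2.1.trans (ENNReal.ofReal_le_ofReal hκ), fun x hx => hA.2.2.2 x (hκ.trans_lt hx)⟩)
    (fun κ hκ => eventually_exists_recovery hlam hτ hRm hRp hκ) (interfaceField Rm Rp)
  have hL1 : ∀ ε : ℝ, 0 < ε → GrainBoundary.IsL1 (GrainBoundary.square (1 / 2)) (A ε) := by
    intro ε _
    rcases hA ε with h | ⟨κ, h⟩
    · rw [h]
      exact GrainBoundary.isL1_interfaceField (GrainBoundary.volume_square_lt_top _)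
    · exact h.1
  have hlim : GrainBoundary.TendstoL1 (GrainBoundary.square (1 / 2)) A
      (GrainBoundary.interfaceField Rm Rp) :=
    GrainBoundary.tendsto_zero_of_eventually_le_ofReal fun κ hκ => (hP κ hκ).mono fun ε h => h.2.2.1
  exact ⟨A, hL1, hlim, GrainBoundary.tendsto_fieldEnergy hlam hRm hRp hL1 hlim
    fun κ hκ => (hP κ hκ).mono fun ε h => h.2.1, fun δ hδ _ => (hP δ hδ).mono fun ε h => h.2.2.2⟩
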